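/- **Setting.** Let $\mathcal Q=\{(u,v): 1\le u<\infty,\ u\le v<\infty\}$, with axis $\Gamma=\{u=v\}$, outgoing null curves $C_u=\{u\}\times[u,\infty)$ and incoming null curves $\underline C_v=[1,v]\times\{v\}$. For real functions $(\phi,r,m)$ on $\mathcal Q$ with $r\ge 0$ put $\lambda=\partial_v r$, $\nu=\partial_u r$, $\mu=2m/r$, $\Omega^2=-4\lambda\nu/(1-\mu)$. BV functions are taken right-continuous; derivatives of BV functions are (signed) measures and $|\cdot|$ of such a measure is its total variation measure. $(\phi,r,m)$ is a *solution* of the spherically symmetric Einstein-scalar-field system if $r=0$ exactly on $\Gamma$, $m=0$ on $\Gamma$, $v=2r+1$ on $C_1$, $\Omega^2>0$ off $\Gamma$, and $$\partial_u\lambda=\partial_v\nu=\frac{\mu\lambda\nu}{(1-\mu)r},\qquad 2\nu\,\partial_u m=(1-\mu)r^2(\partial_u\phi)^2,\qquad 2\lambda\,\partial_v m=(1-\mu)r^2(\partial_v\phi)^2,\qquad \partial_u\partial_v(r\phi)=\frac{\mu\lambda\nu}{(1-\mu)r}\phi .$$ It is a *BV solution* if on every $\mathcal D(u_0,v_0)=\{u_0\le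 u\le v\le v_0\}$, $1\le u_0\le v_0<\infty$: (i) $\sup(-\nu)<\infty$ and $\sup\lambda^{-1}<\infty$; (ii) $\lambda$ and $\partial_v(r\phi)$ are BV on each $C_u\cap\mathcal D(u_0,v_0)$ uniformly in $u$, and $\nu$ and $\partial_u(r\phi)$ are BV on each $\underline C_v\cap\mathcal D(u_0,v_0)$ uniformly in $v$; (iii) $\phi$ is absolutely continuous on each $C_u\cap\mathcal D(u_0,v_0)$ and each $\underline C_v\cap\mathcal D(u_0,v_0)$, with uniformly bounded total variation; and if for each $a\ge1$: (iv) $(\nu+\lambda)(a,a+\epsilon)\to0$ and $(\partial_v(r\phi)+\partial_u(r\phi))(a,a+\epsilon)\to0$ as $\epsilon\to0+$; (v) as $\epsilon\to0+$, the suprema over $0<\delta\le\epsilon$ of the total variations of $\phi$ on $\{a-\delta\}\times(a-\delta,a)$, on $(a-\epsilon,a-\delta)\times\{a-\delta\}$ (both for $a>1$), on $(a,a+\delta)\times\{a+\delta\}$ and on $\{a+\delta\}\times(a+\delta,a+\epsilon)$ tend to $0$. The radial null geodesics are *future complete* if the solution is defined on all of $\mathcal Q$ (so that each $\underline C_v$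 ends on $\Gamma$) and $\int_u^\infty\Omega^2(u,v)\,dv=\infty$ for every $u\ge1$. The solution *blows up at infinity* if at least one of the following holds: (1) $\sup_{u\ge1}\lambda_\Gamma(u)^{-1}=\infty$, where $\lambda_\Gamma(u)=\lim_{v\to u+}\lambda(u,v)$; (2) $\int_1^\infty\!\int_u^\infty|\partial_v\lambda\,\partial_u\phi-\partial_u\lambda\,\partial_v\phi|\,dv\,du=\infty$; (3) $\int_1^\infty\!\int_u^\infty|\partial_u\phi\,\partial_v(\nu^{-1}\partial_u(r\phi))-\partial_v\phi\,\partial_u(\nu^{-1}\partial_u(r\phi))|\,dv\,du=\infty$ (the integrands being measures in general). **Theorem.** Let $(\phi,r,m)$ be a BV solution with future complete radial null geodesics such that $\lim_{v\to\infty}\phi(1,v)=0$ and $$\int_{C_1}|\partial_v^2(r\phi)|+\sup_{C_1}|\partial_v(r\phi)|<\infty .$$ Then either the solution blows up at infinity, or $$\int_{C_u}|\partial_v^2(r\phi)|\to0\quad\text{and}\quad\int_{C_u}|\partial_v\log\lambda|\to0\qquad\text{as }u\to\infty,$$ and moreover, provided that the initial Bondi mass $\lim_{v\to\infty}m(1,v)$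 is finite, the Bondi mass $M(u)=\lim_{v\to\infty}m(u,v)$ exists for every $u\ge1$ and $\lim_{u\to\infty}M(u)=0$. In particular, if the initial Bondi mass is finite and the solution does not blow up at infinity, then it is globally BV scattering. -/

import Mathlib

open Set Filter Topology MeasureTheory
open scoped ENNReal

noncomputable section

namespace SSESF

/-! ### Functions on the quotient manifold

A function on the region `{(u, v) : 1 ≤ u ≤ v}` is a map `f : ℝ → ℝ → ℝ`, written `f u v`; its values
outside of that region never matter.  The axis is the diagonal `u = v`, the outgoing null curve `C_u`
is `{u} × [u, ∞)` and the incoming null curve with label `v` is `[1, v] × {v}`. -/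

/-- `∂_v f`, as a right derivative.  If `f u` is a primitive of a right-continuous function, this is
that function at every point; it is then the right-continuous representative of the weak derivative. -/
def dV (f : ℝ → ℝ → ℝ) (u v : ℝ) : ℝ := derivWithin (f u) (Ioi v) v

/-- `∂_u f`, as a right derivative. -/
def dU (f : ℝ → ℝ → ℝ) (u v : ℝ) : ℝ := derivWithin (fun u' => f u' v) (Ioi u) u

/-- `λ = ∂_v r`. -/
def lam (r : ℝ → ℝ → ℝ) : ℝ → ℝ → ℝ := dV r

/-- `ν = ∂_u r`. -/
def nu (r : ℝ → ℝ → ℝ) : ℝ → ℝ → ℝ := dU r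

/-- The function `r φ`. -/
def rphi (r φ : ℝ → ℝ → ℝ) (u v : ℝ) : ℝ := r u v * φ u v

/-- The mass ratio `μ = 2 m / r`. -/
def massRatio (r m : ℝ → ℝ → ℝ) (u v : ℝ) : ℝ := 2 * m u v / r u v

/-- `Ω² = - 4 λ ν / (1 - μ)`, where the metric of the quotient manifold is `- Ω² du dv`. -/
def OmegaSq (r m : ℝ → ℝ → ℝ) (u v : ℝ) : ℝ :=
  -4 * lam r u v * nu r u v / (1 - massRatio r m u v)

/-- The expression `μ λ ν / ((1 - μ) r)`. -/
def potential (r m : ℝ → ℝ → ℝ) (u v : ℝ) : ℝ :=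
  massRatio r m u v * lam r u v * nu r u v / ((1 - massRatio r m u v) * r u v)

/-- `f' = g` on `[a, b]`, in integrated form. -/
def IsPrimitiveOn (f g : ℝ → ℝ) (a b : ℝ) : Prop :=
  IntervalIntegrable g volume a b ∧ ∀ x ∈ Icc a b, f x - f a = ∫ t in a..x, g t

/-! ### Solutions -/

/-- `(φ, r, m)` solves the spherically symmetric Einstein-scalar-field system in Hawking mass form on
`{(u, v) : 1 ≤ u ≤ v}`, in double null coordinates with `v = 2 r + 1` on `C_1` and axis `u = v`. -/
structure IsSolution (φ r m : ℝ → ℝ → ℝ) : Prop where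
  /-- The axis is the set where `r` vanishes. -/
  r_axis : ∀ u, 1 ≤ u → r u u = 0
  r_pos : ∀ u v, 1 ≤ u → u < v → 0 < r u v
  m_axis : ∀ u, 1 ≤ u → m u u = 0
  /-- Normalization of the coordinate `v`. -/
  r_init : ∀ v, 1 ≤ v → v = 2 * r 1 v + 1
  /-- `- Ω² du dv` is a Lorentzian metric. -/
  OmegaSq_pos : ∀ u v, 1 ≤ u → u < v → 0 < OmegaSq r m u v
  /-- `∂_u λ = μ λ ν / ((1 - μ) r)`. -/
  eq_lam : ∀ v a b, 1 ≤ a → a ≤ b → b < v →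
    IsPrimitiveOn (fun u => lam r u v) (fun u => potential r m u v) a b
  /-- `∂_v ν = μ λ ν / ((1 - μ) r)`. -/
  eq_nu : ∀ u a b, 1 ≤ u → u < a → a ≤ b →
    IsPrimitiveOn (fun v => nu r u v) (fun v => potential r m u v) a b
  /-- `2 ν ∂_u m = (1 - μ) r² (∂_u φ)²`, up to the axis. -/
  eq_m_u : ∀ v, 1 ≤ v → IsPrimitiveOn (fun u => m u v)
    (fun u => (1 - massRatio r m u v) * r u v ^ 2 * dU φ u v ^ 2 / (2 * nu r u v)) 1 v
  /-- `2 λ ∂_v m = (1 - μ) r² (∂_v φ)²`, from the axis on. -/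
  eq_m_v : ∀ u v, 1 ≤ u → u ≤ v → IsPrimitiveOn (fun v => m u v)
    (fun v => (1 - massRatio r m u v) * r u v ^ 2 * dV φ u v ^ 2 / (2 * lam r u v)) u v
  /-- The wave equation, as `∂_u (∂_v (r φ)) = μ λ ν / ((1 - μ) r) φ`. -/
  eq_phi_u : ∀ v a b, 1 ≤ a → a ≤ b → b < v →
    IsPrimitiveOn (fun u => dV (rphi r φ) u v) (fun u => potential r m u v * φ u v) a b
  /-- The wave equation, as `∂_v (∂_u (r φ)) = μ λ ν / ((1 - μ) r) φ`. -/
  eq_phi_v : ∀ u a b, 1 ≤ u → u < a → a ≤ b →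
    IsPrimitiveOn (fun v => dU (rphi r φ) u v) (fun v => potential r m u v * φ u v) a b

/-- Solutions of bounded variation.  The compact domains of dependence are
`D(u₀, v₀) = {(u, v) : u₀ ≤ u ≤ v ≤ v₀}`.  First derivatives are considered off the axis, where they are
right-continuous by convention. -/
structure IsBVSolution (φ r m : ℝ → ℝ → ℝ) : Prop extends IsSolution φ r m where
  /-- `r` is the integral of its derivatives `λ` and `ν` on null segments. -/
  r_ac_v : ∀ u v₀, 1 ≤ u → u ≤ v₀ → AbsolutelyContinuousOnInterval (r u) u v₀
  r_ac_u : ∀ v, 1 ≤ v → AbsolutelyContinuousOnInterval (fun u => r u v) 1 v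
  /-- Right-continuity of `λ` and `∂_v (r φ)` in `v`, of `ν` and `∂_u (r φ)` in `u`. -/
  rightCts_lam : ∀ u v, 1 ≤ u → u < v → ContinuousWithinAt (lam r u) (Ici v) v
  rightCts_nu : ∀ u v, 1 ≤ u → u < v → ContinuousWithinAt (fun u' => nu r u' v) (Ici u) u
  rightCts_dV : ∀ u v, 1 ≤ u → u < v → ContinuousWithinAt (dV (rphi r φ) u) (Ici v) v
  rightCts_dU : ∀ u v, 1 ≤ u → u < v →
    ContinuousWithinAt (fun u' => dU (rphi r φ) u' v) (Ici u) u
  /-- `sup (- ν) < ∞` and `sup λ⁻¹ < ∞` on `D(u₀, v₀)`; note that `λ ≠ 0` since `Ω² > 0`. -/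
  bdd : ∀ u₀ v₀, 1 ≤ u₀ → u₀ ≤ v₀ → ∃ C : ℝ, ∀ u v, u₀ ≤ u → u < v → v ≤ v₀ →
    -nu r u v ≤ C ∧ (lam r u v)⁻¹ ≤ C
  bv_lam : ∀ u₀ v₀, 1 ≤ u₀ → u₀ ≤ v₀ → ∃ C : ℝ, ∀ u ∈ Icc u₀ v₀,
    eVariationOn (lam r u) (Ioc u v₀) ≤ ENNReal.ofReal C
  bv_nu : ∀ u₀ v₀, 1 ≤ u₀ → u₀ ≤ v₀ → ∃ C : ℝ, ∀ v ∈ Icc u₀ v₀,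
    eVariationOn (fun u => nu r u v) (Ico u₀ v) ≤ ENNReal.ofReal C
  axis_r : ∀ a, 1 ≤ a → Tendsto (fun ε => nu r a (a + ε) + lam r a (a + ε)) (𝓝[>] 0) (𝓝 0)
  phi_ac_v : ∀ u v₀, 1 ≤ u → u ≤ v₀ → AbsolutelyContinuousOnInterval (φ u) u v₀
  phi_ac_u : ∀ u₀ v, 1 ≤ u₀ → u₀ ≤ v → AbsolutelyContinuousOnInterval (fun u => φ u v) u₀ v
  bv_phi_v : ∀ u₀ v₀, 1 ≤ u₀ → u₀ ≤ v₀ → ∃ C : ℝ, ∀ u ∈ Icc u₀ v₀,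
    eVariationOn (φ u) (Icc u v₀) ≤ ENNReal.ofReal C
  bv_phi_u : ∀ u₀ v₀, 1 ≤ u₀ → u₀ ≤ v₀ → ∃ C : ℝ, ∀ v ∈ Icc u₀ v₀,
    eVariationOn (fun u => φ u v) (Icc u₀ v) ≤ ENNReal.ofReal C
  /-- The variation of `φ` does not concentrate on the axis.  (Below an axis point `(a, a)` there is a
  part of the region only if `1 < a`.) -/
  axis_phi_v_below : ∀ a, 1 < a → Tendsto (fun ε : ℝ => ⨆ δ ∈ Ioc 0 ε,
    eVariationOn (φ (a - δ)) (Ioo (a - δ) a)) (𝓝[>] 0) (𝓝 0)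
  axis_phi_u_below : ∀ a, 1 < a → Tendsto (fun ε : ℝ => ⨆ δ ∈ Ioc 0 ε,
    eVariationOn (fun u => φ u (a - δ)) (Ioo (a - ε) (a - δ))) (𝓝[>] 0) (𝓝 0)
  axis_phi_u_above : ∀ a, 1 ≤ a → Tendsto (fun ε : ℝ => ⨆ δ ∈ Ioc 0 ε,
    eVariationOn (fun u => φ u (a + δ)) (Ioo a (a + δ))) (𝓝[>] 0) (𝓝 0)
  axis_phi_v_above : ∀ a, 1 ≤ a → Tendsto (fun ε : ℝ => ⨆ δ ∈ Ioc 0 ε,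
    eVariationOn (φ (a + δ)) (Ioo (a + δ) (a + ε))) (𝓝[>] 0) (𝓝 0)
  bv_dV : ∀ u₀ v₀, 1 ≤ u₀ → u₀ ≤ v₀ → ∃ C : ℝ, ∀ u ∈ Icc u₀ v₀,
    eVariationOn (dV (rphi r φ) u) (Ioc u v₀) ≤ ENNReal.ofReal C
  bv_dU : ∀ u₀ v₀, 1 ≤ u₀ → u₀ ≤ v₀ → ∃ C : ℝ, ∀ v ∈ Icc u₀ v₀,
    eVariationOn (fun u => dU (rphi r φ) u v) (Ico u₀ v) ≤ ENNReal.ofReal C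
  axis_rphi : ∀ a, 1 ≤ a →
    Tendsto (fun ε => dV (rphi r φ) a (a + ε) + dU (rphi r φ) a (a + ε)) (𝓝[>] 0) (𝓝 0)

/-- Future completeness of radial null geodesics, for a solution on the whole region
`{(u, v) : 1 ≤ u ≤ v}`.  On this region each incoming null curve ends on the axis; the affine parameter
of the outgoing null geodesic `C_u` is `∫ Ω² dv`, and is required to be infinite. -/
def RadiallyComplete (r m : ℝ → ℝ → ℝ) : Prop :=
  ∀ u, 1 ≤ u → ∫⁻ v in Ioi u, ENNReal.ofReal (OmegaSq r m u v) = ⊤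

/-! ### Blow-up at infinity -/

open Classical in
/-- The distributional derivative `dg` of a right-continuous function `g` of bounded variation on
`[a, b]`, as a signed measure supported in `(a, b]`. -/
def distDeriv (g : ℝ → ℝ) (a b : ℝ) : SignedMeasure ℝ :=
  if h : BoundedVariationOn (fun x => g (max a (min b x))) univ then h.vectorMeasure else 0

/-- The total variation `∫_I |f dg + h dx|` on an open interval `I` of the signed measure `f dg + h dx`,
where `g` is right-continuous and locally of bounded variation; it is the supremum of the total
variations on the intervals `(a, b]` with `[a, b] ⊆ I`. -/
def formVariation (f g h : ℝ → ℝ) (I : Set ℝ) : ℝ≥0∞ :=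
  ⨆ (a : ℝ) (b : ℝ) (_ : a ≤ b) (_ : Icc a b ⊆ I),
    ((distDeriv g a b).withDensity f (ContinuousLinearMap.mul ℝ ℝ) +
      (volume.restrict (Ioc a b)).withDensityᵥ h).variation (Ioc a b)

/-- `ν⁻¹ ∂_u (r φ)`. -/
def nuInvDU (φ r : ℝ → ℝ → ℝ) (u v : ℝ) : ℝ := (nu r u v)⁻¹ * dU (rphi r φ) u v

/-- `∫_1^∞ ∫_u^∞ |∂_v λ ∂_u φ - ∂_u λ ∂_v φ| dv du`; here `∂_v λ dv` is a measure on each `C_u` and the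
other factors are functions. -/
def nullForm₁ (φ r : ℝ → ℝ → ℝ) : ℝ≥0∞ :=
  ∫⁻ u in Ioi (1 : ℝ), formVariation (fun v => dU φ u v) (fun v => lam r u v)
    (fun v => -(dU (lam r) u v * dV φ u v)) (Ioi u)

/-- `∫_1^∞ ∫_u^∞ |∂_u φ ∂_v (ν⁻¹ ∂_u (r φ)) - ∂_v φ ∂_u (ν⁻¹ ∂_u (r φ))| dv du`; here
`∂_u (ν⁻¹ ∂_u (r φ)) du` is a measure on each incoming null curve and the other factors are functions, so
the integration in `u` is carried out first. -/
def nullForm₂ (φ r : ℝ → ℝ → ℝ) : ℝ≥0∞ :=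
  ∫⁻ v in Ioi (1 : ℝ), formVariation (fun u => -dV φ u v) (fun u => nuInvDU φ r u v)
    (fun u => dU φ u v * dV (nuInvDU φ r) u v) (Ioo 1 v)

/-- `λ_Γ(u) = lim_{v → u+} λ(u, v)`. -/
def lamAxis (r : ℝ → ℝ → ℝ) (u : ℝ) : ℝ := Function.rightLim (lam r u) u

/-- Blow-up at infinity. -/
def BlowsUpAtInfinity (φ r : ℝ → ℝ → ℝ) : Prop :=
  (⨆ u ∈ Ici (1 : ℝ), (ENNReal.ofReal (lamAxis r u))⁻¹) = ⊤ ∨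
    nullForm₁ φ r = ⊤ ∨ nullForm₂ φ r = ⊤

/-! ### Scattering -/

/-- The initial Bondi mass `M(1) = lim_{v → ∞} m(1, v)` is finite. -/
def FiniteInitialBondiMass (m : ℝ → ℝ → ℝ) : Prop := ∃ M₁ : ℝ, Tendsto (m 1) atTop (𝓝 M₁)

/-- The Bondi masses `M(u) = lim_{v → ∞} m(u, v)` exist and `lim_{u → ∞} M(u) = 0`. -/
def VanishingFinalBondiMass (m : ℝ → ℝ → ℝ) : Prop :=
  ∃ M : ℝ → ℝ, (∀ u, 1 ≤ u → Tendsto (m u) atTop (𝓝 (M u))) ∧ Tendsto M atTop (𝓝 0)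

/-- The total variations of `∂_v (r φ)` and of `log λ` on `C_u ∩ {r ≤ R}` tend to zero as `u → ∞`. -/
def ScattersInBV (φ r : ℝ → ℝ → ℝ) (R : EReal) : Prop :=
  Tendsto (fun u => eVariationOn (dV (rphi r φ) u) {v | u < v ∧ (r u v : EReal) ≤ R}) atTop (𝓝 0) ∧
  Tendsto (fun u => eVariationOn (fun v => Real.log (lam r u v)) {v | u < v ∧ (r u v : EReal) ≤ R})
    atTop (𝓝 0)

end SSESF

end

/-! The equations hide two exact null structures. Put X = ν⁻¹∂_u(rφ), so that X - φ = r∂_uφ/ν. Since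
∂_u∂_v(rφ) = φ∂_uλ, the measure ∂_v²(rφ) - φ∂_vλ has u-derivative ∂_uλ∂_vφ - ∂_vλ∂_uφ. Since ∂_u
log(λ/(1-μ)) = (X - φ)∂_uφ, the measure ∂_v log(λ/(1-μ)) - (X - φ)∂_vφ has u-derivative ∂_uφ∂_vX -
∂_vφ∂_uX. Up to sign these are the integrands in the definition of blow-up, and `waveFn` and
`massFn` are primitives in v of the two measures. If the null forms are integrable, the variation of
either function on C_u is at most its variation on an earlier curve over v > u, plus a tail of a
convergent integral (`eVariationOn_waveFn_le`, `eVariationOn_massFn_le`). Hence both variations tend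
to zero.

To return to φ and λ, let f be the variation of `waveFn` on C_u. Averaging against λ dv from the
axis gives r|∂_vφ| ≤ f and ∫λ|∂_vφ| ≤ f. Where λ ≥ ℓ, it follows that ∫|∂_vφ| ≤ f/ℓ, and that log λ
differs from `massFn` by a function of variation at most 3(f/ℓ)². If λ_Γ ≥ c, a continuity argument
starting at the axis (`lam_ge_of_small`) therefore yields λ ≥ c/4 on all late curves, and then the
variation of log λ tends to zero. Finally ∂_v²(rφ) is the derivative of `waveFn` plus φ∂_vλ, so that
only a bound for φ is missing: the equation for ∂_u m, integrated from C_1, gives one at large v,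
and ∫|∂_vφ| ≤ f/ℓ spreads it over C_u.

If the initial Bondi mass is finite, the same mass argument gives φ(u,v) → 0 as v → ∞, so sup |φ|
over C_u is at most f/ℓ and tends to zero. Fix a late u₁. Then ∂_v(rφ) is square integrable on
C_{u₁}, and by ∂_u∂_v(rφ) = φ∂_uλ it changes afterwards by at most sup |φ| times the decrease of λ,
which is O(1/(1+v-u)). Because (∂_v(rφ))²/λ = r²(∂_vφ)²/λ + ∂_v(rφ²), the mass on C_u is controlled
by an L² tail on C_{u₁} and a small multiple of a fixed constant (`m_le`). -/

namespace SSESF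

/-! ### Absolutely continuous functions with a prescribed derivative -/

/-- `f` is absolutely continuous on `[a, b]` and its derivative is `g` almost everywhere. -/
structure HasAEDerivOn (f g : ℝ → ℝ) (a b : ℝ) : Prop where
  le : a ≤ b
  ac : AbsolutelyContinuousOnInterval f a b
  hasDerivAt : ∀ᵐ x, x ∈ Ioo a b → HasDerivAt f (g x) x

theorem absolutelyContinuousOnInterval_congr {f f' : ℝ → ℝ} {a b : ℝ}
    (hf : AbsolutelyContinuousOnInterval f a b) (h : EqOn f f' (uIcc a b)) :
    AbsolutelyContinuousOnInterval f' a b := by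
  rw [absolutelyContinuousOnInterval_iff] at hf ⊢
  intro ε hε
  obtain ⟨δ, hδ, H⟩ := hf ε hε
  refine ⟨δ, hδ, fun E hE hE' => ?_⟩
  have := H E hE hE'
  refine lt_of_eq_of_lt (Finset.sum_congr rfl fun i hi => ?_) this
  rw [h (hE.1 i hi).1, h (hE.1 i hi).2]

theorem absolutelyContinuousOnInterval_comp {F f : ℝ → ℝ} {a b : ℝ} {K : NNReal}
    (hf : AbsolutelyContinuousOnInterval f a b) (hF : LipschitzOnWith K F (f '' uIcc a b)) :
    AbsolutelyContinuousOnInterval (fun x => F (f x)) a b := by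
  rw [absolutelyContinuousOnInterval_iff] at hf ⊢
  intro ε hε
  obtain ⟨δ, hδ, H⟩ := hf (ε / (K + 1)) (by positivity)
  refine ⟨δ, hδ, fun E hE hE' => ?_⟩
  have h1 := H E hE hE'
  have h2 : ∑ i ∈ Finset.range E.1, dist (F (f (E.2 i).1)) (F (f (E.2 i).2)) ≤
      (K + 1) * ∑ i ∈ Finset.range E.1, dist (f (E.2 i).1) (f (E.2 i).2) := by
    rw [Finset.mul_sum]
    refine Finset.sum_le_sum fun i hi => ?_
    refine (hF.dist_le_mul _ (mem_image_of_mem _ (hE.1 i hi).1) _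
      (mem_image_of_mem _ (hE.1 i hi).2)).trans ?_
    gcongr
    linarith
  refine h2.trans_lt ?_
  calc (K + 1 : ℝ) * ∑ i ∈ Finset.range E.1, dist (f (E.2 i).1) (f (E.2 i).2)
      < (K + 1) * (ε / (K + 1)) := by gcongr
    _ = ε := by field_simp

namespace HasAEDerivOn

variable {f g f₁ g₁ f₂ g₂ : ℝ → ℝ} {a b : ℝ}

theorem congr (h : HasAEDerivOn f g a b) (hf : EqOn f f₁ (Icc a b)) : HasAEDerivOn f₁ g a b where
  le := h.le
  ac := absolutelyContinuousOnInterval_congr h.ac (by rwa [uIcc_of_le h.le])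
  hasDerivAt := by
    filter_upwards [h.hasDerivAt] with x hx hxm
    refine (hx hxm).congr_of_eventuallyEq ?_
    filter_upwards [Icc_mem_nhds hxm.1 hxm.2] with y hy using (hf hy).symm

theorem congr_deriv (h : HasAEDerivOn f g a b) (hg : ∀ x ∈ Ioo a b, g x = g₁ x) :
    HasAEDerivOn f g₁ a b where
  le := h.le
  ac := h.ac
  hasDerivAt := by
    filter_upwards [h.hasDerivAt] with x hx hxm
    exact hg x hxm ▸ hx hxm

theorem mono (h : HasAEDerivOn f g a b) {c d : ℝ} (hac : a ≤ c) (hcd : c ≤ d) (hdb : d ≤ b) :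
    HasAEDerivOn f g c d where
  le := hcd
  ac := h.ac.mono (by rw [uIcc_of_le hcd, uIcc_of_le h.le]; exact Icc_subset_Icc hac hdb)
  hasDerivAt := by
    filter_upwards [h.hasDerivAt] with x hx hxm
    exact hx ⟨hac.trans_lt hxm.1, hxm.2.trans_le hdb⟩

theorem deriv_ae_eq (h : HasAEDerivOn f g a b) :
    ∀ᵐ x, x ∈ uIoc a b → deriv f x = g x := by
  -- The derivative is prescribed only inside the open interval, while interval integrals run over
  -- `Ioc a b`.
  have hb : ∀ᵐ x : ℝ, x ≠ b := by simp [ae_iff]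
  filter_upwards [h.hasDerivAt, hb] with x hx hxb hxm
  rw [uIoc_of_le h.le] at hxm
  exact (hx ⟨hxm.1, lt_of_le_of_ne hxm.2 hxb⟩).deriv

theorem intervalIntegrable (h : HasAEDerivOn f g a b) : IntervalIntegrable g volume a b :=
  h.ac.intervalIntegrable_deriv.congr_ae ((ae_restrict_iff' measurableSet_uIoc).2 h.deriv_ae_eq)

theorem intervalIntegrable' (h : HasAEDerivOn f g a b) {x y : ℝ} (hx : a ≤ x) (hxy : x ≤ y)
    (hy : y ≤ b) : IntervalIntegrable g volume x y := (h.mono hx hxy hy).intervalIntegrable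

theorem sub_eq (h : HasAEDerivOn f g a b) : f b - f a = ∫ x in a..b, g x := by
  rw [← h.ac.integral_deriv_eq_sub]
  exact intervalIntegral.integral_congr_ae h.deriv_ae_eq

theorem sub_eq' (h : HasAEDerivOn f g a b) {x y : ℝ} (hx : a ≤ x) (hxy : x ≤ y)
    (hy : y ≤ b) : f y - f x = ∫ t in x..y, g t := (h.mono hx hxy hy).sub_eq

theorem continuousOn (h : HasAEDerivOn f g a b) : ContinuousOn f (Icc a b) := by
  have := h.ac.continuousOn
  rwa [uIcc_of_le h.le] at this

theorem of_integral (hab : a ≤ b) (hg : IntervalIntegrable g volume a b) (C : ℝ) :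
    HasAEDerivOn (fun x => C + ∫ t in a..x, g t) g a b where
  le := hab
  ac := by
    have h1 := hg.absolutelyContinuousOnInterval_intervalIntegral (c := a) (by simp)
    have h2 : AbsolutelyContinuousOnInterval (fun _ : ℝ => C) a b :=
      (LipschitzWith.const C).lipschitzOnWith.absolutelyContinuousOnInterval
    exact h2.add h1
  hasDerivAt := by
    filter_upwards [hg.ae_hasDerivAt_integral] with x hx hxm
    exact (hx (by rw [uIcc_of_le hab]; exact Ioo_subset_Icc_self hxm) a (by simp)).const_add C

theorem of_isPrimitiveOn (hab : a ≤ b) (h : IsPrimitiveOn f g a b) : HasAEDerivOn f g a b :=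
  (of_integral hab h.1 (f a)).congr fun x hx => by
    have := h.2 x hx
    simp only
    linarith

theorem of_absolutelyContinuous (hab : a ≤ b) (h : AbsolutelyContinuousOnInterval f a b) :
    HasAEDerivOn f (fun x => derivWithin f (Ioi x) x) a b where
  le := hab
  ac := h
  hasDerivAt := by
    filter_upwards [h.ae_differentiableAt] with x hx hxm
    have h1 := hx (by rw [uIcc_of_le hab]; exact Ioo_subset_Icc_self hxm)
    rw [h1.derivWithin (uniqueDiffWithinAt_Ioi x)]
    exact h1.hasDerivAt

theorem const (hab : a ≤ b) (C : ℝ) : HasAEDerivOn (fun _ => C) (fun _ => 0) a b where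
  le := hab
  ac := (LipschitzWith.const C).lipschitzOnWith.absolutelyContinuousOnInterval
  hasDerivAt := by
    filter_upwards with x _ using hasDerivAt_const x C

theorem add (h₁ : HasAEDerivOn f₁ g₁ a b) (h₂ : HasAEDerivOn f₂ g₂ a b) :
    HasAEDerivOn (fun x => f₁ x + f₂ x) (fun x => g₁ x + g₂ x) a b where
  le := h₁.le
  ac := h₁.ac.add h₂.ac
  hasDerivAt := by
    filter_upwards [h₁.hasDerivAt, h₂.hasDerivAt] with x hx hx' hxm using (hx hxm).add (hx' hxm)

theorem neg (h₁ : HasAEDerivOn f₁ g₁ a b) : HasAEDerivOn (fun x => -f₁ x) (fun x => -g₁ x) a b where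
  le := h₁.le
  ac := h₁.ac.neg
  hasDerivAt := by
    filter_upwards [h₁.hasDerivAt] with x hx hxm using (hx hxm).neg

theorem sub (h₁ : HasAEDerivOn f₁ g₁ a b) (h₂ : HasAEDerivOn f₂ g₂ a b) :
    HasAEDerivOn (fun x => f₁ x - f₂ x) (fun x => g₁ x - g₂ x) a b where
  le := h₁.le
  ac := h₁.ac.sub h₂.ac
  hasDerivAt := by
    filter_upwards [h₁.hasDerivAt, h₂.hasDerivAt] with x hx hx' hxm using (hx hxm).sub (hx' hxm)

theorem mul (h₁ : HasAEDerivOn f₁ g₁ a b) (h₂ : HasAEDerivOn f₂ g₂ a b) :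
    HasAEDerivOn (fun x => f₁ x * f₂ x) (fun x => g₁ x * f₂ x + f₁ x * g₂ x) a b where
  le := h₁.le
  ac := h₁.ac.mul h₂.ac
  hasDerivAt := by
    filter_upwards [h₁.hasDerivAt, h₂.hasDerivAt] with x hx hx' hxm using (hx hxm).mul (hx' hxm)

theorem comp {F F' : ℝ → ℝ} (h : HasAEDerivOn f g a b) {U : Set ℝ}
    (hfU : ∀ x ∈ Icc a b, f x ∈ U) (hF : ContDiffOn ℝ 1 F U)
    (hF' : ∀ y ∈ U, HasDerivAt F (F' y) y) :
    HasAEDerivOn (fun x => F (f x)) (fun x => F' (f x) * g x) a b where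
  le := h.le
  ac := by
    have hsub : f '' Icc a b ⊆ U := by rintro _ ⟨x, hx, rfl⟩; exact hfU x hx
    -- The image of [a, b] is a compact interval in `U`; on a compact convex set a C¹ function is
    -- Lipschitz, and Lipschitz maps preserve absolute continuity.
    have hconv : Convex ℝ (f '' Icc a b) :=
      ((isPreconnected_Icc.image f h.continuousOn).ordConnected).convex
    obtain ⟨K, hK⟩ := (hF.mono hsub).exists_lipschitzOnWith (by decide) hconv
      (isCompact_Icc.image_of_continuousOn h.continuousOn)
    exact absolutelyContinuousOnInterval_comp h.ac (by rwa [uIcc_of_le h.le])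
  hasDerivAt := by
    filter_upwards [h.hasDerivAt] with x hx hxm
    exact (hF' _ (hfU x (Ioo_subset_Icc_self hxm))).comp x (hx hxm)

theorem inv (h : HasAEDerivOn f g a b) (h0 : ∀ x ∈ Icc a b, f x ≠ 0) :
    HasAEDerivOn (fun x => (f x)⁻¹) (fun x => -g x / f x ^ 2) a b := by
  refine (h.comp (F := fun y => y⁻¹) (F' := fun y => -(y ^ 2)⁻¹) (U := {0}ᶜ)
    h0 ?_ ?_).congr_deriv ?_
  · intro y hy
    exact (contDiffAt_inv ℝ hy).contDiffWithinAt
  · intro y hy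
    exact hasDerivAt_inv hy
  · intro x _
    ring

theorem div (h₁ : HasAEDerivOn f₁ g₁ a b) (h₂ : HasAEDerivOn f₂ g₂ a b)
    (h0 : ∀ x ∈ Icc a b, f₂ x ≠ 0) :
    HasAEDerivOn (fun x => f₁ x / f₂ x) (fun x => (g₁ x - f₁ x / f₂ x * g₂ x) / f₂ x) a b := by
  refine ((h₁.mul (h₂.inv h0)).congr fun x _ => ?_).congr_deriv fun x hx => ?_
  · simp only [div_eq_mul_inv]
  · have := h0 x (Ioo_subset_Icc_self hx)
    field_simp
    ring

theorem log (h : HasAEDerivOn f g a b) (h0 : ∀ x ∈ Icc a b, f x ≠ 0) :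
    HasAEDerivOn (fun x => Real.log (f x)) (fun x => g x / f x) a b := by
  refine (h.comp (F := Real.log) (F' := fun y => y⁻¹) (U := {0}ᶜ)
    h0 ?_ ?_).congr_deriv ?_
  · intro y hy
    exact (Real.contDiffAt_log.2 hy).contDiffWithinAt
  · intro y hy
    exact Real.hasDerivAt_log hy
  · intro x _
    rw [div_eq_inv_mul]

theorem abs_sub_le (h : HasAEDerivOn f g a b) : |f b - f a| ≤ ∫ x in a..b, |g x| := by
  rw [h.sub_eq]
  exact intervalIntegral.abs_integral_le_integral_abs h.le

theorem le_of_nonneg (h : HasAEDerivOn f g a b) (hg : ∀ x ∈ Ioo a b, 0 ≤ g x) : f a ≤ f b := by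
  have h1 := h.sub_eq
  have h2 : 0 ≤ ∫ x in a..b, g x := by
    rw [intervalIntegral.integral_of_le h.le, integral_Ioc_eq_integral_Ioo]
    exact setIntegral_nonneg measurableSet_Ioo hg
  linarith

theorem le_of_nonpos (h : HasAEDerivOn f g a b) (hg : ∀ x ∈ Ioo a b, g x ≤ 0) : f b ≤ f a := by
  have := h.neg.le_of_nonneg fun x hx => by linarith [hg x hx]
  linarith

theorem sub_le_sub (h₁ : HasAEDerivOn f₁ g₁ a b) (h₂ : HasAEDerivOn f₂ g₂ a b)
    (hg : ∀ x ∈ Ioo a b, g₁ x ≤ g₂ x) : f₁ b - f₁ a ≤ f₂ b - f₂ a := by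
  have := (h₂.sub h₁).le_of_nonneg fun x hx => by linarith [hg x hx]
  linarith

/-- The form in which pointwise estimates are integrated: the majorant of |f₁'| is the derivative of
an explicit function, so no integral has to be computed. -/
theorem abs_sub_le_sub (h₁ : HasAEDerivOn f₁ g₁ a b) (h₂ : HasAEDerivOn f₂ g₂ a b)
    (hg : ∀ x ∈ Ioo a b, |g₁ x| ≤ g₂ x) : |f₁ b - f₁ a| ≤ f₂ b - f₂ a := by
  rw [abs_le]
  have h3 := h₁.sub_le_sub h₂ fun x hx => (abs_le.1 (hg x hx)).2
  have h4 := h₁.neg.sub_le_sub h₂ fun x hx => by linarith [(abs_le.1 (hg x hx)).1]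
  constructor <;> linarith

/-- At a point of right-continuity of g the fundamental theorem of calculus applies from the right.
This upgrades equations valid almost everywhere to identities between right derivatives at every
point. -/
theorem hasDerivWithinAt (h : HasAEDerivOn f g a b) {x : ℝ} (hx : x ∈ Ico a b)
    (hg : ContinuousWithinAt g (Ici x) x) : HasDerivWithinAt f (g x) (Ioi x) x := by
  have hm : StronglyMeasurableAtFilter g (𝓝[>] x) := by
    refine ⟨Ioc x b, Ioc_mem_nhdsGT hx.2, ?_⟩
    have := (h.intervalIntegrable' hx.1 hx.2.le le_rfl).1
    exact this.aestronglyMeasurable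
  have h1 : HasDerivWithinAt (fun y => ∫ t in x..y, g t) (g x) (Ioi x) x :=
    (intervalIntegral.integral_hasDerivWithinAt_right (s := Ici x) (t := Ioi x)
      (by simp) hm (hg.mono Ioi_subset_Ici_self)).mono Ioi_subset_Ici_self
  refine (h1.const_add (f x)).congr_of_eventuallyEq ?_ (by simp)
  filter_upwards [Ioc_mem_nhdsGT hx.2] with y hy
  have := h.sub_eq' hx.1 hy.1.le hy.2
  linarith

end HasAEDerivOn

/-- The variation of a function whose increments are bounded by the sum of those of two others. -/
theorem eVariationOn_le_add {f f₁ : ℝ → ℝ} {s : Set ℝ} {H : ℝ → ℝ} {B : ℝ}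
    (h : ∀ x ∈ s, ∀ y ∈ s, x ≤ y → |f y - f x| ≤ |f₁ y - f₁ x| + (H y - H x))
    (hH : ∀ x ∈ s, ∀ y ∈ s, x ≤ y → 0 ≤ H y - H x)
    (hB : ∀ x ∈ s, ∀ y ∈ s, x ≤ y → H y - H x ≤ B) :
    eVariationOn f s ≤ eVariationOn f₁ s + ENNReal.ofReal B := by
  refine iSup_le fun p => ?_
  obtain ⟨n, t, ht, hts⟩ := p
  have hH' : ∀ i, 0 ≤ H (t (i + 1)) - H (t i) :=
    fun i => hH _ (hts i) _ (hts (i + 1)) (ht i.le_succ)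
  have h1 : ∀ i, edist (f (t (i + 1))) (f (t i)) ≤
      edist (f₁ (t (i + 1))) (f₁ (t i)) + ENNReal.ofReal (H (t (i + 1)) - H (t i)) :=
    fun i => by
      rw [edist_dist, Real.dist_eq, edist_dist, Real.dist_eq,
        ← ENNReal.ofReal_add (abs_nonneg _) (hH' i)]
      exact ENNReal.ofReal_le_ofReal (h _ (hts i) _ (hts (i + 1)) (ht i.le_succ))
  calc ∑ i ∈ Finset.range n, edist (f (t (i + 1))) (f (t i))
      ≤ ∑ i ∈ Finset.range n, edist (f₁ (t (i + 1))) (f₁ (t i)) +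
        ∑ i ∈ Finset.range n, ENNReal.ofReal (H (t (i + 1)) - H (t i)) := by
        rw [← Finset.sum_add_distrib]
        exact Finset.sum_le_sum fun i _ => h1 i
    _ = ∑ i ∈ Finset.range n, edist (f₁ (t (i + 1))) (f₁ (t i)) +
        ENNReal.ofReal (H (t n) - H (t 0)) := by
        rw [← ENNReal.ofReal_sum_of_nonneg fun i _ => hH' i,
          Finset.sum_range_sub (fun i => H (t i))]
    _ ≤ _ := add_le_add (eVariationOn.sum_le ht hts)
        (ENNReal.ofReal_le_ofReal (hB _ (hts 0) _ (hts n) (ht n.zero_le)))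

end SSESF

namespace SSESF

/-! ### The signed measures `f dg + h dx` -/

section DistDeriv

variable {g : ℝ → ℝ} {a b : ℝ}

/-- Clamping is monotone with values in [a, b], so it cannot increase the variation. -/
theorem boundedVariationOn_clamp (hab : a ≤ b) (hg : BoundedVariationOn g (Icc a b)) :
    BoundedVariationOn (fun x => g (max a (min b x))) univ := by
  have h : eVariationOn (g ∘ fun x => max a (min b x)) univ ≤ eVariationOn g (Icc a b) :=
    eVariationOn.comp_le_of_monotoneOn g _
      (fun x _ y _ hxy => max_le_max le_rfl (min_le_min le_rfl hxy))
      (fun x _ => ⟨le_max_left _ _, max_le hab (min_le_left _ _)⟩)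
  exact ne_top_of_le_ne_top hg h

theorem rightLim_clamp (hab : a ≤ b) (hr : ∀ x ∈ Ico a b, ContinuousWithinAt g (Ici x) x) (x : ℝ) :
    Function.rightLim (fun x => g (max a (min b x))) x = g (max a (min b x)) := by
  apply ContinuousWithinAt.rightLim_eq
  rcases lt_or_ge x a with hxa | hxa
  · refine (continuousWithinAt_const (b := g a)).congr_of_eventuallyEq ?_ ?_
    · filter_upwards [Ico_mem_nhdsGE hxa] with y hy
      rw [min_eq_right (hy.2.le.trans hab), max_eq_left hy.2.le]
    · rw [min_eq_right (hxa.le.trans hab), max_eq_left hxa.le]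
  · rcases lt_or_ge x b with hxb | hxb
    · refine (hr x ⟨hxa, hxb⟩).congr_of_eventuallyEq ?_ ?_
      · filter_upwards [Ico_mem_nhdsGE hxb] with y hy
        rw [min_eq_right hy.2.le, max_eq_right (hxa.trans hy.1)]
      · rw [min_eq_right hxb.le, max_eq_right hxa]
    · refine (continuousWithinAt_const (b := g b)).congr_of_eventuallyEq ?_ ?_
      · filter_upwards [self_mem_nhdsWithin] with y hy
        rw [min_eq_left (hxb.trans hy), max_eq_right hab]
      · rw [min_eq_left hxb, max_eq_right hab]

theorem distDeriv_Ioc (hab : a ≤ b) (hg : BoundedVariationOn g (Icc a b))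
    (hr : ∀ x ∈ Ico a b, ContinuousWithinAt g (Ici x) x) {c d : ℝ} (hcd : c ≤ d) :
    distDeriv g a b (Ioc c d) = g (max a (min b d)) - g (max a (min b c)) := by
  rw [distDeriv, dif_pos (boundedVariationOn_clamp hab hg),
    BoundedVariationOn.vectorMeasure_Ioc _ hcd,
    rightLim_clamp hab hr, rightLim_clamp hab hr]

theorem distDeriv_univ (hab : a ≤ b) (hg : BoundedVariationOn g (Icc a b)) :
    distDeriv g a b univ = g b - g a := by
  rw [distDeriv, dif_pos (boundedVariationOn_clamp hab hg), BoundedVariationOn.vectorMeasure_univ]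
  congr 1
  · refine Tendsto.limUnder_eq (tendsto_const_nhds.congr' ?_)
    filter_upwards [eventually_ge_atTop b] with x hx
    rw [min_eq_left hx, max_eq_right hab]
  · refine Tendsto.limUnder_eq (tendsto_const_nhds.congr' ?_)
    filter_upwards [eventually_le_atBot a] with x hx
    rw [min_eq_right (hx.trans hab), max_eq_left hx]

/-- Both sides agree on half-open intervals, which form a π-system generating the Borel sets, and on
the whole line. As a consequence a function only has to be controlled on [a, b] to be integrable
against the measure. -/
theorem distDeriv_restrict (hab : a ≤ b) (hg : BoundedVariationOn g (Icc a b))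
    (hr : ∀ x ∈ Ico a b, ContinuousWithinAt g (Ici x) x) :
    (distDeriv g a b).restrict (Ioc a b) = distDeriv g a b := by
  refine VectorMeasure.ext_of_generateFrom {s | ∃ u v, u ≤ v ∧ s = Ioc u v} ?_ ?_ ?_ ?_
  · rintro s ⟨c, d, hcd, rfl⟩
    rw [VectorMeasure.restrict_apply _ measurableSet_Ioc measurableSet_Ioc, Ioc_inter_Ioc,
      distDeriv_Ioc hab hg hr hcd]
    rcases le_or_gt (c ⊔ a) (d ⊓ b) with h | h
    · rw [distDeriv_Ioc hab hg hr h]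
      congr 2
      · simp only [min_def, max_def]
        split_ifs <;> linarith
      · simp only [min_def, max_def]
        split_ifs <;> linarith
    · rw [Ioc_eq_empty (not_lt.2 h.le), VectorMeasure.empty, eq_comm, sub_eq_zero]
      congr 1
      simp only [min_def, max_def] at h ⊢
      split_ifs at h ⊢ <;> linarith
  · rw [BorelSpace.measurable_eq (α := ℝ)]
    convert! borel_eq_generateFrom_Ioc_le ℝ using 2
    ext s
    constructor
    · rintro ⟨u, v, huv, rfl⟩
      exact ⟨u, v, huv, rfl⟩
    · rintro ⟨u, v, huv, rfl⟩
      exact ⟨u, v, huv, rfl⟩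
  · exact IsSetSemiring.Ioc.isPiSystem
  · rw [VectorMeasure.restrict_apply _ measurableSet_Ioc MeasurableSet.univ, univ_inter,
      distDeriv_univ hab hg, distDeriv_Ioc hab hg hr hab]
    simp [hab]

theorem variation_distDeriv_restrict (hab : a ≤ b) (hg : BoundedVariationOn g (Icc a b))
    (hr : ∀ x ∈ Ico a b, ContinuousWithinAt g (Ici x) x) :
    (distDeriv g a b).variation.restrict (Ioc a b) = (distDeriv g a b).variation := by
  rw [← VectorMeasure.variation_restrict measurableSet_Ioc, distDeriv_restrict hab hg hr]

instance : IsFiniteMeasure (distDeriv g a b).variation := by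
  rw [← SignedMeasure.totalVariation_eq_variation]
  infer_instance

theorem integrable_distDeriv (hab : a ≤ b) (hg : BoundedVariationOn g (Icc a b))
    (hr : ∀ x ∈ Ico a b, ContinuousWithinAt g (Ici x) x) {f : ℝ → ℝ}
    (hf : ContinuousOn f (Icc a b)) : (distDeriv g a b).Integrable f := by
  have h : IntegrableOn f (Icc a b) (distDeriv g a b).variation := hf.integrableOn_Icc
  have h2 := h.mono_set (Ioc_subset_Icc_self (a := a) (b := b))
  rwa [IntegrableOn, variation_distDeriv_restrict hab hg hr] at h2

/-- An additive function of intervals that is small to second order vanishes. -/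
theorem eq_zero_of_abs_sub_le_mul {D M W : ℝ → ℝ} (hab : a ≤ b) (hW : ContinuousOn W (Icc a b))
    (h : ∀ c ∈ Icc a b, ∀ d ∈ Icc a b, c ≤ d → |D d - D c| ≤ (M d - M c) * (W d - W c))
    (hM : MonotoneOn M (Icc a b)) (hWm : MonotoneOn W (Icc a b)) : D b = D a := by
  rcases hab.eq_or_lt with rfl | hlt
  · rfl
  have key : ∀ ε > 0, |D b - D a| ≤ (M b - M a) * ε := by
    intro ε hε
    have huc := isCompact_Icc.uniformContinuousOn_of_continuous hW
    obtain ⟨δ, hδ, H⟩ := Metric.uniformContinuousOn_iff.1 huc ε hε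
    obtain ⟨N, hN⟩ := exists_nat_gt ((b - a) / δ)
    have hN0 : (0 : ℝ) < N := lt_of_le_of_lt (by have := sub_pos.2 hlt; positivity) hN
    -- On a uniform partition of mesh below δ each increment of W is at most ε, so the bounds add up
    -- to ε times the total increment of M.
    let t : ℕ → ℝ := fun k => a + (b - a) * k / N
    have ht : ∀ k, k ≤ N → t k ∈ Icc a b := by
      intro k hk
      have hk' : (k : ℝ) ≤ N := by exact_mod_cast hk
      have hba := sub_pos.2 hlt
      refine ⟨?_, ?_⟩
      · have : 0 ≤ (b - a) * k / N := by positivity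
        simp only [t]; linarith
      · have : (b - a) * k / N ≤ b - a := by
          rw [div_le_iff₀ hN0]
          gcongr
        simp only [t]; linarith
    have hind : ∀ k, k ≤ N → |D (t k) - D a| ≤ (M (t k) - M a) * ε := by
      intro k
      induction k with
      | zero => intro _; simp [t]
      | succ k ih =>
        intro hk
        have ih' := ih (by omega)
        have hm1 := ht k (by omega)
        have hm2 := ht (k + 1) hk
        have hle : t k ≤ t (k + 1) := by
          have hba := sub_pos.2 hlt
          simp only [t]
          gcongr
          linarith
        have h1 := h _ hm1 _ hm2 hle
        have hdist : dist (t (k + 1)) (t k) < δ := by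
          rw [Real.dist_eq, abs_of_nonneg (by linarith)]
          have : t (k + 1) - t k = (b - a) / N := by
            simp only [t]; push_cast; field_simp; ring
          rw [this, div_lt_iff₀ hN0]
          rw [div_lt_iff₀ hδ] at hN
          linarith
        have h2 := H _ hm2 _ hm1 hdist
        rw [Real.dist_eq] at h2
        have h3 : W (t (k + 1)) - W (t k) ≤ ε := (le_abs_self _).trans h2.le
        have h4 : 0 ≤ M (t (k + 1)) - M (t k) := sub_nonneg.2 (hM hm1 hm2 hle)
        have h5 := mul_le_mul_of_nonneg_left h3 h4
        have h6 : D (t (k + 1)) - D a = (D (t (k + 1)) - D (t k)) + (D (t k) - D a) := by ring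
        rw [h6]
        refine (abs_add_le _ _).trans ?_
        nlinarith
    have hb : t N = b := by simp only [t]; field_simp; ring
    simpa [hb] using hind N le_rfl
  have hMab : 0 ≤ M b - M a := sub_nonneg.2 (hM ⟨le_rfl, hab⟩ ⟨hab, le_rfl⟩ hab)
  have h0 : |D b - D a| ≤ 0 := by
    refine le_of_forall_pos_le_add fun ε hε => ?_
    refine (key (ε / (M b - M a + 1)) (by positivity)).trans ?_
    rw [zero_add, mul_div_assoc', div_le_iff₀ (by positivity)]
    nlinarith
  exact sub_eq_zero.1 (abs_nonpos_iff.1 h0)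

/-- Freezing f at the left endpoint makes the integral exact; the error is the oscillation of f
times the total variation. -/
theorem setIntegral_distDeriv_sub (hab : a ≤ b) (hg : BoundedVariationOn g (Icc a b))
    (hr : ∀ x ∈ Ico a b, ContinuousWithinAt g (Ici x) x) {f : ℝ → ℝ}
    (hf : ContinuousOn f (Icc a b)) {c d : ℝ} (hc : a ≤ c) (hcd : c ≤ d) (hd : d ≤ b) {K : ℝ}
    (hK : ∀ x ∈ Icc c d, |f x - f c| ≤ K) :
    |(∫ᵛ x in Ioc c d, f x ∂[ContinuousLinearMap.mul ℝ ℝ; distDeriv g a b]) - f c * (g d - g c)| ≤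
      K * (distDeriv g a b).variation.real (Ioc c d) := by
  have hint : (distDeriv g a b).IntegrableOn f (Ioc c d) :=
    VectorMeasure.Integrable.integrableOn (integrable_distDeriv hab hg hr hf)
  have hconst : (∫ᵛ x in Ioc c d, f c ∂[ContinuousLinearMap.mul ℝ ℝ; distDeriv g a b]) =
      f c * (g d - g c) := by
    rw [VectorMeasure.integral_const,
      VectorMeasure.restrict_apply _ measurableSet_Ioc MeasurableSet.univ,
      univ_inter, distDeriv_Ioc hab hg hr hcd, min_eq_right hd, min_eq_right (hcd.trans hd),
      max_eq_right hc, max_eq_right (hc.trans hcd)]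
    rfl
  rw [← hconst, ← VectorMeasure.integral_fun_sub hint (integrable_const _)]
  have h1 := VectorMeasure.norm_integral_le_of_norm_le_const (B := ContinuousLinearMap.mul ℝ ℝ)
    (μ := (distDeriv g a b).restrict (Ioc c d)) (f := fun x => f x - f c) (C := K) (by
      rw [VectorMeasure.variation_restrict measurableSet_Ioc, ae_restrict_iff' measurableSet_Ioc]
      exact Eventually.of_forall fun x hx => hK x (Ioc_subset_Icc_self hx))
  rw [VectorMeasure.variation_restrict measurableSet_Ioc, ContinuousLinearMap.opNorm_mul,
    mul_one] at h1
  simpa [Measure.real] using h1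

/-- Integration by parts against the derivative of a function of bounded variation. -/
theorem setIntegral_distDeriv_eq (hab : a ≤ b) (hg : BoundedVariationOn g (Icc a b))
    (hr : ∀ x ∈ Ico a b, ContinuousWithinAt g (Ici x) x) {f f' : ℝ → ℝ}
    (hf : HasAEDerivOn f f' a b) (hgm : IntervalIntegrable (fun x => f' x * g x) volume a b)
    {c d : ℝ} (hc : a ≤ c) (hcd : c ≤ d) (hd : d ≤ b) :
    (∫ᵛ x in Ioc c d, f x ∂[ContinuousLinearMap.mul ℝ ℝ; distDeriv g a b]) =
      f d * g d - f c * g c - ∫ x in c..d, f' x * g x := by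
  set μ := distDeriv g a b with hμ
  have hint : ∀ s, μ.IntegrableOn f s := fun s =>
    VectorMeasure.Integrable.integrableOn (integrable_distDeriv hab hg hr hf.continuousOn)
  have hadd : ∀ x y, c ≤ x → x ≤ y →
      (∫ᵛ t in Ioc c y, f t ∂[ContinuousLinearMap.mul ℝ ℝ; μ]) -
      (∫ᵛ t in Ioc c x, f t ∂[ContinuousLinearMap.mul ℝ ℝ; μ]) =
      ∫ᵛ t in Ioc x y, f t ∂[ContinuousLinearMap.mul ℝ ℝ; μ] := by
    intro x y hcx hxy
    rw [← Ioc_union_Ioc_eq_Ioc hcx hxy, VectorMeasure.setIntegral_union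
      (Ioc_disjoint_Ioc_of_le le_rfl) measurableSet_Ioc measurableSet_Ioc (hint _) (hint _)]
    ring
  have hii : ∀ {x y}, a ≤ x → x ≤ y → y ≤ b → IntervalIntegrable (fun x => f' x * g x) volume x y :=
    fun h1 h2 h3 => hgm.mono_set (by rw [uIcc_of_le h2, uIcc_of_le hab]; exact Icc_subset_Icc h1 h3)
  have hf'i : ∀ {x y}, a ≤ x → x ≤ y → y ≤ b → IntervalIntegrable (fun x => |f' x|) volume x y :=
    fun h1 h2 h3 => (hf.intervalIntegrable' h1 h2 h3).abs
  let D : ℝ → ℝ := fun y => (∫ᵛ t in Ioc c y, f t ∂[ContinuousLinearMap.mul ℝ ℝ; μ]) - f y * g y +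
    ∫ x in c..y, f' x * g x
  -- D is the defect in the integration by parts. On a short interval it has two errors: freezing f
  -- at the left endpoint and freezing g at the right endpoint. Each is at most the total variation
  -- of `μ` times ∫|f'|, hence the factor 2 and the second-order bound that forces D to be constant.
  let M : ℝ → ℝ := fun y => 2 * μ.variation.real (Ioc c y)
  let W : ℝ → ℝ := fun y => ∫ x in c..y, |f' x|
  have hMsub : ∀ x y, c ≤ x → x ≤ y → M y - M x = 2 * μ.variation.real (Ioc x y) := by
    intro x y hcx hxy
    have : μ.variation.real (Ioc c y) = μ.variation.real (Ioc c x) + μ.variation.real (Ioc x y) :=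
      by
      rw [← Ioc_union_Ioc_eq_Ioc hcx hxy, measureReal_union (Ioc_disjoint_Ioc_of_le le_rfl)
        measurableSet_Ioc]
    simp only [M]
    linarith
  have hWsub : ∀ x y, c ≤ x → x ≤ y → y ≤ d → W y - W x = ∫ t in x..y, |f' t| := by
    intro x y hcx hxy hyd
    exact intervalIntegral.integral_interval_sub_left (hf'i hc (hcx.trans hxy) (hyd.trans hd))
      (hf'i hc hcx (hxy.trans (hyd.trans hd)))
  have hWnn : ∀ x y, x ≤ y → 0 ≤ ∫ t in x..y, |f' t| := fun x y hxy =>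
    intervalIntegral.integral_nonneg hxy fun _ _ => abs_nonneg _
  have hmain : D d = D c := by
    refine eq_zero_of_abs_sub_le_mul (M := M) (W := W) hcd ?_ ?_ ?_ ?_
    · have := (HasAEDerivOn.of_integral hcd (hf'i hc hcd hd) 0).continuousOn
      simpa [W] using this
    · intro x hx y hy hxy
      have hax := hc.trans hx.1
      have hyb := hy.2.trans hd
      have h1 := setIntegral_distDeriv_sub hab hg hr hf.continuousOn hax hxy hyb
        (K := ∫ t in x..y, |f' t|) (fun z hz => by
          refine (hf.mono hax hz.1 (hz.2.trans hyb)).abs_sub_le.trans ?_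
          have := intervalIntegral.integral_add_adjacent_intervals
            (hf'i hax hz.1 (hz.2.trans hyb)) (hf'i (hax.trans hz.1) hz.2 hyb)
          linarith [hWnn z y hz.2])
      have h2 : |(f y - f x) * g y - ∫ t in x..y, f' t * g t| ≤
          μ.variation.real (Ioc x y) * ∫ t in x..y, |f' t| := by
        rw [hf.sub_eq' hax hxy hyb, ← intervalIntegral.integral_mul_const,
          ← intervalIntegral.integral_sub ((hf.intervalIntegrable' hax hxy hyb).mul_const _)
            (hii hax hxy hyb), ← intervalIntegral.integral_const_mul]
        refine (intervalIntegral.abs_integral_le_integral_abs hxy).trans ?_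
        refine intervalIntegral.integral_mono_on hxy
          (((hf.intervalIntegrable' hax hxy hyb).mul_const _).sub (hii hax hxy hyb)).abs
          ((hf'i hax hxy hyb).const_mul _) fun t ht => ?_
        rw [← mul_sub, abs_mul, mul_comm]
        refine mul_le_mul_of_nonneg_right ?_ (abs_nonneg _)
        have h3 : g y - g t = μ (Ioc t y) := by
          rw [hμ, distDeriv_Ioc hab hg hr ht.2, min_eq_right hyb, min_eq_right (ht.2.trans hyb),
            max_eq_right (hax.trans ht.1), max_eq_right (hax.trans hxy)]
        rw [h3, ← Real.norm_eq_abs]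
        refine (VectorMeasure.norm_measure_le_variation (μ := μ) (E := Ioc t y)).trans ?_
        exact measureReal_mono (Ioc_subset_Ioc_left ht.1)
      have hD : D y - D x = ((∫ᵛ t in Ioc x y, f t ∂[ContinuousLinearMap.mul ℝ ℝ; μ]) -
          f x * (g y - g x)) - ((f y - f x) * g y - ∫ t in x..y, f' t * g t) := by
        rw [← hadd x y hx.1 hxy, ← intervalIntegral.integral_interval_sub_left
          (hii hc (hx.1.trans hxy) hyb) (hii hc hx.1 (hxy.trans hyb))]
        simp only [D]
        ring
      rw [hD, hMsub x y hx.1 hxy, hWsub x y hx.1 hxy hy.2]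
      refine (abs_sub _ _).trans ?_
      linarith
    · intro x hx y hy hxy
      have := hMsub x y hx.1 hxy
      have : 0 ≤ μ.variation.real (Ioc x y) := measureReal_nonneg
      linarith
    · intro x hx y hy hxy
      have := hWsub x y hx.1 hxy hy.2
      linarith [hWnn x y hxy]
  simp only [D, Ioc_self, intervalIntegral.integral_same] at hmain
  rw [VectorMeasure.restrict_empty, VectorMeasure.integral_zero_vectorMeasure] at hmain
  linarith

end DistDeriv

/-- The sums over partitions of the masses of `f dg + h dx` are bounded by `formVariation`. -/
theorem sum_enorm_le_formVariation {f f' g h : ℝ → ℝ} {a b : ℝ} {I : Set ℝ}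
    (hI : Icc a b ⊆ I) (hg : BoundedVariationOn g (Icc a b))
    (hr : ∀ x ∈ Ico a b, ContinuousWithinAt g (Ici x) x)
    (hf : HasAEDerivOn f f' a b) (hgm : IntervalIntegrable (fun x => f' x * g x) volume a b)
    (hh : IntervalIntegrable h volume a b) {t : ℕ → ℝ} (ht : Monotone t) {n : ℕ}
    (hta : a ≤ t 0) (htb : t n ≤ b) :
    ∑ i ∈ Finset.range n, ‖f (t (i + 1)) * g (t (i + 1)) - f (t i) * g (t i) -
      (∫ x in (t i)..(t (i + 1)), f' x * g x) + ∫ x in (t i)..(t (i + 1)), h x‖ₑ ≤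
      formVariation f g h I := by
  have hab := hf.le
  set ρ : SignedMeasure ℝ := (distDeriv g a b).withDensity f (ContinuousLinearMap.mul ℝ ℝ) +
      (volume.restrict (Ioc a b)).withDensityᵥ h with hρ
  have hval : ∀ i ∈ Finset.range n, f (t (i + 1)) * g (t (i + 1)) - f (t i) * g (t i) -
      (∫ x in (t i)..(t (i + 1)), f' x * g x) + (∫ x in (t i)..(t (i + 1)), h x) =
      ρ (Ioc (t i) (t (i + 1))) := by
    intro i hi
    have hi' := Finset.mem_range.1 hi
    have h1 : a ≤ t i := hta.trans (ht (Nat.zero_le _))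
    have h2 : t i ≤ t (i + 1) := ht (Nat.le_succ _)
    have h3 : t (i + 1) ≤ b := (ht (by omega)).trans htb
    have hhi : Integrable h (volume.restrict (Ioc a b)) := by
      have := hh.1
      exact this
    rw [hρ, _root_.add_apply, VectorMeasure.withDensity_apply
      (integrable_distDeriv hab hg hr hf.continuousOn),
      setIntegral_distDeriv_eq hab hg hr hf hgm h1 h2 h3, withDensityᵥ_apply hhi measurableSet_Ioc,
      Measure.restrict_restrict measurableSet_Ioc,
      inter_eq_left.2 (Ioc_subset_Ioc h1 h3), intervalIntegral.integral_of_le h2,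
      intervalIntegral.integral_of_le h2]
  have hsum : ∑ i ∈ Finset.range n, ‖ρ (Ioc (t i) (t (i + 1)))‖ₑ ≤ ρ.variation (Ioc a b) := by
    have hdis : Pairwise (Function.onFun Disjoint fun i => Ioc (t i) (t (i + 1))) :=
      ht.pairwise_disjoint_on_Ioc_succ
    calc ∑ i ∈ Finset.range n, ‖ρ (Ioc (t i) (t (i + 1)))‖ₑ
        ≤ ∑ i ∈ Finset.range n, ρ.variation (Ioc (t i) (t (i + 1))) :=
          Finset.sum_le_sum fun i _ => VectorMeasure.enorm_measure_le_variation _ _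
      _ = ρ.variation (⋃ i ∈ Finset.range n, Ioc (t i) (t (i + 1))) := by
          rw [measure_biUnion_finset (fun i _ j _ hij => hdis hij) fun i _ => measurableSet_Ioc]
      _ ≤ ρ.variation (Ioc a b) := by
          refine measure_mono (iUnion₂_subset fun i hi => Ioc_subset_Ioc ?_ ?_)
          · exact hta.trans (ht (Nat.zero_le _))
          · exact (ht (by have := Finset.mem_range.1 hi; omega)).trans htb
  rw [Finset.sum_congr rfl fun i hi => by rw [hval i hi]]
  refine hsum.trans ?_
  exact le_iSup_of_le a (le_iSup_of_le b (le_iSup_of_le hab (le_iSup_of_le hI le_rfl)))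

end SSESF

namespace SSESF

/-! ### First consequences of the equations -/

/-- `log (λ / (1 - μ))`. -/
noncomputable def logKap (r m : ℝ → ℝ → ℝ) (u v : ℝ) : ℝ :=
  Real.log (lam r u v) - Real.log (1 - massRatio r m u v)

/-- The mixed derivative `∂_u ∂_v φ`, as given by the wave equation. -/
noncomputable def mixed (φ r : ℝ → ℝ → ℝ) (u v : ℝ) : ℝ :=
  -(lam r u v * dU φ u v + nu r u v * dV φ u v) / r u v

namespace IsBVSolution

variable {φ r m : ℝ → ℝ → ℝ}

theorem r_v (h : IsBVSolution φ r m) {u V : ℝ} (hu : 1 ≤ u) (hV : u ≤ V) :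
    HasAEDerivOn (r u) (lam r u) u V :=
  HasAEDerivOn.of_absolutelyContinuous hV (h.r_ac_v u V hu hV)

theorem phi_v (h : IsBVSolution φ r m) {u V : ℝ} (hu : 1 ≤ u) (hV : u ≤ V) :
    HasAEDerivOn (φ u) (dV φ u) u V :=
  HasAEDerivOn.of_absolutelyContinuous hV (h.phi_ac_v u V hu hV)

theorem rphi_v (h : IsBVSolution φ r m) {u V : ℝ} (hu : 1 ≤ u) (hV : u ≤ V) :
    HasAEDerivOn (rphi r φ u) (dV (rphi r φ) u) u V :=
  HasAEDerivOn.of_absolutelyContinuous hV ((h.r_ac_v u V hu hV).mul (h.phi_ac_v u V hu hV))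

theorem r_u (h : IsBVSolution φ r m) {v : ℝ} (hv : 1 ≤ v) :
    HasAEDerivOn (fun u => r u v) (fun u => nu r u v) 1 v :=
  HasAEDerivOn.of_absolutelyContinuous hv (h.r_ac_u v hv)

theorem phi_u (h : IsBVSolution φ r m) {v : ℝ} (hv : 1 ≤ v) :
    HasAEDerivOn (fun u => φ u v) (fun u => dU φ u v) 1 v :=
  HasAEDerivOn.of_absolutelyContinuous hv (h.phi_ac_u 1 v le_rfl hv)

theorem rphi_u (h : IsBVSolution φ r m) {v : ℝ} (hv : 1 ≤ v) :
    HasAEDerivOn (fun u => rphi r φ u v) (fun u => dU (rphi r φ) u v) 1 v :=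
  HasAEDerivOn.of_absolutelyContinuous hv ((h.r_ac_u v hv).mul (h.phi_ac_u 1 v le_rfl hv))

theorem lam_u (h : IsBVSolution φ r m) {v a b : ℝ} (ha : 1 ≤ a) (hab : a ≤ b) (hb : b < v) :
    HasAEDerivOn (fun u => lam r u v) (fun u => potential r m u v) a b :=
  HasAEDerivOn.of_isPrimitiveOn hab (h.eq_lam v a b ha hab hb)

theorem nu_v (h : IsBVSolution φ r m) {u a b : ℝ} (hu : 1 ≤ u) (ha : u < a) (hab : a ≤ b) :
    HasAEDerivOn (fun v => nu r u v) (fun v => potential r m u v) a b :=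
  HasAEDerivOn.of_isPrimitiveOn hab (h.eq_nu u a b hu ha hab)

theorem dV_rphi_u (h : IsBVSolution φ r m) {v a b : ℝ} (ha : 1 ≤ a) (hab : a ≤ b) (hb : b < v) :
    HasAEDerivOn (fun u => dV (rphi r φ) u v) (fun u => potential r m u v * φ u v) a b :=
  HasAEDerivOn.of_isPrimitiveOn hab (h.eq_phi_u v a b ha hab hb)

theorem dU_rphi_v (h : IsBVSolution φ r m) {u a b : ℝ} (hu : 1 ≤ u) (ha : u < a) (hab : a ≤ b) :
    HasAEDerivOn (fun v => dU (rphi r φ) u v) (fun v => potential r m u v * φ u v) a b :=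
  HasAEDerivOn.of_isPrimitiveOn hab (h.eq_phi_v u a b hu ha hab)

theorem m_v (h : IsBVSolution φ r m) {u V : ℝ} (hu : 1 ≤ u) (hV : u ≤ V) : HasAEDerivOn (m u)
    (fun v => (1 - massRatio r m u v) * r u v ^ 2 * dV φ u v ^ 2 / (2 * lam r u v)) u V :=
  HasAEDerivOn.of_isPrimitiveOn hV (h.eq_m_v u V hu hV)

theorem m_u (h : IsBVSolution φ r m) {v : ℝ} (hv : 1 ≤ v) : HasAEDerivOn (fun u => m u v)
    (fun u => (1 - massRatio r m u v) * r u v ^ 2 * dU φ u v ^ 2 / (2 * nu r u v)) 1 v :=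
  HasAEDerivOn.of_isPrimitiveOn hv (h.eq_m_u v hv)

theorem r_nonneg (h : IsBVSolution φ r m) {u v : ℝ} (hu : 1 ≤ u) (huv : u ≤ v) : 0 ≤ r u v := by
  rcases huv.eq_or_lt with rfl | hlt
  · rw [h.r_axis u hu]
  · exact (h.r_pos u v hu hlt).le

theorem hasDeriv_r_v (h : IsBVSolution φ r m) {u v : ℝ} (hu : 1 ≤ u) (huv : u < v) :
    HasDerivWithinAt (r u) (lam r u v) (Ioi v) v :=
  (h.r_v hu (huv.le.trans (by linarith : v ≤ v + 1))).hasDerivWithinAt ⟨huv.le, by linarith⟩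
    (h.rightCts_lam u v hu huv)

theorem hasDeriv_rphi_v (h : IsBVSolution φ r m) {u v : ℝ} (hu : 1 ≤ u) (huv : u < v) :
    HasDerivWithinAt (rphi r φ u) (dV (rphi r φ) u v) (Ioi v) v :=
  (h.rphi_v hu (huv.le.trans (by linarith : v ≤ v + 1))).hasDerivWithinAt ⟨huv.le, by linarith⟩
    (h.rightCts_dV u v hu huv)

theorem hasDeriv_r_u (h : IsBVSolution φ r m) {u v : ℝ} (hu : 1 ≤ u) (huv : u < v) :
    HasDerivWithinAt (fun u' => r u' v) (nu r u v) (Ioi u) u :=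
  (h.r_u (hu.trans huv.le)).hasDerivWithinAt ⟨hu, huv⟩ (h.rightCts_nu u v hu huv)

theorem hasDeriv_rphi_u (h : IsBVSolution φ r m) {u v : ℝ} (hu : 1 ≤ u) (huv : u < v) :
    HasDerivWithinAt (fun u' => rphi r φ u' v) (dU (rphi r φ) u v) (Ioi u) u :=
  (h.rphi_u (hu.trans huv.le)).hasDerivWithinAt ⟨hu, huv⟩ (h.rightCts_dU u v hu huv)

/-- Quotient rule for φ = (rφ)/r off the axis. Right-continuity of λ and ∂_v(rφ) gives the right
derivative of φ at every point, as needed for the endpoint values in the null forms. -/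
theorem hasDeriv_phi_v (h : IsBVSolution φ r m) {u v : ℝ} (hu : 1 ≤ u) (huv : u < v) :
    HasDerivWithinAt (φ u) ((dV (rphi r φ) u v - lam r u v * φ u v) / r u v) (Ioi v) v := by
  have hr := (h.r_pos u v hu huv).ne'
  have h1 := (h.hasDeriv_rphi_v hu huv).div (h.hasDeriv_r_v hu huv) hr
  have h2 : HasDerivWithinAt (φ u) ((dV (rphi r φ) u v * r u v - rphi r φ u v * lam r u v) / r u v ^ 2)
      (Ioi v) v := by
    refine h1.congr (fun y hy => ?_) ?_
    · have := (h.r_pos u y hu (huv.trans hy)).ne'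
      simp only [Pi.div_apply, rphi]
      field_simp
    · simp only [Pi.div_apply, rphi]
      field_simp
  convert h2 using 1
  simp only [rphi]
  field_simp

theorem r_mul_dV (h : IsBVSolution φ r m) {u v : ℝ} (hu : 1 ≤ u) (huv : u < v) :
    r u v * dV φ u v = dV (rphi r φ) u v - lam r u v * φ u v := by
  have hr := (h.r_pos u v hu huv).ne'
  have h1 : dV φ u v = _ := (h.hasDeriv_phi_v hu huv).derivWithin (uniqueDiffWithinAt_Ioi v)
  rw [h1]
  field_simp

theorem hasDeriv_phi_u (h : IsBVSolution φ r m) {u v : ℝ} (hu : 1 ≤ u) (huv : u < v) :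
    HasDerivWithinAt (fun u' => φ u' v) ((dU (rphi r φ) u v - nu r u v * φ u v) / r u v)
      (Ioi u) u := by
  have hr := (h.r_pos u v hu huv).ne'
  have h1 := (h.hasDeriv_rphi_u hu huv).div (h.hasDeriv_r_u hu huv) hr
  have h2 : HasDerivWithinAt (fun u' => φ u' v)
      ((dU (rphi r φ) u v * r u v - rphi r φ u v * nu r u v) / r u v ^ 2) (Ioi u) u := by
    refine h1.congr_of_eventuallyEq ?_ ?_
    · filter_upwards [Ioo_mem_nhdsGT huv] with y hy
      have := (h.r_pos y v (hu.trans hy.1.le) hy.2).ne'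
      simp only [Pi.div_apply, rphi]
      field_simp
    · simp only [Pi.div_apply, rphi]
      field_simp
  convert h2 using 1
  simp only [rphi]
  field_simp

theorem r_mul_dU (h : IsBVSolution φ r m) {u v : ℝ} (hu : 1 ≤ u) (huv : u < v) :
    r u v * dU φ u v = dU (rphi r φ) u v - nu r u v * φ u v := by
  have hr := (h.r_pos u v hu huv).ne'
  have h1 : dU φ u v = _ := (h.hasDeriv_phi_u hu huv).derivWithin (uniqueDiffWithinAt_Ioi u)
  rw [h1]
  field_simp

/-! #### Signs -/

theorem lam_ne (h : IsBVSolution φ r m) {u v : ℝ} (hu : 1 ≤ u) (huv : u < v) :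
    lam r u v ≠ 0 := fun h0 => by
  have := h.OmegaSq_pos u v hu huv
  simp [OmegaSq, h0] at this

theorem nu_ne (h : IsBVSolution φ r m) {u v : ℝ} (hu : 1 ≤ u) (huv : u < v) :
    nu r u v ≠ 0 := fun h0 => by
  have := h.OmegaSq_pos u v hu huv
  simp [OmegaSq, h0] at this

theorem lam_init (h : IsBVSolution φ r m) {v : ℝ} (hv : 1 ≤ v) : lam r 1 v = 1 / 2 := by
  have h1 : HasDerivWithinAt (fun v : ℝ => (v - 1) / 2) (1 / 2) (Ioi v) v :=
    (((hasDerivAt_id v).sub_const 1).div_const 2).hasDerivWithinAt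
  have h2 : HasDerivWithinAt (r 1) (1 / 2) (Ioi v) v := by
    refine h1.congr (fun y hy => ?_) ?_
    · linarith [h.r_init y (hv.trans (le_of_lt hy))]
    · linarith [h.r_init v hv]
  exact h2.derivWithin (uniqueDiffWithinAt_Ioi v)

/-- λ equals 1/2 on C_1, is continuous in u and cannot vanish because Ω² > 0. -/
theorem lam_pos (h : IsBVSolution φ r m) {u v : ℝ} (hu : 1 ≤ u) (huv : u < v) : 0 < lam r u v := by
  by_contra hneg
  have hc := (h.lam_u (v := v) le_rfl hu huv).continuousOn
  have h1 := h.lam_init (hu.trans huv.le)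
  obtain ⟨x, hx, hx0⟩ := intermediate_value_Icc' hu hc
    (show (0 : ℝ) ∈ Icc (lam r u v) (lam r 1 v) from ⟨not_lt.1 hneg, by rw [h1]; norm_num⟩)
  exact h.lam_ne hx.1 (hx.2.trans_lt huv) hx0

theorem exists_lam_ge (h : IsBVSolution φ r m) {u₀ v₀ : ℝ} (hu : 1 ≤ u₀) (huv : u₀ ≤ v₀) :
    ∃ c > 0, ∀ u v, u₀ ≤ u → u < v →
    v ≤ v₀ → c ≤ lam r u v := by
  obtain ⟨C, hC⟩ := h.bdd u₀ v₀ hu huv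
  refine ⟨(max C 1)⁻¹, by positivity, fun u v h1 h2 h3 => ?_⟩
  rw [inv_le_comm₀ (by positivity) (h.lam_pos (hu.trans h1) h2)]
  exact (hC u v h1 h2 h3).2.trans (le_max_left _ _)

/-- Near the axis ν is close to -λ, hence negative since λ is bounded below there. Being continuous
in v and never zero, it keeps its sign along C_u. -/
theorem nu_neg (h : IsBVSolution φ r m) {u v : ℝ} (hu : 1 ≤ u) (huv : u < v) : nu r u v < 0 := by
  obtain ⟨c, hc, hlam⟩ := h.exists_lam_ge hu huv.le
  have h1 : ∀ᶠ ε in 𝓝[>] (0 : ℝ), nu r u (u + ε) + lam r u (u + ε) < c :=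
    (h.axis_r u hu).eventually_lt_const hc
  have h2 : ∀ᶠ ε in 𝓝[>] (0 : ℝ), ε ∈ Ioo 0 (v - u) := Ioo_mem_nhdsGT (by linarith)
  obtain ⟨ε, h3, h4⟩ := (h1.and h2).exists
  have h5 := hlam u (u + ε) le_rfl (by linarith [h4.1]) (by linarith [h4.2])
  by_contra hneg
  have hcont :=
    (h.nu_v hu (by linarith [h4.1] : u < u + ε) (by linarith [h4.2] : u + ε ≤ v)).continuousOn
  obtain ⟨x, hx, hx0⟩ := intermediate_value_Icc (by linarith [h4.2]) hcont
    (show (0 : ℝ) ∈ Icc (nu r u (u + ε)) (nu r u v) from ⟨by linarith, not_lt.1 hneg⟩)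
  exact h.nu_ne hu (by linarith [hx.1, h4.1]) hx0

theorem one_sub_pos (h : IsBVSolution φ r m) {u v : ℝ} (hu : 1 ≤ u) (huv : u < v) :
    0 < 1 - massRatio r m u v := by
  have h1 := h.OmegaSq_pos u v hu huv
  have h2 : 0 < -4 * lam r u v * nu r u v := by
    nlinarith [mul_pos (h.lam_pos hu huv) (neg_pos.2 (h.nu_neg hu huv))]
  rw [OmegaSq] at h1
  by_contra h3
  exact absurd h1 (not_lt.2 (div_nonpos_of_nonneg_of_nonpos h2.le (not_lt.1 h3)))

theorem m_nonneg (h : IsBVSolution φ r m) {u v : ℝ} (hu : 1 ≤ u) (huv : u ≤ v) : 0 ≤ m u v := by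
  rw [← h.m_axis u hu]
  refine (h.m_v hu huv).le_of_nonneg fun x hx => ?_
  have h1 := h.lam_pos hu hx.1
  have h2 := h.one_sub_pos hu hx.1
  positivity

theorem m_mono_v (h : IsBVSolution φ r m) {u x y : ℝ} (hu : 1 ≤ u) (hx : u ≤ x) (hxy : x ≤ y) :
    m u x ≤ m u y := by
  refine ((h.m_v hu (hx.trans hxy)).mono hx hxy le_rfl).le_of_nonneg fun z hz => ?_
  have h1 := h.lam_pos hu (hx.trans_lt hz.1)
  have h2 := h.one_sub_pos hu (hx.trans_lt hz.1)
  positivity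

theorem m_anti_u (h : IsBVSolution φ r m) {x y v : ℝ} (hx : 1 ≤ x) (hxy : x ≤ y) (hy : y ≤ v) :
    m y v ≤ m x v := by
  refine ((h.m_u (hx.trans (hxy.trans hy))).mono hx hxy hy).le_of_nonpos fun z hz => ?_
  have hz1 : 1 ≤ z := hx.trans hz.1.le
  have hz2 : z < v := hz.2.trans_le hy
  have h1 := h.nu_neg hz1 hz2
  have h2 := h.one_sub_pos hz1 hz2
  exact div_nonpos_of_nonneg_of_nonpos (by positivity) (by linarith)

theorem massRatio_nonneg (h : IsBVSolution φ r m) {u v : ℝ} (hu : 1 ≤ u) (huv : u < v) :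
    0 ≤ massRatio r m u v := by
  have := h.m_nonneg hu huv.le
  have := h.r_pos u v hu huv
  rw [massRatio]
  positivity

theorem potential_nonpos (h : IsBVSolution φ r m) {u v : ℝ} (hu : 1 ≤ u) (huv : u < v) :
    potential r m u v ≤ 0 := by
  have h1 := h.massRatio_nonneg hu huv
  have h2 := h.lam_pos hu huv
  have h3 := h.nu_neg hu huv
  have h4 := h.one_sub_pos hu huv
  have h5 := h.r_pos u v hu huv
  rw [potential]
  exact div_nonpos_of_nonpos_of_nonneg
    (mul_nonpos_of_nonneg_of_nonpos (by positivity) h3.le) (by positivity)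

theorem lam_anti_u (h : IsBVSolution φ r m) {x y v : ℝ} (hx : 1 ≤ x) (hxy : x ≤ y) (hy : y < v) :
    lam r y v ≤ lam r x v :=
  (h.lam_u hx hxy hy).le_of_nonpos fun _ hz =>
    h.potential_nonpos (hx.trans hz.1.le) (hz.2.trans hy)

theorem lam_le_half (h : IsBVSolution φ r m) {u v : ℝ} (hu : 1 ≤ u) (huv : u < v) :
    lam r u v ≤ 1 / 2 := by
  rw [← h.lam_init (hu.trans huv.le)]
  exact h.lam_anti_u le_rfl hu huv

theorem nu_anti_v (h : IsBVSolution φ r m) {u x y : ℝ} (hu : 1 ≤ u) (hx : u < x) (hxy : x ≤ y) :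
    nu r u y ≤ nu r u x :=
  (h.nu_v hu hx hxy).le_of_nonpos fun _ hz => h.potential_nonpos hu (hx.trans hz.1)

theorem r_mono_v (h : IsBVSolution φ r m) {u x y : ℝ} (hu : 1 ≤ u) (hx : u ≤ x) (hxy : x ≤ y) :
    r u x ≤ r u y :=
  ((h.r_v hu (hx.trans hxy)).mono hx hxy le_rfl).le_of_nonneg fun _ hz =>
    (h.lam_pos hu (hx.trans_lt hz.1)).le

theorem r_anti_u (h : IsBVSolution φ r m) {x y v : ℝ} (hx : 1 ≤ x) (hxy : x ≤ y) (hy : y ≤ v) :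
    r y v ≤ r x v :=
  ((h.r_u (hx.trans (hxy.trans hy))).mono hx hxy hy).le_of_nonpos fun _ hz =>
    (h.nu_neg (hx.trans hz.1.le) (hz.2.trans_le hy)).le

/-- Lower bounds for `λ` on an outgoing curve are lower bounds for `-ν`. -/
theorem le_neg_nu (h : IsBVSolution φ r m) {u v c : ℝ} (hu : 1 ≤ u) (huv : u < v)
    (hc : ∀ x, u < x → x < v → c ≤ lam r u x) :
    c ≤ -nu r u v := by
  refine le_of_tendsto_of_tendsto (f := fun ε => c - (nu r u (u + ε) + lam r u (u + ε)))
    (g := fun _ => -nu r u v) (b := 𝓝[>] (0 : ℝ)) ?_ tendsto_const_nhds ?_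
  · simpa using tendsto_const_nhds.sub (h.axis_r u hu)
  · filter_upwards [Ioo_mem_nhdsGT (by linarith : (0 : ℝ) < v - u)] with ε hε
    have h1 := hc (u + ε) (by linarith [hε.1]) (by linarith [hε.2])
    have h2 := h.nu_anti_v hu (by linarith [hε.1] : u < u + ε) (by linarith [hε.2] : u + ε ≤ v)
    linarith

/-! #### Derived equations -/

theorem r_mul_dV_u (h : IsBVSolution φ r m) {v a b : ℝ} (ha : 1 ≤ a) (hab : a ≤ b) (hb : b < v) :
    HasAEDerivOn (fun u => r u v * dV φ u v) (fun u => -(lam r u v * dU φ u v)) a b := by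
  refine (((h.dV_rphi_u ha hab hb).sub ((h.lam_u ha hab hb).mul
    ((h.phi_u (ha.trans (hab.trans hb.le))).mono ha hab hb.le))).congr fun u hu => ?_).congr_deriv
    fun u _ => ?_
  · exact (h.r_mul_dV (ha.trans hu.1) (hu.2.trans_lt hb)).symm
  · ring

theorem r_mul_dU_v (h : IsBVSolution φ r m) {u a b : ℝ} (hu : 1 ≤ u) (ha : u < a) (hab : a ≤ b) :
    HasAEDerivOn (fun v => r u v * dU φ u v) (fun v => -(nu r u v * dV φ u v)) a b := by
  refine (((h.dU_rphi_v hu ha hab).sub ((h.nu_v hu ha hab).mul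
    ((h.phi_v hu (ha.le.trans hab)).mono ha.le hab le_rfl))).congr fun v hv => ?_).congr_deriv
    fun v _ => ?_
  · exact (h.r_mul_dU hu (ha.trans_le hv.1)).symm
  · ring

theorem dV_phi_u (h : IsBVSolution φ r m) {v a b : ℝ} (ha : 1 ≤ a) (hab : a ≤ b) (hb : b < v) :
    HasAEDerivOn (fun u => dV φ u v) (fun u => mixed φ r u v) a b := by
  have hr : ∀ u ∈ Icc a b, r u v ≠ 0 := fun u hu =>
    (h.r_pos u v (ha.trans hu.1) (hu.2.trans_lt hb)).ne'
  refine (((h.r_mul_dV_u ha hab hb).div ((h.r_u (ha.trans (hab.trans hb.le))).mono ha hab hb.le)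
    hr).congr fun u hu => ?_).congr_deriv fun u hu => ?_
  · have := hr u hu
    field_simp
  · have := hr u (Ioo_subset_Icc_self hu)
    rw [mixed]
    field_simp
    ring

theorem dU_phi_v (h : IsBVSolution φ r m) {u a b : ℝ} (hu : 1 ≤ u) (ha : u < a) (hab : a ≤ b) :
    HasAEDerivOn (fun v => dU φ u v) (fun v => mixed φ r u v) a b := by
  have hr : ∀ v ∈ Icc a b, r u v ≠ 0 := fun v hv => (h.r_pos u v hu (ha.trans_le hv.1)).ne'
  refine (((h.r_mul_dU_v hu ha hab).div ((h.r_v hu (ha.le.trans hab)).mono ha.le hab le_rfl)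
    hr).congr fun v hv => ?_).congr_deriv fun v hv => ?_
  · have := hr v hv
    field_simp
  · have := hr v (Ioo_subset_Icc_self hv)
    rw [mixed]
    field_simp
    ring

theorem nuInvDU_sub (h : IsBVSolution φ r m) {u v : ℝ} (hu : 1 ≤ u) (huv : u < v) :
    nuInvDU φ r u v - φ u v = r u v * dU φ u v / nu r u v := by
  have := h.nu_ne hu huv
  rw [h.r_mul_dU hu huv, nuInvDU]
  field_simp

/-- Both ∂_u(rφ) and ν have the same coefficient in their equations in v, so the quotient X relaxes
to φ at the rate ∂_vν/ν. -/
theorem nuInvDU_v (h : IsBVSolution φ r m) {u a b : ℝ} (hu : 1 ≤ u) (ha : u < a) (hab : a ≤ b) :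
    HasAEDerivOn (fun v => nuInvDU φ r u v)
      (fun v => -(potential r m u v / nu r u v * (nuInvDU φ r u v - φ u v))) a b := by
  have hn : ∀ v ∈ Icc a b, nu r u v ≠ 0 := fun v hv => h.nu_ne hu (ha.trans_le hv.1)
  refine (((h.dU_rphi_v hu ha hab).div (h.nu_v hu ha hab) hn).congr fun v hv => ?_).congr_deriv
    fun v hv => ?_
  · rw [nuInvDU, div_eq_inv_mul]
  · have := hn v (Ioo_subset_Icc_self hv)
    rw [nuInvDU]
    field_simp
    ring

theorem massRatio_v (h : IsBVSolution φ r m) {u a b : ℝ} (hu : 1 ≤ u) (ha : u < a) (hab : a ≤ b) :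
    HasAEDerivOn (fun v => 1 - massRatio r m u v)
      (fun v => massRatio r m u v * lam r u v / r u v -
        (1 - massRatio r m u v) * (r u v * dV φ u v ^ 2 / lam r u v)) a b := by
  have hr : ∀ v ∈ Icc a b, r u v ≠ 0 := fun v hv => (h.r_pos u v hu (ha.trans_le hv.1)).ne'
  have h1 := ((h.m_v hu (ha.le.trans hab)).mono ha.le hab le_rfl).div
    ((h.r_v hu (ha.le.trans hab)).mono ha.le hab le_rfl) hr
  refine (((HasAEDerivOn.const hab 1).sub ((HasAEDerivOn.const hab 2).mul h1)).congr
    fun v _ => ?_).congr_deriv fun v hv => ?_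
  · simp only [massRatio, mul_div_assoc]
  · have h2 := hr v (Ioo_subset_Icc_self hv)
    have h3 := h.lam_ne hu (ha.trans hv.1)
    simp only [massRatio]
    field_simp
    ring

theorem massRatio_u (h : IsBVSolution φ r m) {v a b : ℝ} (ha : 1 ≤ a) (hab : a ≤ b) (hb : b < v) :
    HasAEDerivOn (fun u => 1 - massRatio r m u v)
      (fun u => massRatio r m u v * nu r u v / r u v -
        (1 - massRatio r m u v) * (r u v * dU φ u v ^ 2 / nu r u v)) a b := by
  have hr : ∀ u ∈ Icc a b, r u v ≠ 0 := fun u hu =>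
    (h.r_pos u v (ha.trans hu.1) (hu.2.trans_lt hb)).ne'
  have hv := ha.trans (hab.trans hb.le)
  have h1 := ((h.m_u hv).mono ha hab hb.le).div ((h.r_u hv).mono ha hab hb.le) hr
  refine (((HasAEDerivOn.const hab 1).sub ((HasAEDerivOn.const hab 2).mul h1)).congr
    fun v _ => ?_).congr_deriv fun u hu => ?_
  · simp only [massRatio, mul_div_assoc]
  · have h2 := hr u (Ioo_subset_Icc_self hu)
    have h3 := h.nu_ne (ha.trans hu.1.le) (hu.2.trans hb)
    simp only [massRatio]
    field_simp
    ring

theorem log_one_sub_v (h : IsBVSolution φ r m) {u a b : ℝ} (hu : 1 ≤ u) (ha : u < a) (hab : a ≤ b) :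
    HasAEDerivOn (fun v => Real.log (1 - massRatio r m u v))
      (fun v => potential r m u v / nu r u v - r u v * dV φ u v ^ 2 / lam r u v) a b := by
  refine ((h.massRatio_v hu ha hab).log fun v hv =>
    (h.one_sub_pos hu (ha.trans_le hv.1)).ne').congr_deriv fun v hv => ?_
  have huv := ha.trans hv.1
  have h1 := (h.one_sub_pos hu huv).ne'
  have h2 := h.nu_ne hu huv
  have h3 := (h.r_pos u v hu huv).ne'
  have h4 := h.lam_ne hu huv
  rw [potential]
  field_simp

/-- The terms μν/((1-μ)r) in ∂_u log λ and ∂_u log(1-μ) cancel, and only the matter term is left.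
Its sign makes λ/(1-μ) nonincreasing in u, which later turns bounds on an early curve into lower
bounds for 1-μ. -/
theorem logKap_u (h : IsBVSolution φ r m) {v a b : ℝ} (ha : 1 ≤ a) (hab : a ≤ b) (hb : b < v) :
    HasAEDerivOn (fun u => logKap r m u v) (fun u => r u v * dU φ u v ^ 2 / nu r u v) a b := by
  have h1 := (h.massRatio_u ha hab hb).log fun u hu =>
    (h.one_sub_pos (ha.trans hu.1) (hu.2.trans_lt hb)).ne'
  have h2 := (h.lam_u ha hab hb).log fun u hu => h.lam_ne (ha.trans hu.1) (hu.2.trans_lt hb)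
  refine (h2.sub h1).congr_deriv fun u hu => ?_
  have hu1 : 1 ≤ u := ha.trans hu.1.le
  have huv := hu.2.trans hb
  have h1 := (h.one_sub_pos hu1 huv).ne'
  have h2 := h.nu_ne hu1 huv
  have h3 := (h.r_pos u v hu1 huv).ne'
  have h4 := h.lam_ne hu1 huv
  rw [potential]
  field_simp
  ring

/-! #### Right-continuity and pointwise second derivatives -/

theorem continuousOn_r_v (h : IsBVSolution φ r m) {u : ℝ} (hu : 1 ≤ u) {a b : ℝ} (ha : u ≤ a) :
    ContinuousOn (r u) (Icc a b) :=
  fun x hx => ((h.r_v hu (ha.trans (hx.1.trans hx.2))).continuousOn.mono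
    (Icc_subset_Icc_left ha)) x hx

theorem continuousWithinAt_potential_u (h : IsBVSolution φ r m) {u v : ℝ} (hu : 1 ≤ u)
    (huv : u < v) :
    ContinuousWithinAt (fun u => potential r m u v) (Ici u) u := by
  obtain ⟨b, hub, hbv⟩ := exists_between huv
  have hnhds : Icc u b ∈ 𝓝[≥] u := Icc_mem_nhdsGE hub
  have hmem : u ∈ Icc u b := ⟨le_rfl, hub.le⟩
  have h1 : ContinuousWithinAt (fun u => massRatio r m u v) (Ici u) u := by
    have := ((h.massRatio_u hu hub.le hbv).continuousOn u hmem).mono_of_mem_nhdsWithin hnhds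
    have h2 := (continuousWithinAt_const (b := (1 : ℝ))).sub this
    exact h2.congr (fun _ _ => by simp) (by simp)
  have h2 := ((h.lam_u hu hub.le hbv).continuousOn u hmem).mono_of_mem_nhdsWithin hnhds
  have h3 := (((h.r_u (hu.trans huv.le)).mono hu hub.le hbv.le).continuousOn u
    hmem).mono_of_mem_nhdsWithin hnhds
  have h4 := (h.one_sub_pos hu huv).ne'
  have h5 := (h.r_pos u v hu huv).ne'
  exact ((h1.mul h2).mul (h.rightCts_nu u v hu huv)).div
    ((continuousWithinAt_const.sub h1).mul h3) (mul_ne_zero h4 h5)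

theorem continuousWithinAt_potential_v (h : IsBVSolution φ r m) {u v : ℝ} (hu : 1 ≤ u)
    (huv : u < v) :
    ContinuousWithinAt (fun v => potential r m u v) (Ici v) v := by
  have hub : v < v + 1 := by linarith
  have hnhds : Icc v (v + 1) ∈ 𝓝[≥] v := Icc_mem_nhdsGE hub
  have hmem : v ∈ Icc v (v + 1) := ⟨le_rfl, hub.le⟩
  have h1 : ContinuousWithinAt (fun v => massRatio r m u v) (Ici v) v := by
    have := ((h.massRatio_v hu huv hub.le).continuousOn v hmem).mono_of_mem_nhdsWithin hnhds
    have h2 := (continuousWithinAt_const (b := (1 : ℝ))).sub this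
    exact h2.congr (fun _ _ => by simp) (by simp)
  have h2 := ((h.nu_v hu huv hub.le).continuousOn v hmem).mono_of_mem_nhdsWithin hnhds
  have h3 := (((h.r_v hu (huv.trans hub).le).mono huv.le hub.le le_rfl).continuousOn v
    hmem).mono_of_mem_nhdsWithin hnhds
  have h4 := (h.one_sub_pos hu huv).ne'
  have h5 := (h.r_pos u v hu huv).ne'
  exact ((h1.mul (h.rightCts_lam u v hu huv)).mul h2).div
    ((continuousWithinAt_const.sub h1).mul h3) (mul_ne_zero h4 h5)

/-- Right-continuity of the potential in u turns the integrated equation into a pointwise one, so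
that the integrand of the first null form can be rewritten. -/
theorem dU_lam (h : IsBVSolution φ r m) {u v : ℝ} (hu : 1 ≤ u) (huv : u < v) :
    dU (lam r) u v = potential r m u v := by
  obtain ⟨b, hub, hbv⟩ := exists_between huv
  exact ((h.lam_u hu hub.le hbv).hasDerivWithinAt ⟨le_rfl, hub⟩
    (h.continuousWithinAt_potential_u hu huv)).derivWithin (uniqueDiffWithinAt_Ioi u)

theorem dV_nuInvDU (h : IsBVSolution φ r m) {u v : ℝ} (hu : 1 ≤ u) (huv : u < v) :
    dV (nuInvDU φ r) u v =
    -(potential r m u v / nu r u v * (nuInvDU φ r u v - φ u v)) := by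
  have hub : v < v + 1 := by linarith
  have hnhds : Icc v (v + 1) ∈ 𝓝[≥] v := Icc_mem_nhdsGE hub
  have hmem : v ∈ Icc v (v + 1) := ⟨le_rfl, hub.le⟩
  have h2 := ((h.nu_v hu huv hub.le).continuousOn v hmem).mono_of_mem_nhdsWithin hnhds
  have h3 := ((h.nuInvDU_v hu huv hub.le).continuousOn v hmem).mono_of_mem_nhdsWithin hnhds
  have h4 := (((h.phi_v hu (huv.trans hub).le).mono huv.le hub.le le_rfl).continuousOn v
    hmem).mono_of_mem_nhdsWithin hnhds
  exact ((h.nuInvDU_v hu huv hub.le).hasDerivWithinAt ⟨le_rfl, hub⟩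
    ((((h.continuousWithinAt_potential_v hu huv).div h2 (h.nu_ne hu huv)).mul
      (h3.sub h4)).neg)).derivWithin (uniqueDiffWithinAt_Ioi v)

end IsBVSolution

end SSESF

namespace SSESF

/-! ### Bounded measurable functions on rectangles -/

/-- `f` is bounded and measurable on the rectangle `[u₁, u₂] × [v₁, v₂]`. -/
structure RectBdd (f : ℝ → ℝ → ℝ) (u₁ u₂ v₁ v₂ : ℝ) : Prop where
  meas : ∃ F : ℝ × ℝ → ℝ, Measurable F ∧ ∀ u ∈ Icc u₁ u₂, ∀ v ∈ Icc v₁ v₂, f u v = F (u, v)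
  bdd : ∃ C, ∀ u ∈ Icc u₁ u₂, ∀ v ∈ Icc v₁ v₂, |f u v| ≤ C

namespace RectBdd

variable {f g : ℝ → ℝ → ℝ} {u₁ u₂ v₁ v₂ : ℝ}

theorem mul (hf : RectBdd f u₁ u₂ v₁ v₂) (hg : RectBdd g u₁ u₂ v₁ v₂) :
    RectBdd (fun u v => f u v * g u v) u₁ u₂ v₁ v₂ where
  meas := by
    obtain ⟨F, hF, hF'⟩ := hf.meas
    obtain ⟨G, hG, hG'⟩ := hg.meas
    exact ⟨fun p => F p * G p, hF.mul hG, fun u hu v hv => by rw [hF' u hu v hv, hG' u hu v hv]⟩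
  bdd := by
    obtain ⟨C, hC⟩ := hf.bdd
    obtain ⟨D, hD⟩ := hg.bdd
    refine ⟨C * D, fun u hu v hv => ?_⟩
    rw [abs_mul]
    exact mul_le_mul (hC u hu v hv) (hD u hu v hv) (abs_nonneg _) ((abs_nonneg _).trans (hC u hu v hv))

theorem add (hf : RectBdd f u₁ u₂ v₁ v₂) (hg : RectBdd g u₁ u₂ v₁ v₂) :
    RectBdd (fun u v => f u v + g u v) u₁ u₂ v₁ v₂ where
  meas := by
    obtain ⟨F, hF, hF'⟩ := hf.meas
    obtain ⟨G, hG, hG'⟩ := hg.meas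
    exact ⟨fun p => F p + G p, hF.add hG, fun u hu v hv => by rw [hF' u hu v hv, hG' u hu v hv]⟩
  bdd := by
    obtain ⟨C, hC⟩ := hf.bdd
    obtain ⟨D, hD⟩ := hg.bdd
    exact ⟨C + D, fun u hu v hv => (abs_add_le _ _).trans (add_le_add (hC u hu v hv) (hD u hu v hv))⟩

theorem neg (hf : RectBdd f u₁ u₂ v₁ v₂) : RectBdd (fun u v => -f u v) u₁ u₂ v₁ v₂ where
  meas := by
    obtain ⟨F, hF, hF'⟩ := hf.meas
    exact ⟨fun p => -F p, hF.neg, fun u hu v hv => by rw [hF' u hu v hv]⟩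
  bdd := by
    obtain ⟨C, hC⟩ := hf.bdd
    exact ⟨C, fun u hu v hv => by rw [abs_neg]; exact hC u hu v hv⟩

theorem sub (hf : RectBdd f u₁ u₂ v₁ v₂) (hg : RectBdd g u₁ u₂ v₁ v₂) :
    RectBdd (fun u v => f u v - g u v) u₁ u₂ v₁ v₂ := by
  simpa [sub_eq_add_neg] using hf.add hg.neg

theorem inv (hf : RectBdd f u₁ u₂ v₁ v₂) {c : ℝ} (hc : 0 < c)
    (hfc : ∀ u ∈ Icc u₁ u₂, ∀ v ∈ Icc v₁ v₂, c ≤ |f u v|) :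
    RectBdd (fun u v => (f u v)⁻¹) u₁ u₂ v₁ v₂ where
  meas := by
    obtain ⟨F, hF, hF'⟩ := hf.meas
    exact ⟨fun p => (F p)⁻¹, hF.inv, fun u hu v hv => by rw [hF' u hu v hv]⟩
  bdd := ⟨c⁻¹, fun u hu v hv => by rw [abs_inv]; exact inv_anti₀ hc (hfc u hu v hv)⟩

theorem congr (hf : RectBdd f u₁ u₂ v₁ v₂)
    (hfg : ∀ u ∈ Icc u₁ u₂, ∀ v ∈ Icc v₁ v₂, f u v = g u v) : RectBdd g u₁ u₂ v₁ v₂ where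
  meas := by
    obtain ⟨F, hF, hF'⟩ := hf.meas
    exact ⟨F, hF, fun u hu v hv => by rw [← hfg u hu v hv, hF' u hu v hv]⟩
  bdd := by
    obtain ⟨C, hC⟩ := hf.bdd
    exact ⟨C, fun u hu v hv => by rw [← hfg u hu v hv]; exact hC u hu v hv⟩

theorem intervalIntegrable_u (hf : RectBdd f u₁ u₂ v₁ v₂) (hu : u₁ ≤ u₂) {v : ℝ}
    (hv : v ∈ Icc v₁ v₂) : IntervalIntegrable (fun u => f u v) volume u₁ u₂ := by
  obtain ⟨F, hF, hF'⟩ := hf.meas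
  obtain ⟨C, hC⟩ := hf.bdd
  rw [intervalIntegrable_iff_integrableOn_Icc_of_le hu]
  have h1 : AEStronglyMeasurable (fun u => f u v) (volume.restrict (Icc u₁ u₂)) :=
    AEStronglyMeasurable.congr (f := fun u => F (u, v))
      (hF.comp measurable_prodMk_right).aestronglyMeasurable
      ((ae_restrict_iff' measurableSet_Icc).2 (Eventually.of_forall fun u hu => (hF' u hu v hv).symm))
  exact Integrable.of_bound (C := C) h1
    ((ae_restrict_iff' measurableSet_Icc).2 (Eventually.of_forall fun u hu => hC u hu v hv))

theorem intervalIntegrable_v (hf : RectBdd f u₁ u₂ v₁ v₂) (hv : v₁ ≤ v₂) {u : ℝ}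
    (hu : u ∈ Icc u₁ u₂) : IntervalIntegrable (fun v => f u v) volume v₁ v₂ := by
  obtain ⟨F, hF, hF'⟩ := hf.meas
  obtain ⟨C, hC⟩ := hf.bdd
  rw [intervalIntegrable_iff_integrableOn_Icc_of_le hv]
  have h1 : AEStronglyMeasurable (fun v => f u v) (volume.restrict (Icc v₁ v₂)) :=
    AEStronglyMeasurable.congr (f := fun v => F (u, v))
      (hF.comp measurable_prodMk_left).aestronglyMeasurable
      ((ae_restrict_iff' measurableSet_Icc).2 (Eventually.of_forall fun v hv => (hF' u hu v hv).symm))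
  exact Integrable.of_bound (C := C) h1
    ((ae_restrict_iff' measurableSet_Icc).2 (Eventually.of_forall fun v hv => hC u hu v hv))

theorem integrable_prod (hf : RectBdd f u₁ u₂ v₁ v₂) : Integrable (Function.uncurry f)
    ((volume.restrict (Ioc u₁ u₂)).prod (volume.restrict (Ioc v₁ v₂))) := by
  obtain ⟨F, hF, hF'⟩ := hf.meas
  obtain ⟨C, hC⟩ := hf.bdd
  have hmem : ∀ᵐ p ∂((volume.restrict (Ioc u₁ u₂)).prod (volume.restrict (Ioc v₁ v₂))),
      p ∈ Ioc u₁ u₂ ×ˢ Ioc v₁ v₂ := by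
    rw [Measure.prod_restrict]
    exact ae_restrict_mem (measurableSet_Ioc.prod measurableSet_Ioc)
  refine Integrable.of_bound (C := C)
    (AEStronglyMeasurable.congr (f := F) hF.aestronglyMeasurable ?_) ?_
  · filter_upwards [hmem] with p hp
    exact (hF' p.1 (Ioc_subset_Icc_self hp.1) p.2 (Ioc_subset_Icc_self hp.2)).symm
  · filter_upwards [hmem] with p hp
    exact hC p.1 (Ioc_subset_Icc_self hp.1) p.2 (Ioc_subset_Icc_self hp.2)

theorem integral_swap (hf : RectBdd f u₁ u₂ v₁ v₂) (hu : u₁ ≤ u₂) (hv : v₁ ≤ v₂) :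
    ∫ u in u₁..u₂, ∫ v in v₁..v₂, f u v = ∫ v in v₁..v₂, ∫ u in u₁..u₂, f u v := by
  simp only [intervalIntegral.integral_of_le hu, intervalIntegral.integral_of_le hv]
  exact integral_integral_swap hf.integrable_prod

theorem intervalIntegrable_integral_v (hf : RectBdd f u₁ u₂ v₁ v₂) (hu : u₁ ≤ u₂) (hv : v₁ ≤ v₂) :
    IntervalIntegrable (fun u => ∫ v in v₁..v₂, f u v) volume u₁ u₂ := by
  rw [intervalIntegrable_iff_integrableOn_Ioc_of_le hu]
  simp only [intervalIntegral.integral_of_le hv]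
  exact hf.integrable_prod.integral_prod_left

theorem intervalIntegrable_integral_u (hf : RectBdd f u₁ u₂ v₁ v₂) (hu : u₁ ≤ u₂) (hv : v₁ ≤ v₂) :
    IntervalIntegrable (fun v => ∫ u in u₁..u₂, f u v) volume v₁ v₂ := by
  rw [intervalIntegrable_iff_integrableOn_Ioc_of_le hv]
  simp only [intervalIntegral.integral_of_le hu]
  exact hf.integrable_prod.integral_prod_right

end RectBdd

/-! ### Joint measurability of separately continuous functions and of right derivatives -/

section Measurability

variable {f g : ℝ → ℝ → ℝ} {u₁ u₂ v₁ v₂ : ℝ}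

/-- Projecting onto the rectangle extends the function to one that is continuous in each variable on
the whole plane, and such functions are jointly measurable. -/
theorem exists_measurable_of_separately_continuousOn (hu : u₁ ≤ u₂) (hv : v₁ ≤ v₂)
    (hcu : ∀ v ∈ Icc v₁ v₂, ContinuousOn (fun u => f u v) (Icc u₁ u₂))
    (hcv : ∀ u ∈ Icc u₁ u₂, ContinuousOn (f u) (Icc v₁ v₂)) :
    ∃ F : ℝ × ℝ → ℝ, Measurable F ∧ ∀ u ∈ Icc u₁ u₂, ∀ v ∈ Icc v₁ v₂, f u v = F (u, v) := by
  refine ⟨Function.uncurry fun u v => f (projIcc u₁ u₂ hu u) (projIcc v₁ v₂ hv v), ?_, ?_⟩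
  · refine measurable_uncurry_of_continuous_of_measurable (fun v => ?_) fun u => ?_
    · exact (hcu _ (projIcc v₁ v₂ hv v).2).comp_continuous
        (continuous_subtype_val.comp continuous_projIcc) fun u => (projIcc u₁ u₂ hu u).2
    · exact ((hcv _ (projIcc u₁ u₂ hu u).2).comp_continuous
        (continuous_subtype_val.comp continuous_projIcc) fun v => (projIcc v₁ v₂ hv v).2).measurable
  · intro u hu' v hv'
    simp [projIcc_of_mem hu hu', projIcc_of_mem hv hv']

theorem tendsto_slope_of_hasDerivWithinAt {f : ℝ → ℝ} {f' x : ℝ}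
    (hf : HasDerivWithinAt f f' (Ioi x) x) {s : ℕ → ℝ} (hs : ∀ n, 0 < s n)
    (hs0 : Tendsto s atTop (𝓝 0)) :
    Tendsto (fun n => (f (x + s n) - f x) / s n) atTop (𝓝 f') := by
  have h1 := (hasDerivWithinAt_iff_tendsto_slope' (by simp)).1 hf
  have h2 : Tendsto (fun n => x + s n) atTop (𝓝[>] x) := by
    refine tendsto_nhdsWithin_iff.2 ⟨by simpa using hs0.const_add x, ?_⟩
    exact Eventually.of_forall fun n => by simpa using hs n
  refine (h1.comp h2).congr fun n => ?_
  simp [slope_def_field]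

/-- The right derivative is a pointwise limit of measurable difference quotients. The extra room up
to `v₃` keeps the shifted points inside the region where f is measurable. -/
theorem exists_measurable_deriv_v {v₃ : ℝ} (hv₃ : v₂ < v₃)
    (hf : ∃ F : ℝ × ℝ → ℝ, Measurable F ∧ ∀ u ∈ Icc u₁ u₂, ∀ v ∈ Icc v₁ v₃, f u v = F (u, v))
    (hfg : ∀ u ∈ Icc u₁ u₂, ∀ v ∈ Icc v₁ v₂, HasDerivWithinAt (f u) (g u v) (Ioi v) v) :
    ∃ F : ℝ × ℝ → ℝ, Measurable F ∧ ∀ u ∈ Icc u₁ u₂, ∀ v ∈ Icc v₁ v₂, g u v = F (u, v) := by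
  obtain ⟨F, hF, hF'⟩ := hf
  let s : ℕ → ℝ := fun n => (v₃ - v₂) * (1 / ((n : ℝ) + 1))
  have hpos : 0 < v₃ - v₂ := sub_pos.2 hv₃
  have hs : ∀ n, 0 < s n := fun n => by positivity
  have hsle : ∀ n, s n ≤ v₃ - v₂ := fun n => by
    have : 1 / ((n : ℝ) + 1) ≤ 1 := by
      rw [div_le_one (by positivity)]
      linarith [n.cast_nonneg (α := ℝ)]
    simp only [s]
    nlinarith
  have hs0 : Tendsto s atTop (𝓝 0) := by
    have := (tendsto_one_div_add_atTop_nhds_zero_nat (𝕜 := ℝ)).const_mul (v₃ - v₂)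
    rwa [mul_zero] at this
  have hR : MeasurableSet (Icc u₁ u₂ ×ˢ Icc v₁ v₂) := measurableSet_Icc.prod measurableSet_Icc
  refine ⟨(Icc u₁ u₂ ×ˢ Icc v₁ v₂).indicator (Function.uncurry g), ?_, fun u hu v hv => ?_⟩
  · refine measurable_of_tendsto_metrizable (f := fun n => (Icc u₁ u₂ ×ˢ Icc v₁ v₂).indicator
      fun p => (F (p.1, p.2 + s n) - F p) / s n) (fun n => ?_) (tendsto_pi_nhds.2 fun p => ?_)
    · exact (((hF.comp (measurable_fst.prodMk (measurable_snd.add_const _))).sub hF).div_const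
        _).indicator hR
    · by_cases hp : p ∈ Icc u₁ u₂ ×ˢ Icc v₁ v₂
      · simp only [indicator_of_mem hp]
        refine (tendsto_slope_of_hasDerivWithinAt (hfg p.1 hp.1 p.2 hp.2) hs hs0).congr fun n => ?_
        rw [hF' p.1 hp.1 p.2 ⟨hp.2.1, hp.2.2.trans hv₃.le⟩, hF' p.1 hp.1 (p.2 + s n)
          ⟨by linarith [hp.2.1, hs n], by linarith [hp.2.2, hsle n]⟩]
      · simp only [indicator_of_notMem hp]
        exact tendsto_const_nhds
  · rw [indicator_of_mem (by exact ⟨hu, hv⟩)]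
    rfl

theorem exists_measurable_deriv_u {u₃ : ℝ} (hu₃ : u₂ < u₃)
    (hf : ∃ F : ℝ × ℝ → ℝ, Measurable F ∧ ∀ u ∈ Icc u₁ u₃, ∀ v ∈ Icc v₁ v₂, f u v = F (u, v))
    (hfg : ∀ u ∈ Icc u₁ u₂, ∀ v ∈ Icc v₁ v₂,
      HasDerivWithinAt (fun u' => f u' v) (g u v) (Ioi u) u) :
    ∃ F : ℝ × ℝ → ℝ, Measurable F ∧ ∀ u ∈ Icc u₁ u₂, ∀ v ∈ Icc v₁ v₂, g u v = F (u, v) := by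
  obtain ⟨F, hF, hF'⟩ := hf
  obtain ⟨G, hG, hG'⟩ := exists_measurable_deriv_v (f := fun v u => f u v) (g := fun v u => g u v)
    (u₁ := v₁) (u₂ := v₂) (v₁ := u₁) hu₃
    ⟨fun p => F (p.2, p.1), hF.comp measurable_swap, fun v hv u hu => hF' u hu v hv⟩
    fun v hv u hu => hfg u hu v hv
  exact ⟨fun p => G (p.2, p.1), hG.comp measurable_swap, fun u hu v hv => hG' v hv u hu⟩

end Measurability

theorem abs_sub_le_of_eVariationOn_le {f : ℝ → ℝ} {s : Set ℝ} {C : ℝ}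
    (hf : eVariationOn f s ≤ ENNReal.ofReal C) {x y : ℝ} (hx : x ∈ s) (hy : y ∈ s) :
    |f x - f y| ≤ max C 0 := by
  have h1 := (eVariationOn.edist_le f hx hy).trans hf
  rw [edist_dist, Real.dist_eq, ENNReal.ofReal_le_ofReal_iff'] at h1
  rcases h1 with h1 | h1
  · exact h1.trans (le_max_left _ _)
  · exact h1.trans (le_max_right _ _)

/-! ### Bounds for solutions on rectangles off the axis -/

namespace IsBVSolution

variable {φ r m : ℝ → ℝ → ℝ} {u₁ u₂ v₁ v₂ : ℝ}

theorem rectBdd_r (h : IsBVSolution φ r m) (h1 : 1 ≤ u₁) (hu : u₁ ≤ u₂) (huv : u₂ < v₁)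
    (hv : v₁ ≤ v₂) : RectBdd r u₁ u₂ v₁ v₂ where
  meas := exists_measurable_of_separately_continuousOn hu hv
    (fun v hv' => (h.r_u (by linarith [hv'.1])).continuousOn.mono
      (Icc_subset_Icc h1 (huv.le.trans hv'.1)))
    fun u hu' => h.continuousOn_r_v (h1.trans hu'.1) (hu'.2.trans huv.le)
  bdd := by
    refine ⟨r u₁ v₂, fun u hu' v hv' => ?_⟩
    have h2 : 1 ≤ u := h1.trans hu'.1
    have h3 : u ≤ v := hu'.2.trans (huv.le.trans hv'.1)
    rw [abs_of_nonneg (h.r_nonneg h2 h3)]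
    exact (h.r_mono_v h2 h3 hv'.2).trans (h.r_anti_u h1 hu'.1 (h3.trans hv'.2))

theorem le_r (h : IsBVSolution φ r m) (h1 : 1 ≤ u₁) (huv : u₂ < v₁) {u v : ℝ}
    (hu : u ∈ Icc u₁ u₂) (hv : v₁ ≤ v) : r u₂ v₁ ≤ r u v :=
  (h.r_anti_u (h1.trans hu.1) hu.2 huv.le).trans
    (h.r_mono_v (h1.trans hu.1) (hu.2.trans huv.le) hv)

theorem rectBdd_r_inv (h : IsBVSolution φ r m) (h1 : 1 ≤ u₁) (hu : u₁ ≤ u₂) (huv : u₂ < v₁)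
    (hv : v₁ ≤ v₂) : RectBdd (fun u v => (r u v)⁻¹) u₁ u₂ v₁ v₂ :=
  (h.rectBdd_r h1 hu huv hv).inv (h.r_pos u₂ v₁ (h1.trans hu) huv) fun _ hu' _ hv' =>
    (h.le_r h1 huv hu' hv'.1).trans (le_abs_self _)

theorem meas_phi (h : IsBVSolution φ r m) (h1 : 1 ≤ u₁) (hu : u₁ ≤ u₂) (huv : u₂ < v₁)
    (hv : v₁ ≤ v₂) :
    ∃ F : ℝ × ℝ → ℝ, Measurable F ∧ ∀ u ∈ Icc u₁ u₂, ∀ v ∈ Icc v₁ v₂, φ u v = F (u, v) :=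
  exists_measurable_of_separately_continuousOn hu hv
    (fun v hv' => (h.phi_u (by linarith [hv'.1])).continuousOn.mono
      (Icc_subset_Icc h1 (huv.le.trans hv'.1)))
    fun _ hu' => (h.phi_v (h1.trans hu'.1) ((hu'.2.trans huv.le).trans hv)).continuousOn.mono
      (Icc_subset_Icc_left (hu'.2.trans huv.le))

theorem rectBdd_phi (h : IsBVSolution φ r m) (h1 : 1 ≤ u₁) (hu : u₁ ≤ u₂) (huv : u₂ < v₁)
    (hv : v₁ ≤ v₂) : RectBdd φ u₁ u₂ v₁ v₂ where
  meas := h.meas_phi h1 hu huv hv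
  bdd := by
    obtain ⟨C, hC⟩ := h.bv_phi_v u₁ v₂ h1 (by linarith)
    obtain ⟨D, hD⟩ := isCompact_Icc.exists_bound_of_continuousOn
      ((h.phi_u (v := v₁) (by linarith)).continuousOn.mono (Icc_subset_Icc h1 huv.le))
    refine ⟨max C 0 + D, fun u hu' v hv' => ?_⟩
    have h3 : u ≤ v₁ := hu'.2.trans huv.le
    have h2 := abs_sub_le_of_eVariationOn_le (hC u ⟨hu'.1, h3.trans hv⟩)
      (x := v) (y := v₁) ⟨h3.trans hv'.1, hv'.2⟩ ⟨h3, hv⟩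
    have h4 := hD u hu'
    rw [Real.norm_eq_abs] at h4
    calc |φ u v| = |(φ u v - φ u v₁) + φ u v₁| := by ring_nf
      _ ≤ _ := (abs_add_le _ _).trans (add_le_add h2 h4)

theorem rectBdd_lam (h : IsBVSolution φ r m) (h1 : 1 ≤ u₁) (hu : u₁ ≤ u₂) (huv : u₂ < v₁)
    (hv : v₁ ≤ v₂) : RectBdd (lam r) u₁ u₂ v₁ v₂ where
  meas := exists_measurable_deriv_v (v₃ := v₂ + 1) (by linarith)
    (h.rectBdd_r h1 hu huv (by linarith : v₁ ≤ v₂ + 1)).meas fun u hu' v hv' =>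
      h.hasDeriv_r_v (h1.trans hu'.1) (hu'.2.trans_lt (huv.trans_le hv'.1))
  bdd := ⟨1 / 2, fun u hu' v hv' => by
    have h2 : 1 ≤ u := h1.trans hu'.1
    have h3 : u < v := hu'.2.trans_lt (huv.trans_le hv'.1)
    rw [abs_of_pos (h.lam_pos h2 h3)]
    exact h.lam_le_half h2 h3⟩

theorem rectBdd_nu (h : IsBVSolution φ r m) (h1 : 1 ≤ u₁) (hu : u₁ ≤ u₂) (huv : u₂ < v₁)
    (hv : v₁ ≤ v₂) : RectBdd (nu r) u₁ u₂ v₁ v₂ where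
  meas := by
    obtain ⟨u₃, h3, h4⟩ := exists_between huv
    exact exists_measurable_deriv_u h3 (h.rectBdd_r h1 (hu.trans h3.le) h4 hv).meas
      fun u hu' v hv' => h.hasDeriv_r_u (h1.trans hu'.1) (hu'.2.trans_lt (huv.trans_le hv'.1))
  bdd := by
    obtain ⟨C, hC⟩ := h.bdd u₁ v₂ h1 (by linarith)
    refine ⟨C, fun u hu' v hv' => ?_⟩
    have h2 : 1 ≤ u := h1.trans hu'.1
    have h3 : u < v := hu'.2.trans_lt (huv.trans_le hv'.1)
    rw [abs_of_neg (h.nu_neg h2 h3)]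
    exact (hC u v hu'.1 h3 hv'.2).1

theorem rectBdd_nu_inv (h : IsBVSolution φ r m) (h1 : 1 ≤ u₁) (hu : u₁ ≤ u₂) (huv : u₂ < v₁)
    (hv : v₁ ≤ v₂) : RectBdd (fun u v => (nu r u v)⁻¹) u₁ u₂ v₁ v₂ := by
  obtain ⟨c, hc, hlam⟩ := h.exists_lam_ge h1 (by linarith : u₁ ≤ v₂)
  refine (h.rectBdd_nu h1 hu huv hv).inv hc fun u hu' v hv' => ?_
  have h2 : 1 ≤ u := h1.trans hu'.1
  have h3 : u < v := hu'.2.trans_lt (huv.trans_le hv'.1)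
  rw [abs_of_neg (h.nu_neg h2 h3)]
  exact h.le_neg_nu h2 h3 fun x hx hx' => hlam u x hu'.1 hx (hx'.le.trans hv'.2)

theorem rectBdd_dV (h : IsBVSolution φ r m) (h1 : 1 ≤ u₁) (hu : u₁ ≤ u₂) (huv : u₂ < v₁)
    (hv : v₁ ≤ v₂) : RectBdd (dV φ) u₁ u₂ v₁ v₂ := by
  have hb : RectBdd (dV (rphi r φ)) u₁ u₂ v₁ v₂ := by
    refine ⟨?_, ?_⟩
    · obtain ⟨F, hF, hF'⟩ := (h.rectBdd_r h1 hu huv (by linarith : v₁ ≤ v₂ + 1)).meas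
      obtain ⟨G, hG, hG'⟩ := h.meas_phi h1 hu huv (by linarith : v₁ ≤ v₂ + 1)
      exact exists_measurable_deriv_v (f := rphi r φ) (v₃ := v₂ + 1) (by linarith)
        ⟨fun p => F p * G p, hF.mul hG, fun u hu v hv => by
          rw [rphi, hF' u hu v hv, hG' u hu v hv]⟩ fun u hu' v hv' =>
        h.hasDeriv_rphi_v (h1.trans hu'.1) (hu'.2.trans_lt (huv.trans_le hv'.1))
    · obtain ⟨C, hC⟩ := h.bv_dV u₁ v₂ h1 (by linarith)
      obtain ⟨D, hD⟩ := isCompact_Icc.exists_bound_of_continuousOn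
        (h.dV_rphi_u h1 hu huv).continuousOn
      refine ⟨max C 0 + D, fun u hu' v hv' => ?_⟩
      have h3 : u < v₁ := hu'.2.trans_lt huv
      have h2 := abs_sub_le_of_eVariationOn_le (hC u ⟨hu'.1, h3.le.trans hv⟩)
        (x := v) (y := v₁) ⟨h3.trans_le hv'.1, hv'.2⟩ ⟨h3, hv⟩
      have h4 := hD u hu'
      rw [Real.norm_eq_abs] at h4
      calc |dV (rphi r φ) u v| = |(dV (rphi r φ) u v - dV (rphi r φ) u v₁) + dV (rphi r φ) u v₁| := by
            ring_nf
        _ ≤ _ := (abs_add_le _ _).trans (add_le_add h2 h4)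
  refine ((hb.sub ((h.rectBdd_lam h1 hu huv hv).mul (h.rectBdd_phi h1 hu huv hv))).mul
    (h.rectBdd_r_inv h1 hu huv hv)).congr fun u hu' v hv' => ?_
  have h2 : 1 ≤ u := h1.trans hu'.1
  have h3 : u < v := hu'.2.trans_lt (huv.trans_le hv'.1)
  have h4 := (h.r_pos u v h2 h3).ne'
  rw [← h.r_mul_dV h2 h3]
  field_simp

theorem rectBdd_dU_rphi (h : IsBVSolution φ r m) (h1 : 1 ≤ u₁) (hu : u₁ ≤ u₂) (huv : u₂ < v₁)
    (hv : v₁ ≤ v₂) : RectBdd (dU (rphi r φ)) u₁ u₂ v₁ v₂ := by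
  refine ⟨?_, ?_⟩
  · obtain ⟨u₃, h3, h4⟩ := exists_between huv
    obtain ⟨F, hF, hF'⟩ := (h.rectBdd_r h1 (hu.trans h3.le) h4 hv).meas
    obtain ⟨G, hG, hG'⟩ := h.meas_phi h1 (hu.trans h3.le) h4 hv
    exact exists_measurable_deriv_u (f := rphi r φ) h3
      ⟨fun p => F p * G p, hF.mul hG, fun u hu v hv => by
        rw [rphi, hF' u hu v hv, hG' u hu v hv]⟩ fun u hu' v hv' =>
      h.hasDeriv_rphi_u (h1.trans hu'.1) (hu'.2.trans_lt (huv.trans_le hv'.1))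
  · obtain ⟨C, hC⟩ := h.bv_dU u₁ v₂ h1 (by linarith)
    obtain ⟨D, hD⟩ := isCompact_Icc.exists_bound_of_continuousOn
      (h.dU_rphi_v h1 (hu.trans_lt huv) hv).continuousOn
    refine ⟨max C 0 + D, fun u hu' v hv' => ?_⟩
    have h3 : u < v := hu'.2.trans_lt (huv.trans_le hv'.1)
    have h2 := abs_sub_le_of_eVariationOn_le (hC v ⟨hu'.1.trans h3.le, hv'.2⟩)
      (x := u) (y := u₁) ⟨hu'.1, h3⟩ ⟨le_rfl, hu'.1.trans_lt h3⟩
    have h4 := hD v hv'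
    rw [Real.norm_eq_abs] at h4
    calc |dU (rphi r φ) u v| = |(dU (rphi r φ) u v - dU (rphi r φ) u₁ v) + dU (rphi r φ) u₁ v| := by
          ring_nf
      _ ≤ _ := (abs_add_le _ _).trans (add_le_add h2 h4)

theorem rectBdd_dU (h : IsBVSolution φ r m) (h1 : 1 ≤ u₁) (hu : u₁ ≤ u₂) (huv : u₂ < v₁)
    (hv : v₁ ≤ v₂) : RectBdd (dU φ) u₁ u₂ v₁ v₂ := by
  refine (((h.rectBdd_dU_rphi h1 hu huv hv).sub ((h.rectBdd_nu h1 hu huv hv).mul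
    (h.rectBdd_phi h1 hu huv hv))).mul
    (h.rectBdd_r_inv h1 hu huv hv)).congr fun u hu' v hv' => ?_
  have h2 : 1 ≤ u := h1.trans hu'.1
  have h3 : u < v := hu'.2.trans_lt (huv.trans_le hv'.1)
  have h4 := (h.r_pos u v h2 h3).ne'
  rw [← h.r_mul_dU h2 h3]
  field_simp

theorem rectBdd_nuInvDU (h : IsBVSolution φ r m) (h1 : 1 ≤ u₁) (hu : u₁ ≤ u₂) (huv : u₂ < v₁)
    (hv : v₁ ≤ v₂) : RectBdd (nuInvDU φ r) u₁ u₂ v₁ v₂ :=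
  (h.rectBdd_nu_inv h1 hu huv hv).mul (h.rectBdd_dU_rphi h1 hu huv hv)

theorem rectBdd_mixed (h : IsBVSolution φ r m) (h1 : 1 ≤ u₁) (hu : u₁ ≤ u₂) (huv : u₂ < v₁)
    (hv : v₁ ≤ v₂) : RectBdd (mixed φ r) u₁ u₂ v₁ v₂ :=
  ((((h.rectBdd_lam h1 hu huv hv).mul (h.rectBdd_dU h1 hu huv hv)).add
    ((h.rectBdd_nu h1 hu huv hv).mul (h.rectBdd_dV h1 hu huv hv))).neg.mul
    (h.rectBdd_r_inv h1 hu huv hv)).congr fun u _ v _ => by rw [mixed, div_eq_mul_inv]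

theorem logKap_anti_u (h : IsBVSolution φ r m) {x y v : ℝ} (hx : 1 ≤ x) (hxy : x ≤ y) (hy : y < v) :
    logKap r m y v ≤ logKap r m x v := by
  refine (h.logKap_u hx hxy hy).le_of_nonpos fun z hz => ?_
  have hz1 : 1 ≤ z := hx.trans hz.1.le
  have hzv := hz.2.trans hy
  have := h.r_pos z v hz1 hzv
  exact div_nonpos_of_nonneg_of_nonpos (by positivity) (h.nu_neg hz1 hzv).le

theorem exp_logKap (h : IsBVSolution φ r m) {u v : ℝ} (hu : 1 ≤ u) (huv : u < v) :
    Real.exp (logKap r m u v) = lam r u v / (1 - massRatio r m u v) := by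
  rw [logKap, Real.exp_sub, Real.exp_log (h.lam_pos hu huv), Real.exp_log (h.one_sub_pos hu huv)]

theorem div_one_sub_anti_u (h : IsBVSolution φ r m) {x y v : ℝ} (hx : 1 ≤ x) (hxy : x ≤ y)
    (hy : y < v) :
    lam r y v / (1 - massRatio r m y v) ≤ lam r x v / (1 - massRatio r m x v) := by
  rw [← h.exp_logKap (hx.trans hxy) hy, ← h.exp_logKap hx (hxy.trans_lt hy)]
  exact Real.exp_le_exp.2 (h.logKap_anti_u hx hxy hy)

/-- Only 1/(1-μ) needs an argument. Since λ/(1-μ) does not increase in u, a lower bound for 1-μ on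
the edge u = u₁, which exists by compactness, propagates to the rectangle. -/
theorem rectBdd_potential (h : IsBVSolution φ r m) (h1 : 1 ≤ u₁) (hu : u₁ ≤ u₂) (huv : u₂ < v₁)
    (hv : v₁ ≤ v₂) : RectBdd (potential r m) u₁ u₂ v₁ v₂ := by
  have hmu : RectBdd (fun u v => 1 - massRatio r m u v) u₁ u₂ v₁ v₂ := by
    refine ⟨exists_measurable_of_separately_continuousOn hu hv
      (fun v hv' => (h.massRatio_u h1 hu (huv.trans_le hv'.1)).continuousOn)
      fun u hu' => (h.massRatio_v (h1.trans hu'.1) (hu'.2.trans_lt huv) hv).continuousOn, 1,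
      fun u hu' v hv' => ?_⟩
    have h2 : 1 ≤ u := h1.trans hu'.1
    have h3 : u < v := hu'.2.trans_lt (huv.trans_le hv'.1)
    rw [abs_of_pos (h.one_sub_pos h2 h3)]
    linarith [h.massRatio_nonneg h2 h3]
  obtain ⟨c, hc, hlam⟩ := h.exists_lam_ge h1 (by linarith : u₁ ≤ v₂)
  obtain ⟨x, hx, hxm⟩ := isCompact_Icc.exists_isMinOn (nonempty_Icc.2 hv)
    (h.massRatio_v h1 (hu.trans_lt huv) hv).continuousOn
  have hq : 0 < 1 - massRatio r m u₁ x := h.one_sub_pos h1 (hu.trans_lt (huv.trans_le hx.1))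
  -- Monotonicity gives 1-μ(u,v) ≥ (1-μ(u₁,v)) λ(u,v)/λ(u₁,v); here λ(u,v) ≥ c and λ(u₁,v) ≤ 1/2.
  have hinv := hmu.inv (c := 2 * c * (1 - massRatio r m u₁ x)) (by positivity) fun u hu' v hv' => by
    have h2 : 1 ≤ u := h1.trans hu'.1
    have h3 : u < v := hu'.2.trans_lt (huv.trans_le hv'.1)
    have h4 := h.one_sub_pos h2 h3
    have h5 := h.div_one_sub_anti_u h1 hu'.1 h3
    have h6 := hlam u v hu'.1 h3 hv'.2
    have h7 : 1 - massRatio r m u₁ x ≤ 1 - massRatio r m u₁ v := hxm hv'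
    have h8 := h.lam_le_half h1 (hu'.1.trans_lt h3)
    rw [abs_of_pos h4]
    rw [div_le_div_iff₀ h4 (hq.trans_le h7)] at h5
    nlinarith
  -- The factor μ is assembled as (μ - 1) + (1-μ)(1-μ)⁻¹.
  refine ((((((hmu.neg.congr (g := fun u v => massRatio r m u v - 1) fun u _ v _ => by ring).add
    (hmu.mul hinv)).mul (h.rectBdd_lam h1 hu huv hv)).mul (h.rectBdd_nu h1 hu huv hv)).mul hinv).mul
    (h.rectBdd_r_inv h1 hu huv hv)).congr fun u hu' v hv' => ?_
  have h2 : 1 ≤ u := h1.trans hu'.1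
  have h3 : u < v := hu'.2.trans_lt (huv.trans_le hv'.1)
  have h4 := (h.one_sub_pos h2 h3).ne'
  have h5 := (h.r_pos u v h2 h3).ne'
  rw [potential, mul_inv_cancel₀ h4]
  field_simp
  ring

end IsBVSolution

end SSESF

/-! ### Two functions on outgoing curves adapted to the null forms -/

namespace SSESF

theorem intervalIntegrable_bdd_mul {f g : ℝ → ℝ} {a b C : ℝ} (hab : a ≤ b)
    (hf : IntervalIntegrable f volume a b)
    (hg : AEStronglyMeasurable g (volume.restrict (Ioc a b))) (hC : ∀ x ∈ Ioc a b, |g x| ≤ C) :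
    IntervalIntegrable (fun x => g x * f x) volume a b := by
  rw [intervalIntegrable_iff_integrableOn_Ioc_of_le hab] at hf ⊢
  exact hf.bdd_mul hg ((ae_restrict_iff' measurableSet_Ioc).2 (Eventually.of_forall hC))

/-- The function whose distributional derivative in `v` is `∂_v² (r φ) - φ ∂_v λ`. -/
noncomputable def waveFn (φ r : ℝ → ℝ → ℝ) (u v : ℝ) : ℝ :=
  r u v * dV φ u v + ∫ x in u..v, lam r u x * dV φ u x

/-- The function whose distributional derivative in `v` is
`∂_v log (λ / (1 - μ)) - ∂_v φ (ν⁻¹ ∂_u (r φ) - φ)`. -/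
noncomputable def massFn (φ r m : ℝ → ℝ → ℝ) (u v : ℝ) : ℝ :=
  logKap r m u v - ∫ x in u..v, (nuInvDU φ r u x - φ u x) * dV φ u x

namespace IsBVSolution

variable {φ r m : ℝ → ℝ → ℝ}

/-! ### Behaviour at the axis -/

theorem exists_tendsto_of_bv {f : ℝ → ℝ} {u V : ℝ} {C : ℝ} (huV : u < V)
    (hf : eVariationOn f (Ioc u V) ≤ ENNReal.ofReal C) : ∃ l, Tendsto f (𝓝[>] u) (𝓝 l) := by
  have hbv : BoundedVariationOn f (Ioc u V) := ne_top_of_le_ne_top ENNReal.ofReal_ne_top hf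
  obtain ⟨l, hl⟩ := hbv.exists_tendsto_right u
  refine ⟨l, hl.mono_left ?_⟩
  rw [inter_eq_left.2 fun x hx => hx.1, nhdsWithin_Ioc_eq_nhdsGT huV]

theorem tendsto_lam (h : IsBVSolution φ r m) {u : ℝ} (hu : 1 ≤ u) :
    Tendsto (lam r u) (𝓝[>] u) (𝓝 (lamAxis r u)) := by
  obtain ⟨C, hC⟩ := h.bv_lam u (u + 1) hu (by linarith)
  obtain ⟨l, hl⟩ := exists_tendsto_of_bv (by linarith) (hC u ⟨le_rfl, by linarith⟩)
  rw [lamAxis, rightLim_eq_of_tendsto hl]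
  exact hl

/-- Redefining g at the single point u by its right limit makes it right-continuous there without
affecting the almost-everywhere derivative. -/
theorem hasDerivWithinAt_axis {f g : ℝ → ℝ} {u V l : ℝ} (huV : u < V) (hf : HasAEDerivOn f g u V)
    (hl : Tendsto g (𝓝[>] u) (𝓝 l)) : HasDerivWithinAt f l (Ioi u) u := by
  have h1 : HasAEDerivOn f (Function.update g u l) u V :=
    hf.congr_deriv fun x hx => by rw [Function.update_of_ne hx.1.ne']
  have h2 : ContinuousWithinAt (Function.update g u l) (Ici u) u := by
    rw [continuousWithinAt_update_same]
    simpa using hl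
  simpa using h1.hasDerivWithinAt ⟨le_rfl, huV⟩ h2

theorem tendsto_phi_axis (h : IsBVSolution φ r m) {u : ℝ} (hu : 1 ≤ u) :
    Tendsto (φ u) (𝓝[>] u) (𝓝 (φ u u)) := by
  have h1 := (h.phi_v hu (by linarith : u ≤ u + 1)).continuousOn u ⟨le_rfl, by linarith⟩
  exact (h1.mono_of_mem_nhdsWithin (Icc_mem_nhdsGT (by linarith))).tendsto

/-- The limit of ∂_v(rφ) at the axis is the right derivative of rφ there. As r vanishes on the axis,
the difference quotient of rφ is that of r times φ, so this limit equals λ_Γ φ and cancels in r∂_vφ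
= ∂_v(rφ) - λφ. -/
theorem tendsto_r_mul_dV_axis (h : IsBVSolution φ r m) {u : ℝ} (hu : 1 ≤ u) :
    Tendsto (fun v => r u v * dV φ u v) (𝓝[>] u) (𝓝 0) := by
  obtain ⟨C, hC⟩ := h.bv_dV u (u + 1) hu (by linarith)
  obtain ⟨p, hp⟩ := exists_tendsto_of_bv (by linarith) (hC u ⟨le_rfl, by linarith⟩)
  have hlam := h.tendsto_lam hu
  have hphi := h.tendsto_phi_axis hu
  have h1 := hasDerivWithinAt_axis (by linarith) (h.rphi_v hu (by linarith : u ≤ u + 1)) hp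
  have h2 := hasDerivWithinAt_axis (by linarith) (h.r_v hu (by linarith : u ≤ u + 1)) hlam
  rw [hasDerivWithinAt_iff_tendsto_slope' (by simp)] at h1 h2
  have h3 : p = lamAxis r u * φ u u := by
    refine tendsto_nhds_unique h1 ((h2.mul hphi).congr' ?_)
    filter_upwards [self_mem_nhdsWithin] with v _
    simp only [slope_def_field, rphi, h.r_axis u hu]
    ring
  have h4 : Tendsto (fun v => dV (rphi r φ) u v - lam r u v * φ u v) (𝓝[>] u) (𝓝 0) := by
    have := hp.sub (hlam.mul hphi)
    rwa [h3, sub_self] at this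
  refine h4.congr' ?_
  filter_upwards [self_mem_nhdsWithin] with v hv
  exact (h.r_mul_dV hu hv).symm

theorem tendsto_sub_axis {f : ℝ → ℝ} {u l : ℝ}
    (hf : Tendsto (fun ε => f (u + ε)) (𝓝[>] 0) (𝓝 l)) : Tendsto f (𝓝[>] u) (𝓝 l) := by
  have h1 : Tendsto (fun v => v - u) (𝓝[>] u) (𝓝[>] 0) := by
    refine tendsto_nhdsWithin_iff.2 ⟨?_, ?_⟩
    · have : Tendsto (fun v : ℝ => v - u) (𝓝 u) (𝓝 (u - u)) := tendsto_id.sub_const u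
      rw [sub_self] at this
      exact this.mono_left nhdsWithin_le_nhds
    · filter_upwards [self_mem_nhdsWithin] with v hv
      exact sub_pos.2 (mem_Ioi.1 hv)
  refine (hf.comp h1).congr fun v => ?_
  simp

/-- The two axis conditions combine to r∂_uφ + r∂_vφ → 0. -/
theorem tendsto_r_mul_dU_axis (h : IsBVSolution φ r m) {u : ℝ} (hu : 1 ≤ u) :
    Tendsto (fun v => r u v * dU φ u v) (𝓝[>] u) (𝓝 0) := by
  have h1 := tendsto_sub_axis (f := fun v => nu r u v + lam r u v) (h.axis_r u hu)
  have h2 := tendsto_sub_axis (f := fun v => dV (rphi r φ) u v + dU (rphi r φ) u v)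
    (h.axis_rphi u hu)
  have h3 := (h2.sub (h1.mul (h.tendsto_phi_axis hu))).sub (h.tendsto_r_mul_dV_axis hu)
  rw [zero_mul, sub_zero, sub_zero] at h3
  refine h3.congr' ?_
  filter_upwards [self_mem_nhdsWithin] with v hv
  rw [h.r_mul_dU hu hv, h.r_mul_dV hu hv]
  ring

theorem intervalIntegrable_abs_dV (h : IsBVSolution φ r m) {u x y : ℝ} (hu : 1 ≤ u) (hx : u ≤ x)
    (hxy : x ≤ y) : IntervalIntegrable (fun v => |dV φ u v|) volume x y :=
  ((h.phi_v hu (hx.trans hxy)).intervalIntegrable' hx hxy le_rfl).abs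

/-- Integrate ∂_v(r∂_uφ) = -ν∂_vφ from the axis, where r∂_uφ vanishes; -ν is nondecreasing in v and
can be taken out at the endpoint. After division by -ν this bounds X - φ by the variation of φ. -/
theorem abs_r_mul_dU_le (h : IsBVSolution φ r m) {u v : ℝ} (hu : 1 ≤ u) (huv : u < v) :
    |r u v * dU φ u v| ≤ -nu r u v * ∫ x in u..v, |dV φ u x| := by
  refine le_of_tendsto_of_tendsto (b := 𝓝[>] u) (f := fun _ => |r u v * dU φ u v|)
    (g := fun x => |r u x * dU φ u x| + -nu r u v * ∫ x in u..v, |dV φ u x|) tendsto_const_nhds ?_ ?_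
  · simpa using (h.tendsto_r_mul_dU_axis hu).abs.add_const (-nu r u v * ∫ x in u..v, |dV φ u x|)
  · filter_upwards [Ioo_mem_nhdsGT huv] with x hx
    have hi := h.intervalIntegrable_abs_dV hu hx.1.le hx.2.le
    have h1 := (h.r_mul_dU_v hu hx.1 hx.2.le).abs_sub_le_sub
      (HasAEDerivOn.of_integral hx.2.le (hi.const_mul (-nu r u v)) 0) fun y hy => by
        rw [abs_neg, abs_mul]
        have hy1 := hx.1.trans hy.1
        rw [abs_of_neg (h.nu_neg hu hy1)]
        exact mul_le_mul_of_nonneg_right (neg_le_neg (h.nu_anti_v hu hy1 hy.2.le)) (abs_nonneg _)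
    simp only [intervalIntegral.integral_same, add_zero, zero_add, sub_zero,
      intervalIntegral.integral_const_mul] at h1
    have h2 := intervalIntegral.integral_add_adjacent_intervals
      (h.intervalIntegrable_abs_dV hu le_rfl hx.1.le) hi
    have h3 : 0 ≤ ∫ y in u..x, |dV φ u y| :=
      intervalIntegral.integral_nonneg hx.1.le fun _ _ => abs_nonneg _
    have h4 : -nu r u v * ∫ y in x..v, |dV φ u y| ≤ -nu r u v * ∫ y in u..v, |dV φ u y| := by
      refine mul_le_mul_of_nonneg_left (by linarith) ?_
      linarith [h.nu_neg hu huv]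
    have h5 : |r u v * dU φ u v| ≤ |r u v * dU φ u v - r u x * dU φ u x| + |r u x * dU φ u x| := by
      have := abs_add_le (r u v * dU φ u v - r u x * dU φ u x) (r u x * dU φ u x)
      rwa [sub_add_cancel] at this
    linarith

theorem abs_nuInvDU_sub_le (h : IsBVSolution φ r m) {u v : ℝ} (hu : 1 ≤ u) (huv : u < v) :
    |nuInvDU φ r u v - φ u v| ≤ ∫ x in u..v, |dV φ u x| := by
  have hn := h.nu_neg hu huv
  rw [h.nuInvDU_sub hu huv, abs_div, abs_of_neg hn, div_le_iff₀ (neg_pos.2 hn),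
    mul_comm (∫ x in u..v, |dV φ u x|)]
  exact h.abs_r_mul_dU_le hu huv

theorem continuousOn_Ioc_of {f : ℝ → ℝ} {u V : ℝ} (hf : ∀ x, u < x → x ≤ V → ContinuousOn f (Icc x V)) :
    ContinuousOn f (Ioc u V) := by
  intro x hx
  obtain ⟨y, hy1, hy2⟩ := exists_between hx.1
  refine (hf y hy1 (hy2.le.trans hx.2) x ⟨hy2.le, hx.2⟩).mono_of_mem_nhdsWithin ?_
  filter_upwards [mem_nhdsWithin_of_mem_nhds (Ioi_mem_nhds hy2), self_mem_nhdsWithin] with z hz hz'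
  exact ⟨le_of_lt hz, hz'.2⟩

theorem intervalIntegrable_lam_mul (h : IsBVSolution φ r m) {u V : ℝ} {f : ℝ → ℝ} (hu : 1 ≤ u)
    (huV : u ≤ V) (hf : IntervalIntegrable f volume u V) :
    IntervalIntegrable (fun v => lam r u v * f v) volume u V := by
  refine intervalIntegrable_bdd_mul (C := 1 / 2) huV hf
    (h.r_v hu huV).intervalIntegrable.1.aestronglyMeasurable fun x hx => ?_
  rw [abs_of_pos (h.lam_pos hu hx.1)]
  exact h.lam_le_half hu hx.1

theorem intervalIntegrable_lam_dV (h : IsBVSolution φ r m) {u V : ℝ} (hu : 1 ≤ u) (huV : u ≤ V) :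
    IntervalIntegrable (fun v => lam r u v * dV φ u v) volume u V :=
  h.intervalIntegrable_lam_mul hu huV (h.phi_v hu huV).intervalIntegrable

theorem intervalIntegrable_nuInvDU_dV (h : IsBVSolution φ r m) {u V : ℝ} (hu : 1 ≤ u)
    (huV : u ≤ V) :
    IntervalIntegrable (fun v => (nuInvDU φ r u v - φ u v) * dV φ u v) volume u V := by
  refine intervalIntegrable_bdd_mul (C := ∫ x in u..V, |dV φ u x|) huV
    (h.phi_v hu huV).intervalIntegrable ?_ fun x hx => ?_
  · refine ContinuousOn.aestronglyMeasurable ?_ measurableSet_Ioc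
    refine ContinuousOn.sub (continuousOn_Ioc_of fun x hx hxV => (h.nuInvDU_v hu hx hxV).continuousOn) ?_
    exact (h.phi_v hu huV).continuousOn.mono Ioc_subset_Icc_self
  · refine (h.abs_nuInvDU_sub_le hu hx.1).trans ?_
    have h2 := intervalIntegral.integral_add_adjacent_intervals
      (h.intervalIntegrable_abs_dV hu le_rfl hx.1.le) (h.intervalIntegrable_abs_dV hu hx.1.le hx.2)
    have h3 : 0 ≤ ∫ y in x..V, |dV φ u y| :=
      intervalIntegral.integral_nonneg hx.2 fun _ _ => abs_nonneg _
    linarith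

theorem integral_sub_of {f : ℝ → ℝ} {u x y : ℝ} (hf : IntervalIntegrable f volume u y) (hx : u ≤ x)
    (hxy : x ≤ y) : (∫ t in u..y, f t) - ∫ t in u..x, f t = ∫ t in x..y, f t :=
  intervalIntegral.integral_interval_sub_left hf
    (hf.mono_set (by rw [uIcc_of_le hx, uIcc_of_le (hx.trans hxy)]; exact Icc_subset_Icc_right hxy))

theorem waveFn_sub (h : IsBVSolution φ r m) {u x y : ℝ} (hu : 1 ≤ u) (hx : u < x) (hxy : x ≤ y) :
    waveFn φ r u y - waveFn φ r u x = r u y * dV φ u y - r u x * dV φ u x +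
      ∫ t in x..y, lam r u t * dV φ u t := by
  rw [← integral_sub_of (h.intervalIntegrable_lam_dV hu (hx.le.trans hxy)) hx.le hxy, waveFn,
    waveFn]
  ring

theorem massFn_sub (h : IsBVSolution φ r m) {u x y : ℝ} (hu : 1 ≤ u) (hx : u < x) (hxy : x ≤ y) :
    massFn φ r m u y - massFn φ r m u x = logKap r m u y - logKap r m u x -
      ∫ t in x..y, (nuInvDU φ r u t - φ u t) * dV φ u t := by
  rw [← integral_sub_of (h.intervalIntegrable_nuInvDU_dV hu (hx.le.trans hxy)) hx.le hxy, massFn,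
    massFn]
  ring

/-! ### The null forms control the variation -/

/-- The integrand on the right is the mass of the first null form on (x, y], written after
integration by parts because λ is only of bounded variation in v. The boundary terms come from
∂_u(r∂_vφ) = -λ∂_uφ and the rest from ∂_u(λ∂_vφ), with the order of integration exchanged. -/
theorem waveFn_sub_sub (h : IsBVSolution φ r m) {u₁ u₂ x y : ℝ} (h1 : 1 ≤ u₁) (hu : u₁ ≤ u₂)
    (hx : u₂ < x) (hxy : x ≤ y) :
    IntervalIntegrable (fun u => dU φ u y * lam r u y - dU φ u x * lam r u x -
      (∫ v in x..y, mixed φ r u v * lam r u v) + ∫ v in x..y, -(dU (lam r) u v * dV φ u v))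
      volume u₁ u₂ ∧
    (waveFn φ r u₂ y - waveFn φ r u₂ x) - (waveFn φ r u₁ y - waveFn φ r u₁ x) =
      -∫ u in u₁..u₂, (dU φ u y * lam r u y - dU φ u x * lam r u x -
      (∫ v in x..y, mixed φ r u v * lam r u v) + ∫ v in x..y, -(dU (lam r) u v * dV φ u v)) := by
  have hy := hx.trans_le hxy
  have hbl := (h.rectBdd_dU h1 hu hx hxy).mul (h.rectBdd_lam h1 hu hx hxy)
  have hml := (h.rectBdd_mixed h1 hu hx hxy).mul (h.rectBdd_lam h1 hu hx hxy)
  have hpa := (h.rectBdd_potential h1 hu hx hxy).mul (h.rectBdd_dV h1 hu hx hxy)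
  have hla := (h.rectBdd_lam h1 hu hx hxy).mul (h.rectBdd_dV h1 hu hx hxy)
  have hE : ∀ u ∈ Icc u₁ u₂, (dU φ u y * lam r u y - dU φ u x * lam r u x -
      (∫ v in x..y, mixed φ r u v * lam r u v) + ∫ v in x..y, -(dU (lam r) u v * dV φ u v)) =
      dU φ u y * lam r u y - dU φ u x * lam r u x -
      ∫ v in x..y, (mixed φ r u v * lam r u v + potential r m u v * dV φ u v) := by
    intro u hu'
    have : ∫ v in x..y, -(dU (lam r) u v * dV φ u v) =
        -∫ v in x..y, potential r m u v * dV φ u v := by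
      rw [← intervalIntegral.integral_neg]
      refine intervalIntegral.integral_congr fun v hv => ?_
      rw [uIcc_of_le hxy] at hv
      simp only [h.dU_lam (h1.trans hu'.1) (hu'.2.trans_lt (hx.trans_le hv.1))]
    rw [this, intervalIntegral.integral_add (hml.intervalIntegrable_v hxy hu')
      (hpa.intervalIntegrable_v hxy hu')]
    ring
  have hi1 := hbl.intervalIntegrable_u hu ⟨hxy, le_refl y⟩
  have hi2 := hbl.intervalIntegrable_u hu ⟨le_refl x, hxy⟩
  have hi3 := (hml.add hpa).intervalIntegrable_integral_v hu hxy
  refine ⟨((hi1.sub hi2).sub hi3).congr fun u hu' => ?_, ?_⟩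
  · rw [uIoc_of_le hu] at hu'
    exact (hE u (Ioc_subset_Icc_self hu')).symm
  rw [h.waveFn_sub (h1.trans hu) hx hxy, h.waveFn_sub h1 (hu.trans_lt hx) hxy]
  have e1 := (h.r_mul_dV_u h1 hu hy).sub_eq
  have e2 := (h.r_mul_dV_u h1 hu hx).sub_eq
  have e3 : (∫ t in x..y, lam r u₂ t * dV φ u₂ t) - (∫ t in x..y, lam r u₁ t * dV φ u₁ t) =
      ∫ u in u₁..u₂, ∫ v in x..y, (mixed φ r u v * lam r u v + potential r m u v * dV φ u v) := by
    rw [(hml.add hpa).integral_swap hu hxy, ← intervalIntegral.integral_sub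
      (hla.intervalIntegrable_v hxy ⟨hu, le_rfl⟩) (hla.intervalIntegrable_v hxy ⟨le_rfl, hu⟩)]
    refine intervalIntegral.integral_congr fun v hv => ?_
    rw [uIcc_of_le hxy] at hv
    have hv' := hx.trans_le hv.1
    exact (((h.lam_u h1 hu hv').mul (h.dV_phi_u h1 hu hv')).congr_deriv fun u _ => by ring).sub_eq
  have e4 : (∫ u in u₁..u₂, (dU φ u y * lam r u y - dU φ u x * lam r u x -
      (∫ v in x..y, mixed φ r u v * lam r u v) + ∫ v in x..y, -(dU (lam r) u v * dV φ u v))) =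
      ∫ u in u₁..u₂, (dU φ u y * lam r u y - dU φ u x * lam r u x -
      ∫ v in x..y, (mixed φ r u v * lam r u v + potential r m u v * dV φ u v)) :=
    intervalIntegral.integral_congr fun u hu' => hE u (by rwa [uIcc_of_le hu] at hu')
  rw [e4, intervalIntegral.integral_sub (hi1.sub hi2) hi3, intervalIntegral.integral_sub hi1 hi2]
  simp only [intervalIntegral.integral_neg] at e1 e2
  simp only [mul_comm (lam r _ _) (dU φ _ _)] at e1 e2
  linarith

/-- Apply the increment identity on each interval of a partition; summing under the u-integral
produces, for every u, a sum of masses of the null form on disjoint intervals. -/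
theorem eVariationOn_waveFn_le (h : IsBVSolution φ r m) {u₁ u₂ : ℝ} (h1 : 1 ≤ u₁) (hu : u₁ ≤ u₂) :
    eVariationOn (waveFn φ r u₂) (Ioi u₂) ≤ eVariationOn (waveFn φ r u₁) (Ioi u₂) +
      ∫⁻ u in Ioc u₁ u₂, formVariation (fun v => dU φ u v) (fun v => lam r u v)
        (fun v => -(dU (lam r) u v * dV φ u v)) (Ioi u) := by
  refine iSup_le fun p => ?_
  obtain ⟨n, t, ht, hts⟩ := p
  have htle : ∀ i, t i ≤ t (i + 1) := fun i => ht i.le_succ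
  let E : ℕ → ℝ → ℝ := fun i u => dU φ u (t (i + 1)) * lam r u (t (i + 1)) -
    dU φ u (t i) * lam r u (t i) - (∫ v in (t i)..(t (i + 1)), mixed φ r u v * lam r u v) +
    ∫ v in (t i)..(t (i + 1)), -(dU (lam r) u v * dV φ u v)
  have hE := fun i => h.waveFn_sub_sub h1 hu (hts i) (htle i)
  have hterm : ∀ i, edist (waveFn φ r u₂ (t (i + 1))) (waveFn φ r u₂ (t i)) ≤
      edist (waveFn φ r u₁ (t (i + 1))) (waveFn φ r u₁ (t i)) + ∫⁻ u in Ioc u₁ u₂, ‖E i u‖ₑ := by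
    intro i
    rw [edist_eq_enorm_sub, edist_eq_enorm_sub]
    have e1 : waveFn φ r u₂ (t (i + 1)) - waveFn φ r u₂ (t i) =
        (waveFn φ r u₁ (t (i + 1)) - waveFn φ r u₁ (t i)) + -∫ u in u₁..u₂, E i u := by
      rw [← (hE i).2]; ring
    rw [e1]
    refine (enorm_add_le _ _).trans (add_le_add le_rfl ?_)
    rw [enorm_neg, intervalIntegral.integral_of_le hu]
    exact enorm_integral_le_lintegral_enorm _
  calc ∑ i ∈ Finset.range n, edist (waveFn φ r u₂ (t (i + 1))) (waveFn φ r u₂ (t i))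
      ≤ ∑ i ∈ Finset.range n, edist (waveFn φ r u₁ (t (i + 1))) (waveFn φ r u₁ (t i)) +
        ∑ i ∈ Finset.range n, ∫⁻ u in Ioc u₁ u₂, ‖E i u‖ₑ := by
        rw [← Finset.sum_add_distrib]
        exact Finset.sum_le_sum fun i _ => hterm i
    _ ≤ _ := by
        refine add_le_add (eVariationOn.sum_le ht hts) ?_
        rw [← lintegral_finsetSum' _ fun i _ => (hE i).1.1.aestronglyMeasurable.enorm]
        refine setLIntegral_mono' measurableSet_Ioc fun u hu' => ?_
        have hu1 : 1 ≤ u := h1.trans hu'.1.le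
        have hut : u < t 0 := hu'.2.trans_lt (hts 0)
        have h0n : t 0 ≤ t n := ht n.zero_le
        have hmem : u ∈ Icc u u := ⟨le_rfl, le_rfl⟩
        obtain ⟨C, hC⟩ := h.bv_lam u (t n) hu1 (hut.le.trans h0n)
        refine sum_enorm_le_formVariation (a := t 0) (b := t n) ?_ ?_ ?_ (h.dU_phi_v hu1 hut h0n)
          (((h.rectBdd_mixed hu1 le_rfl hut h0n).mul
            (h.rectBdd_lam hu1 le_rfl hut h0n)).intervalIntegrable_v h0n hmem) ?_ ht le_rfl le_rfl
        · exact fun v hv => hut.trans_le hv.1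
        · exact ne_top_of_le_ne_top ENNReal.ofReal_ne_top ((eVariationOn.mono _
            (show Icc (t 0) (t n) ⊆ Ioc u (t n) from fun v hv => ⟨hut.trans_le hv.1, hv.2⟩)).trans
            (hC u ⟨le_rfl, hut.le.trans h0n⟩))
        · exact fun v hv => h.rightCts_lam u v hu1 (hut.trans_le hv.1)
        · refine (((h.rectBdd_potential hu1 le_rfl hut h0n).mul
            (h.rectBdd_dV hu1 le_rfl hut h0n)).neg.intervalIntegrable_v h0n hmem).congr fun v hv => ?_
          rw [uIoc_of_le h0n] at hv
          simp only [h.dU_lam hu1 (hut.trans hv.1)]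

end IsBVSolution

end SSESF

/-! ### The second null form and `massFn` -/

namespace SSESF

namespace IsBVSolution

variable {φ r m : ℝ → ℝ → ℝ}

theorem rectBdd_dV_nuInvDU (h : IsBVSolution φ r m) {u₁ u₂ v₁ v₂ : ℝ} (h1 : 1 ≤ u₁) (hu : u₁ ≤ u₂)
    (huv : u₂ < v₁) (hv : v₁ ≤ v₂) : RectBdd (dV (nuInvDU φ r)) u₁ u₂ v₁ v₂ := by
  refine (((h.rectBdd_potential h1 hu huv hv).mul (h.rectBdd_nu_inv h1 hu huv hv)).mul
    ((h.rectBdd_nuInvDU h1 hu huv hv).sub (h.rectBdd_phi h1 hu huv hv))).neg.congr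
    fun u hu' v hv' => ?_
  rw [h.dV_nuInvDU (h1.trans hu'.1) (hu'.2.trans_lt (huv.trans_le hv'.1)), div_eq_mul_inv]

/-- The counterpart for the second null form. Here X is of bounded variation in u only, so the
integration by parts is in u and the null form is integrated along incoming curves first. -/
theorem massFn_sub_sub (h : IsBVSolution φ r m) {u₁ u₂ x y : ℝ} (h1 : 1 ≤ u₁) (hu : u₁ ≤ u₂)
    (hx : u₂ < x) (hxy : x ≤ y) :
    (massFn φ r m u₂ y - massFn φ r m u₂ x) - (massFn φ r m u₁ y - massFn φ r m u₁ x) =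
      ∫ v in x..y, (-dV φ u₂ v * nuInvDU φ r u₂ v - -dV φ u₁ v * nuInvDU φ r u₁ v -
      (∫ u in u₁..u₂, -mixed φ r u v * nuInvDU φ r u v) +
      ∫ u in u₁..u₂, dU φ u v * dV (nuInvDU φ r) u v) := by
  have hy := hx.trans_le hxy
  have ha := h.rectBdd_dV h1 hu hx hxy
  have hb := h.rectBdd_dU h1 hu hx hxy
  have hX := h.rectBdd_nuInvDU h1 hu hx hxy
  have hφ := h.rectBdd_phi h1 hu hx hxy
  have hw := h.rectBdd_mixed h1 hu hx hxy
  have hXv := h.rectBdd_dV_nuInvDU h1 hu hx hxy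
  rw [h.massFn_sub (h1.trans hu) hx hxy, h.massFn_sub h1 (hu.trans_lt hx) hxy]
  have hlog : ∀ v ∈ Icc x y, logKap r m u₂ v - logKap r m u₁ v =
      ∫ u in u₁..u₂, dU φ u v * (nuInvDU φ r u v - φ u v) := by
    intro v hv
    have hv' := hx.trans_le hv.1
    rw [(h.logKap_u h1 hu hv').sub_eq]
    refine intervalIntegral.integral_congr fun u hu' => ?_
    rw [uIcc_of_le hu] at hu'
    rw [h.nuInvDU_sub (h1.trans hu'.1) (hu'.2.trans_lt hv')]
    ring
  have hL := (hw.mul (hX.sub hφ)).add (hb.mul (hXv.sub ha))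
  have e1 : (logKap r m u₂ y - logKap r m u₁ y) - (logKap r m u₂ x - logKap r m u₁ x) =
      ∫ v in x..y, ∫ u in u₁..u₂, (mixed φ r u v * (nuInvDU φ r u v - φ u v) +
        dU φ u v * (dV (nuInvDU φ r) u v - dV φ u v)) := by
    rw [hlog y ⟨hxy, le_rfl⟩, hlog x ⟨le_rfl, hxy⟩, ← hL.integral_swap hu hxy,
      ← intervalIntegral.integral_sub ((hb.mul (hX.sub hφ)).intervalIntegrable_u hu ⟨hxy, le_rfl⟩)
        ((hb.mul (hX.sub hφ)).intervalIntegrable_u hu ⟨le_rfl, hxy⟩)]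
    refine intervalIntegral.integral_congr fun u hu' => ?_
    rw [uIcc_of_le hu] at hu'
    have h1u := h1.trans hu'.1
    have hux := hu'.2.trans_lt hx
    refine (((h.dU_phi_v h1u hux hxy).mul ((h.nuInvDU_v h1u hux hxy).sub
      ((h.phi_v h1u (hux.le.trans hxy)).mono hux.le hxy le_rfl))).congr_deriv fun v hv => ?_).sub_eq
    rw [h.dV_nuInvDU h1u (hux.trans hv.1)]
  have hXa := (hX.sub hφ).mul ha
  have e2 : (∫ t in x..y, (nuInvDU φ r u₂ t - φ u₂ t) * dV φ u₂ t) -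
      (∫ t in x..y, (nuInvDU φ r u₁ t - φ u₁ t) * dV φ u₁ t) =
      ∫ v in x..y, ((nuInvDU φ r u₂ v - φ u₂ v) * dV φ u₂ v -
        (nuInvDU φ r u₁ v - φ u₁ v) * dV φ u₁ v) :=
    (intervalIntegral.integral_sub (hXa.intervalIntegrable_v hxy ⟨hu, le_rfl⟩)
      (hXa.intervalIntegrable_v hxy ⟨le_rfl, hu⟩)).symm
  have e3 : ∫ v in x..y, (-dV φ u₂ v * nuInvDU φ r u₂ v - -dV φ u₁ v * nuInvDU φ r u₁ v -
      (∫ u in u₁..u₂, -mixed φ r u v * nuInvDU φ r u v) +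
      ∫ u in u₁..u₂, dU φ u v * dV (nuInvDU φ r) u v) =
      ∫ v in x..y, ((∫ u in u₁..u₂, (mixed φ r u v * (nuInvDU φ r u v - φ u v) +
        dU φ u v * (dV (nuInvDU φ r) u v - dV φ u v))) -
      ((nuInvDU φ r u₂ v - φ u₂ v) * dV φ u₂ v - (nuInvDU φ r u₁ v - φ u₁ v) * dV φ u₁ v)) := by
    refine intervalIntegral.integral_congr fun v hv => ?_
    rw [uIcc_of_le hxy] at hv
    have hv' := hx.trans_le hv.1
    -- The contributions of the φ in X - φ form the exact derivative ∂_u(φ∂_vφ), and cancel against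
    -- the boundary terms.
    have e4 := (((h.phi_u (h1.trans (hu.trans hv'.le))).mono h1 hu hv'.le).mul
      (h.dV_phi_u h1 hu hv')).sub_eq
    have i1 := (hb.mul ha).intervalIntegrable_u hu hv
    have i2 := (hφ.mul hw).intervalIntegrable_u hu hv
    have i3 := (hw.mul hX).intervalIntegrable_u hu hv
    have i4 := (hb.mul hXv).intervalIntegrable_u hu hv
    have e5 : ∫ u in u₁..u₂, (mixed φ r u v * (nuInvDU φ r u v - φ u v) +
        dU φ u v * (dV (nuInvDU φ r) u v - dV φ u v)) =
        (∫ u in u₁..u₂, mixed φ r u v * nuInvDU φ r u v) +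
        (∫ u in u₁..u₂, dU φ u v * dV (nuInvDU φ r) u v) -
        ∫ u in u₁..u₂, (dU φ u v * dV φ u v + φ u v * mixed φ r u v) := by
      rw [← intervalIntegral.integral_add i3 i4,
        ← intervalIntegral.integral_sub (i3.add i4) (i1.add i2)]
      exact intervalIntegral.integral_congr fun u _ => by ring
    simp only [neg_mul, intervalIntegral.integral_neg]
    rw [e5, ← e4]
    ring
  rw [e3, intervalIntegral.integral_sub (hL.intervalIntegrable_integral_u hu hxy)
    ((hXa.intervalIntegrable_v hxy ⟨hu, le_rfl⟩).sub (hXa.intervalIntegrable_v hxy ⟨le_rfl, hu⟩)),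
    ← e1, ← e2]
  ring

theorem continuousWithinAt_nuInvDU_u (h : IsBVSolution φ r m) {u v : ℝ} (hu : 1 ≤ u) (huv : u < v) :
    ContinuousWithinAt (fun u' => nuInvDU φ r u' v) (Ici u) u :=
  ((h.rightCts_nu u v hu huv).inv₀ (h.nu_ne hu huv)).mul (h.rightCts_dU u v hu huv)

/-- Off the axis ν ≤ -c < 0, where inversion is Lipschitz with constant c⁻²; products of functions
of bounded variation are again of bounded variation. -/
theorem boundedVariationOn_nuInvDU (h : IsBVSolution φ r m) {u₁ u₂ v : ℝ} (h1 : 1 ≤ u₁)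
    (hu : u₁ ≤ u₂) (huv : u₂ < v) :
    BoundedVariationOn (fun u => nuInvDU φ r u v) (Icc u₁ u₂) := by
  have hsub : Icc u₁ u₂ ⊆ Ico u₁ v := fun u hu' => ⟨hu'.1, hu'.2.trans_lt huv⟩
  have hv : v ∈ Icc u₁ v := ⟨hu.trans huv.le, le_rfl⟩
  obtain ⟨C, hC⟩ := h.bv_nu u₁ v h1 (hu.trans huv.le)
  obtain ⟨D, hD⟩ := h.bv_dU u₁ v h1 (hu.trans huv.le)
  obtain ⟨c, hc, hlam⟩ := h.exists_lam_ge h1 (hu.trans huv.le)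
  have hnu : BoundedVariationOn (fun u => nu r u v) (Icc u₁ u₂) :=
    ne_top_of_le_ne_top ENNReal.ofReal_ne_top ((eVariationOn.mono _ hsub).trans (hC v hv))
  have hdU : BoundedVariationOn (fun u => dU (rphi r φ) u v) (Icc u₁ u₂) :=
    ne_top_of_le_ne_top ENNReal.ofReal_ne_top ((eVariationOn.mono _ hsub).trans (hD v hv))
  have hmap : MapsTo (fun u => nu r u v) (Icc u₁ u₂) (Iic (-c)) := by
    intro u hu'
    have := h.le_neg_nu (h1.trans hu'.1) (hu'.2.trans_lt huv) (c := c) fun x hx hxv =>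
      hlam u x hu'.1 hx hxv.le
    show nu r u v ≤ -c
    linarith
  have hlip : LipschitzOnWith (Real.toNNReal ((c ^ 2)⁻¹)) (fun y : ℝ => y⁻¹) (Iic (-c)) := by
    refine LipschitzOnWith.of_dist_le_mul fun x hx y hy => ?_
    have hx' : x ≤ -c := hx
    have hy' : y ≤ -c := hy
    have hx0 : x ≠ 0 := by linarith
    have hy0 : y ≠ 0 := by linarith
    rw [Real.coe_toNNReal _ (by positivity), Real.dist_eq, Real.dist_eq, inv_sub_inv hx0 hy0,
      abs_div,
      abs_sub_comm, div_eq_inv_mul]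
    refine mul_le_mul_of_nonneg_right (inv_anti₀ (by positivity) ?_) (abs_nonneg _)
    refine le_trans ?_ (le_abs_self _)
    nlinarith
  exact (hlip.comp_boundedVariationOn hmap hnu).mul hdU

/-- The mass of the second null form on the part of an incoming curve starting at `C_1`. -/
theorem enorm_nullForm_le (h : IsBVSolution φ r m) {u v : ℝ} (hu : 1 ≤ u) (huv : u < v) :
    ‖-dV φ u v * nuInvDU φ r u v - -dV φ 1 v * nuInvDU φ r 1 v -
      (∫ x in (1 : ℝ)..u, -mixed φ r x v * nuInvDU φ r x v) +
      ∫ x in (1 : ℝ)..u, dU φ x v * dV (nuInvDU φ r) x v‖ₑ ≤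
    formVariation (fun u => -dV φ u v) (fun u => nuInvDU φ r u v)
      (fun u => dU φ u v * dV (nuInvDU φ r) u v) (Ioo 1 v) := by
  rcases hu.eq_or_lt with rfl | hu1
  · simp
  have i1 := ((h.rectBdd_mixed le_rfl hu huv le_rfl).neg.mul
    (h.rectBdd_nuInvDU le_rfl hu huv le_rfl)).intervalIntegrable_u hu ⟨le_rfl, le_rfl⟩
  have i2 := ((h.rectBdd_dU le_rfl hu huv le_rfl).mul
    (h.rectBdd_dV_nuInvDU le_rfl hu huv le_rfl)).intervalIntegrable_u hu ⟨le_rfl, le_rfl⟩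
  -- `formVariation` on (1, v) only sees closed subintervals, so the bound is proved from x > 1 and
  -- then x tends to 1, using right-continuity at C_1.
  have key : ∀ᶠ x in 𝓝[>] (1 : ℝ),
      ‖-dV φ u v * nuInvDU φ r u v - -dV φ x v * nuInvDU φ r x v -
      (∫ x in x..u, -mixed φ r x v * nuInvDU φ r x v) +
      ∫ x in x..u, dU φ x v * dV (nuInvDU φ r) x v‖ₑ ≤
      formVariation (fun u => -dV φ u v) (fun u => nuInvDU φ r u v)
        (fun u => dU φ u v * dV (nuInvDU φ r) u v) (Ioo 1 v) := by
    filter_upwards [Ioo_mem_nhdsGT hu1] with x hx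
    have hsub : uIcc x u ⊆ uIcc 1 u := by
      rw [uIcc_of_le hx.2.le, uIcc_of_le hu]; exact Icc_subset_Icc_left hx.1.le
    have := sum_enorm_le_formVariation (f := fun u => -dV φ u v) (f' := fun u => -mixed φ r u v)
      (g := fun u => nuInvDU φ r u v) (h := fun u => dU φ u v * dV (nuInvDU φ r) u v) (a := x)
      (b := u) (I := Ioo 1 v) (fun y hy => ⟨hx.1.trans_le hy.1, hy.2.trans_lt huv⟩)
      (h.boundedVariationOn_nuInvDU hx.1.le hx.2.le huv)
      (fun y hy => h.continuousWithinAt_nuInvDU_u (hx.1.le.trans hy.1) (hy.2.trans huv))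
      (h.dV_phi_u hx.1.le hx.2.le huv).neg (i1.mono_set hsub) (i2.mono_set hsub)
      -- A partition with the single interval [x, u], continued as a constant to be monotone.
      (t := fun n => if n = 0 then x else u) (n := 1)
      (monotone_nat_of_le_succ fun n => by rcases n with _ | n <;> simp [hx.2.le])
      (by simp) (by simp)
    simpa using this
  have hint : ∀ {g : ℝ → ℝ}, IntervalIntegrable g volume 1 u →
      Tendsto (fun x => ∫ t in x..u, g t) (𝓝[>] 1) (𝓝 (∫ t in (1 : ℝ)..u, g t)) := by
    intro g hg
    have hc := (HasAEDerivOn.of_integral hu hg 0).continuousOn 1 ⟨le_rfl, hu⟩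
    have hc' := (hc.mono_of_mem_nhdsWithin (Icc_mem_nhdsGT hu1)).tendsto
    have h2 := (tendsto_const_nhds (x := ∫ t in (1 : ℝ)..u, g t)).sub hc'
    simp only [intervalIntegral.integral_same, zero_add, sub_zero] at h2
    refine h2.congr' ?_
    filter_upwards [Ioo_mem_nhdsGT hu1] with x hx
    exact integral_sub_of hg hx.1.le hx.2.le
  have hdV : Tendsto (fun x => dV φ x v) (𝓝[>] 1) (𝓝 (dV φ 1 v)) :=
    (((h.dV_phi_u le_rfl hu huv).continuousOn 1 ⟨le_rfl, hu⟩).mono_of_mem_nhdsWithin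
      (Icc_mem_nhdsGT hu1)).tendsto
  have hX : Tendsto (fun x => nuInvDU φ r x v) (𝓝[>] 1) (𝓝 (nuInvDU φ r 1 v)) :=
    (h.continuousWithinAt_nuInvDU_u le_rfl (hu1.trans huv)).tendsto.mono_left
      (nhdsWithin_mono _ Ioi_subset_Ici_self)
  exact le_of_tendsto ((((tendsto_const_nhds.sub (hdV.neg.mul hX)).sub (hint i1)).add
    (hint i2)).enorm) key

/-- Since the null form is integrated over v > u last, comparison with C_1 itself already produces a
tail. -/
theorem eVariationOn_massFn_le (h : IsBVSolution φ r m) {u : ℝ} (hu : 1 ≤ u) :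
    eVariationOn (massFn φ r m u) (Ioi u) ≤ eVariationOn (massFn φ r m 1) (Ioi u) +
      ∫⁻ v in Ioi u, formVariation (fun u => -dV φ u v) (fun u => nuInvDU φ r u v)
        (fun u => dU φ u v * dV (nuInvDU φ r) u v) (Ioo 1 v) := by
  set F : ℝ → ℝ≥0∞ := fun v => formVariation (fun u => -dV φ u v) (fun u => nuInvDU φ r u v)
        (fun u => dU φ u v * dV (nuInvDU φ r) u v) (Ioo 1 v) with hF
  refine iSup_le fun p => ?_
  obtain ⟨n, t, ht, hts⟩ := p
  have htle : ∀ i, t i ≤ t (i + 1) := fun i => ht i.le_succ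
  have hterm : ∀ i, edist (massFn φ r m u (t (i + 1))) (massFn φ r m u (t i)) ≤
      edist (massFn φ r m 1 (t (i + 1))) (massFn φ r m 1 (t i)) +
      ∫⁻ v in Ioc (t i) (t (i + 1)), F v := by
    intro i
    rw [edist_eq_enorm_sub, edist_eq_enorm_sub]
    have e0 := h.massFn_sub_sub le_rfl hu (hts i) (htle i)
    rw [sub_eq_iff_eq_add'.1 e0]
    refine (enorm_add_le _ _).trans (add_le_add le_rfl ?_)
    rw [intervalIntegral.integral_of_le (htle i)]
    refine (enorm_integral_le_lintegral_enorm _).trans ?_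
    exact setLIntegral_mono' measurableSet_Ioc fun v hv =>
      h.enorm_nullForm_le hu ((mem_Ioi.1 (hts i)).trans hv.1)
  calc ∑ i ∈ Finset.range n, edist (massFn φ r m u (t (i + 1))) (massFn φ r m u (t i))
      ≤ ∑ i ∈ Finset.range n, edist (massFn φ r m 1 (t (i + 1))) (massFn φ r m 1 (t i)) +
        ∑ i ∈ Finset.range n, ∫⁻ v in Ioc (t i) (t (i + 1)), F v := by
        rw [← Finset.sum_add_distrib]
        exact Finset.sum_le_sum fun i _ => hterm i
    _ ≤ _ := by
        refine add_le_add (eVariationOn.sum_le ht hts) ?_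
        have hdis : Pairwise (Function.onFun Disjoint fun i => Ioc (t i) (t (i + 1))) :=
          ht.pairwise_disjoint_on_Ioc_succ
        rw [← lintegral_biUnion_finset (fun i _ j _ hij => hdis hij) fun i _ => measurableSet_Ioc]
        exact lintegral_mono_set (iUnion₂_subset fun i _ v hv => (mem_Ioi.1 (hts i)).trans hv.1)

end IsBVSolution

end SSESF

namespace SSESF

/-! ### Tails -/

/-- Continuity from above of the measure with density F. Measurability of F is not needed, which
matters because F will be a `formVariation`. -/
theorem tendsto_setLIntegral_Ioi_zero {F : ℝ → ℝ≥0∞} {a : ℝ} (hF : ∫⁻ v in Ioi a, F v ≠ ⊤) :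
    Tendsto (fun u => ∫⁻ v in Ioi u, F v) atTop (𝓝 0) := by
  have h1 := tendsto_measure_iInter_atTop (μ := volume.withDensity F) (s := fun u : ℝ => Ioi u)
    (fun u => measurableSet_Ioi.nullMeasurableSet) (fun x y hxy => Ioi_subset_Ioi hxy)
    ⟨a, by rwa [withDensity_apply _ measurableSet_Ioi]⟩
  have h2 : ⋂ u : ℝ, Ioi u = ∅ := by
    ext x
    simpa using ⟨x, le_rfl⟩
  rw [h2, measure_empty] at h1
  exact h1.congr fun u => withDensity_apply _ measurableSet_Ioi

theorem tendsto_eVariationOn_Ioi_zero {f : ℝ → ℝ} {a : ℝ} (hf : BoundedVariationOn f (Ioi a)) :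
    Tendsto (fun u => eVariationOn f (Ioi u)) atTop (𝓝 0) := by
  have h1 := hf.tendsto_eVariationOn_Ici_zero_of_filter atTop fun y hy =>
    inter_mem (Ioi_mem_atTop a) (Ici_mem_atTop y)
  refine tendsto_of_tendsto_of_tendsto_of_le_of_le' tendsto_const_nhds h1
    (Eventually.of_forall fun _ => zero_le) ?_
  filter_upwards [Ioi_mem_atTop a] with u hu
  exact eVariationOn.mono _ fun x hx => ⟨(mem_Ioi.1 hu).trans hx, (mem_Ioi.1 hx).le⟩

theorem eVariationOn_Ioi_le {f : ℝ → ℝ} {u : ℝ} {B : ℝ≥0∞}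
    (h : ∀ V, u < V → eVariationOn f (Ioc u V) ≤ B) : eVariationOn f (Ioi u) ≤ B := by
  refine iSup_le fun p => ?_
  obtain ⟨n, t, ht, hts⟩ := p
  refine le_trans ?_ (h (t n) (hts n))
  exact eVariationOn.sum_le_of_monotoneOn_Iic (ht.monotoneOn _) fun i hi => ⟨hts i, ht hi⟩

theorem integral_le_of_forall_Ioo {g : ℝ → ℝ} {u V B : ℝ} (huV : u < V)
    (hg : IntervalIntegrable g volume u V) (h : ∀ x ∈ Ioo u V, ∫ t in x..V, g t ≤ B) :
    ∫ t in u..V, g t ≤ B := by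
  have hc := (HasAEDerivOn.of_integral huV.le hg 0).continuousOn u ⟨le_rfl, huV.le⟩
  have hc' := (hc.mono_of_mem_nhdsWithin (Icc_mem_nhdsGT huV)).tendsto
  have h2 := (tendsto_const_nhds (x := ∫ t in u..V, g t)).sub hc'
  simp only [intervalIntegral.integral_same, zero_add, sub_zero] at h2
  refine le_of_tendsto h2 ?_
  filter_upwards [Ioo_mem_nhdsGT huV] with x hx
  rw [IsBVSolution.integral_sub_of hg hx.1.le hx.2.le]
  exact h x hx

/-! ### The variation as a monotone function of the endpoint -/

section VariationFunction

variable {f : ℝ → ℝ} {u B : ℝ}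

theorem eVariationOn_Ioc_toReal_mono (hf : BoundedVariationOn f (Ioi u)) :
    Monotone fun v => (eVariationOn f (Ioc u v)).toReal := fun _ y hxy =>
  ENNReal.toReal_mono (hf.mono (Ioc_subset_Ioi_self : Ioc u y ⊆ Ioi u))
    (eVariationOn.mono _ (Ioc_subset_Ioc_right hxy))

theorem abs_sub_le_eVariationOn_Ioc_sub (hf : BoundedVariationOn f (Ioi u)) {x y : ℝ} (hx : u < x)
    (hxy : x ≤ y) : |f y - f x| ≤
      (eVariationOn f (Ioc u y)).toReal - (eVariationOn f (Ioc u x)).toReal := by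
  have hy : eVariationOn f (Ioc u y) ≠ ⊤ := hf.mono (Ioc_subset_Ioi_self : Ioc u y ⊆ Ioi u)
  have h1 : eVariationOn f (Ioc u x) + eVariationOn f (Icc x y) ≤ eVariationOn f (Ioc u y) := by
    refine (eVariationOn.add_le_union f fun a ha b hb => ha.2.trans hb.1).trans
      (eVariationOn.mono _ (union_subset (Ioc_subset_Ioc_right hxy) fun z hz =>
        ⟨hx.trans_le hz.1, hz.2⟩))
  have h2 : ‖f y - f x‖ₑ ≤ eVariationOn f (Icc x y) := by
    rw [← edist_eq_enorm_sub]
    exact eVariationOn.edist_le f ⟨hxy, le_rfl⟩ ⟨le_rfl, hxy⟩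
  have h3 := ENNReal.toReal_mono hy ((add_le_add le_rfl h2).trans h1)
  rw [ENNReal.toReal_add (hf.mono (Ioc_subset_Ioi_self : Ioc u x ⊆ Ioi u)) enorm_ne_top,
    toReal_enorm, Real.norm_eq_abs] at h3
  linarith

theorem eVariationOn_Ioc_toReal_le (hB : 0 ≤ B) (hf : eVariationOn f (Ioi u) ≤ ENNReal.ofReal B)
    (v : ℝ) : (eVariationOn f (Ioc u v)).toReal ≤ B :=
  ENNReal.toReal_le_of_le_ofReal hB ((eVariationOn.mono _ Ioc_subset_Ioi_self).trans hf)

end VariationFunction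

namespace IsBVSolution

variable {φ r m : ℝ → ℝ → ℝ}

/-! ### Estimates on an outgoing curve, from the axis -/

theorem r_eq_integral (h : IsBVSolution φ r m) {u v : ℝ} (hu : 1 ≤ u) (huv : u ≤ v) :
    r u v = ∫ x in u..v, lam r u x := by
  rw [← (h.r_v hu huv).sub_eq, h.r_axis u hu, sub_zero]

/-- `r |∂_v φ|` is bounded by the difference of the variation of `waveFn` and its average. -/
theorem r_sq_mul_abs_dV_le (h : IsBVSolution φ r m) {u v : ℝ} (hu : 1 ≤ u) (huv : u < v)
    (hf : BoundedVariationOn (waveFn φ r u) (Ioi u)) :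
    r u v * (r u v * |dV φ u v|) ≤ r u v * (eVariationOn (waveFn φ r u) (Ioc u v)).toReal -
      ∫ x in u..v, lam r u x * (eVariationOn (waveFn φ r u) (Ioc u x)).toReal := by
  have hd : HasAEDerivOn (fun v => r u v * (0 + ∫ x in u..v, lam r u x * dV φ u x))
      (fun v => lam r u v * waveFn φ r u v) u v :=
    ((h.r_v hu huv.le).mul (HasAEDerivOn.of_integral huv.le
      (h.intervalIntegrable_lam_dV hu huv.le) 0)).congr_deriv fun x _ => by rw [waveFn]; ring
  have hT := h.intervalIntegrable_lam_mul hu huv.le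
    ((eVariationOn_Ioc_toReal_mono hf).intervalIntegrable (μ := volume) (a := u) (b := v))
  have hl := (h.r_v hu huv.le).intervalIntegrable
  have h1 := hd.sub_eq
  have h2 : r u v * (r u v * dV φ u v) =
      ∫ x in u..v, (lam r u x * waveFn φ r u v - lam r u x * waveFn φ r u x) := by
    rw [intervalIntegral.integral_sub (hl.mul_const _) hd.intervalIntegrable,
      intervalIntegral.integral_mul_const, ← h.r_eq_integral hu huv.le, ← h1, h.r_axis u hu, waveFn]
    ring
  have h3 : r u v * (r u v * |dV φ u v|) = |r u v * (r u v * dV φ u v)| := by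
    rw [abs_mul, abs_mul, abs_of_pos (h.r_pos u v hu huv)]
  rw [h3, h2]
  have h4 : r u v * (eVariationOn (waveFn φ r u) (Ioc u v)).toReal -
      (∫ x in u..v, lam r u x * (eVariationOn (waveFn φ r u) (Ioc u x)).toReal) =
      ∫ x in u..v, (lam r u x * (eVariationOn (waveFn φ r u) (Ioc u v)).toReal -
        lam r u x * (eVariationOn (waveFn φ r u) (Ioc u x)).toReal) := by
    rw [intervalIntegral.integral_sub (hl.mul_const _) hT, intervalIntegral.integral_mul_const,
      ← h.r_eq_integral hu huv.le]
  rw [h4]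
  refine (intervalIntegral.abs_integral_le_integral_abs huv.le).trans ?_
  refine intervalIntegral.integral_mono_on_of_le_Ioo huv.le
    ((hl.mul_const _).sub hd.intervalIntegrable).abs ((hl.mul_const _).sub hT) fun x hx => ?_
  rw [← mul_sub, ← mul_sub, abs_mul, abs_of_pos (h.lam_pos hu hx.1)]
  exact mul_le_mul_of_nonneg_left (abs_sub_le_eVariationOn_Ioc_sub hf hx.1 hx.2.le)
    (h.lam_pos hu hx.1).le

theorem r_mul_abs_dV_le (h : IsBVSolution φ r m) {u v f : ℝ} (hu : 1 ≤ u) (huv : u < v)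
    (hf0 : 0 ≤ f)
    (hf : eVariationOn (waveFn φ r u) (Ioi u) ≤ ENNReal.ofReal f) : r u v * |dV φ u v| ≤ f := by
  have hbv : BoundedVariationOn (waveFn φ r u) (Ioi u) :=
    ne_top_of_le_ne_top ENNReal.ofReal_ne_top hf
  have h1 := h.r_sq_mul_abs_dV_le hu huv hbv
  have h2 : 0 ≤ ∫ x in u..v, lam r u x * (eVariationOn (waveFn φ r u) (Ioc u x)).toReal := by
    rw [intervalIntegral.integral_of_le huv.le]
    exact setIntegral_nonneg measurableSet_Ioc fun x hx =>
      mul_nonneg (h.lam_pos hu hx.1).le ENNReal.toReal_nonneg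
  have h3 := eVariationOn_Ioc_toReal_le hf0 hf v
  have h4 := h.r_pos u v hu huv
  exact le_trans (le_of_mul_le_mul_left (by linarith) h4) h3

/-- Let T be the variation of `waveFn` up to v and S = r⁻¹∫λT its average. Then ∂_vS = λ(T - S)/r,
while r|∂_vφ| ≤ T - S. So λ|∂_vφ| is dominated by the derivative of S, and S ≤ f. -/
theorem integral_lam_mul_abs_dV_le (h : IsBVSolution φ r m) {u V f : ℝ} (hu : 1 ≤ u) (huV : u < V)
    (hf0 : 0 ≤ f) (hf : eVariationOn (waveFn φ r u) (Ioi u) ≤ ENNReal.ofReal f) :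
    ∫ v in u..V, lam r u v * |dV φ u v| ≤ f := by
  have hbv : BoundedVariationOn (waveFn φ r u) (Ioi u) :=
    ne_top_of_le_ne_top ENNReal.ofReal_ne_top hf
  set T : ℝ → ℝ := fun v => (eVariationOn (waveFn φ r u) (Ioc u v)).toReal with hTdef
  have hi := h.intervalIntegrable_lam_mul hu huV.le (h.intervalIntegrable_abs_dV hu le_rfl huV.le)
  have hT := h.intervalIntegrable_lam_mul hu huV.le
    ((eVariationOn_Ioc_toReal_mono hbv).intervalIntegrable (μ := volume) (a := u) (b := V))
  have hJ := HasAEDerivOn.of_integral huV.le hT 0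
  -- The average has r in the denominator, so the estimate starts at x > u and x then tends to the
  -- axis.
  refine integral_le_of_forall_Ioo huV hi fun x hx => ?_
  have hS := (hJ.mono hx.1.le hx.2.le le_rfl).div ((h.r_v hu huV.le).mono hx.1.le hx.2.le le_rfl)
    fun y hy => (h.r_pos u y hu (hx.1.trans_le hy.1)).ne'
  have hx' : IntervalIntegrable (fun v => lam r u v * |dV φ u v|) volume x V :=
    hi.mono_set (by rw [uIcc_of_le hx.2.le, uIcc_of_le huV.le]; exact Icc_subset_Icc_left hx.1.le)
  have h1 := (HasAEDerivOn.of_integral hx.2.le hx' 0).sub_le_sub hS fun y hy => by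
    have huy := hx.1.trans hy.1
    have hr := h.r_pos u y hu huy
    have h2 := h.r_sq_mul_abs_dV_le hu huy hbv
    have h3 := h.lam_pos hu huy
    rw [le_div_iff₀ hr]
    have h4 : r u y * |dV φ u y| ≤ T y - (0 + ∫ t in u..y, lam r u t * T t) / r u y := by
      rw [le_sub_iff_add_le, ← le_sub_iff_add_le', div_le_iff₀ hr]
      simp only [hTdef]
      linarith
    calc lam r u y * |dV φ u y| * r u y = lam r u y * (r u y * |dV φ u y|) := by ring
      _ ≤ lam r u y * (T y - (0 + ∫ t in u..y, lam r u t * T t) / r u y) :=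
        mul_le_mul_of_nonneg_left h4 h3.le
      _ = _ := by ring
  simp only [intervalIntegral.integral_same, zero_add, sub_zero, add_zero] at h1
  have h5 : 0 ≤ (∫ t in u..x, lam r u t * T t) / r u x := by
    refine div_nonneg ?_ (h.r_pos u x hu hx.1).le
    rw [intervalIntegral.integral_of_le hx.1.le]
    exact setIntegral_nonneg measurableSet_Ioc fun y hy =>
      mul_nonneg (h.lam_pos hu hy.1).le ENNReal.toReal_nonneg
  have h6 : (∫ t in u..V, lam r u t * T t) / r u V ≤ f := by
    have hr := h.r_pos u V hu huV
    rw [div_le_iff₀ hr]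
    have h7 := h.r_sq_mul_abs_dV_le hu huV hbv
    have h8 := eVariationOn_Ioc_toReal_le hf0 hf V
    have h9 : 0 ≤ r u V * (r u V * |dV φ u V|) := by positivity
    have h10 := mul_le_mul_of_nonneg_left h8 hr.le
    simp only [hTdef]
    linarith
  linarith

end IsBVSolution

end SSESF

/-! ### The mass ratio and log λ on an outgoing curve -/

namespace SSESF

namespace IsBVSolution

variable {φ r m : ℝ → ℝ → ℝ}

/-- Integrate the mass equation from the axis, with 1-μ ≤ 1 and one factor r estimated by its value
at the endpoint, which cancels the denominator of μ. In particular μ → 0 at the axis. -/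
theorem massRatio_axis_bound (h : IsBVSolution φ r m) {u v : ℝ} (hu : 1 ≤ u) (huv : u < v)
    (hi : IntervalIntegrable (fun v => r u v * dV φ u v ^ 2 / lam r u v) volume u v) :
    massRatio r m u v ≤ ∫ x in u..v, r u x * dV φ u x ^ 2 / lam r u x := by
  have hr := h.r_pos u v hu huv
  have h1 := (h.m_v hu huv.le).sub_eq
  rw [h.m_axis u hu, sub_zero] at h1
  rw [massRatio, div_le_iff₀ hr, h1, mul_comm (∫ x in u..v, _) (r u v),
    ← intervalIntegral.integral_const_mul, ← intervalIntegral.integral_const_mul]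
  refine intervalIntegral.integral_mono_on_of_le_Ioo huv.le
    ((h.m_v hu huv.le).intervalIntegrable.const_mul 2) (hi.const_mul (r u v)) fun x hx => ?_
  have hl := h.lam_pos hu hx.1
  have hrx := h.r_pos u x hu hx.1
  have h2 := h.one_sub_pos hu hx.1
  have h3 := h.massRatio_nonneg hu hx.1
  have h4 := h.r_mono_v hu hx.1.le hx.2.le
  have h5 : (1 - massRatio r m u x) * r u x ≤ r u v := by nlinarith
  have h6 : 0 ≤ r u x * dV φ u x ^ 2 / lam r u x := by positivity
  calc 2 * ((1 - massRatio r m u x) * r u x ^ 2 * dV φ u x ^ 2 / (2 * lam r u x))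
      = ((1 - massRatio r m u x) * r u x) * (r u x * dV φ u x ^ 2 / lam r u x) := by
        field_simp
    _ ≤ r u v * (r u x * dV φ u x ^ 2 / lam r u x) := mul_le_mul_of_nonneg_right h5 h6

theorem intervalIntegrable_density (h : IsBVSolution φ r m) {u V f : ℝ} (hu : 1 ≤ u) (huV : u ≤ V)
    (hf0 : 0 ≤ f) (hf : eVariationOn (waveFn φ r u) (Ioi u) ≤ ENNReal.ofReal f) :
    IntervalIntegrable (fun v => r u v * dV φ u v ^ 2 / lam r u v) volume u V := by
  obtain ⟨c, hc, hlam⟩ := h.exists_lam_ge hu huV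
  have ha := (h.phi_v hu huV).intervalIntegrable
  have h1 := intervalIntegrable_bdd_mul (g := fun v => r u v * dV φ u v / lam r u v) (C := f / c) huV
    ha ?_ fun x hx => ?_
  · refine h1.congr fun x _ => ?_
    ring
  · exact ((((h.r_v hu huV).continuousOn.mono Ioc_subset_Icc_self).aestronglyMeasurable
      measurableSet_Ioc).mul ha.1.aestronglyMeasurable).div₀
      (h.r_v hu huV).intervalIntegrable.1.aestronglyMeasurable
  · have hl := h.lam_pos hu hx.1
    rw [abs_div, abs_mul, abs_of_pos (h.r_pos u x hu hx.1), abs_of_pos hl]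
    exact div_le_div₀ hf0 (h.r_mul_abs_dV_le hu hx.1 hf0 hf) hc (hlam u x le_rfl hx.1 hx.2)

/-- The v-derivative of the sum is the potential divided by ν, which is nonnegative, and the sum
tends to zero at the axis. This is a lower bound for 1-μ. -/
theorem log_one_sub_add_nonneg (h : IsBVSolution φ r m) {u v : ℝ} (hu : 1 ≤ u) (huv : u < v)
    (hi : IntervalIntegrable (fun v => r u v * dV φ u v ^ 2 / lam r u v) volume u v) :
    0 ≤ Real.log (1 - massRatio r m u v) + ∫ x in u..v, r u x * dV φ u x ^ 2 / lam r u x := by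
  have hW := HasAEDerivOn.of_integral huv.le hi 0
  have hsub : ∀ x ∈ Ioo u v,
      IntervalIntegrable (fun v => r u v * dV φ u v ^ 2 / lam r u v) volume u x := fun x hx =>
    hi.mono_set (by rw [uIcc_of_le hx.1.le, uIcc_of_le huv.le]; exact Icc_subset_Icc_right hx.2.le)
  have hW0 : Tendsto (fun x => ∫ y in u..x, r u y * dV φ u y ^ 2 / lam r u y) (𝓝[>] u) (𝓝 0) := by
    have := ((hW.continuousOn u ⟨le_rfl, huv.le⟩).mono_of_mem_nhdsWithin
      (Icc_mem_nhdsGT huv)).tendsto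
    simpa using this
  have hmu : Tendsto (fun x => massRatio r m u x) (𝓝[>] u) (𝓝 0) := by
    refine tendsto_of_tendsto_of_tendsto_of_le_of_le' tendsto_const_nhds hW0 ?_ ?_
    · filter_upwards [self_mem_nhdsWithin] with x hx using h.massRatio_nonneg hu hx
    · filter_upwards [Ioo_mem_nhdsGT huv] with x hx
      exact h.massRatio_axis_bound hu hx.1 (hsub x hx)
  have hlog : Tendsto (fun x => Real.log (1 - massRatio r m u x) +
      ∫ y in u..x, r u y * dV φ u y ^ 2 / lam r u y) (𝓝[>] u) (𝓝 0) := by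
    have h1 : Tendsto (fun x => 1 - massRatio r m u x) (𝓝[>] u) (𝓝 1) := by
      simpa using tendsto_const_nhds.sub hmu
    simpa using (h1.log one_ne_zero).add hW0
  refine le_of_tendsto hlog ?_
  filter_upwards [Ioo_mem_nhdsGT huv] with x hx
  have h2 := ((h.log_one_sub_v hu hx.1 hx.2.le).add (hW.mono hx.1.le hx.2.le le_rfl)).le_of_nonneg
    fun y hy => by
      have huy := hx.1.trans hy.1
      have := div_nonneg_of_nonpos (h.potential_nonpos hu huy) (h.nu_neg hu huy).le
      linarith
  simpa using h2

/-! ### Estimates under a lower bound for λ -/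

section LowerBound

variable {u V f ℓ : ℝ}

theorem integral_abs_dV_le (h : IsBVSolution φ r m) (hu : 1 ≤ u) (huV : u < V)
    (hf0 : 0 ≤ f) (hf : eVariationOn (waveFn φ r u) (Ioi u) ≤ ENNReal.ofReal f) (hℓ : 0 < ℓ)
    (hlam : ∀ x ∈ Ioo u V, ℓ ≤ lam r u x) : ∫ v in u..V, |dV φ u v| ≤ f / ℓ := by
  rw [le_div_iff₀ hℓ, mul_comm, ← intervalIntegral.integral_const_mul]
  refine le_trans ?_ (h.integral_lam_mul_abs_dV_le hu huV hf0 hf)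
  have hi := h.intervalIntegrable_abs_dV hu le_rfl huV.le
  exact intervalIntegral.integral_mono_on_of_le_Ioo huV.le (hi.const_mul ℓ)
    (h.intervalIntegrable_lam_mul hu huV.le hi) fun x hx =>
      mul_le_mul_of_nonneg_right (hlam x hx) (abs_nonneg _)

/-- One factor ∂_vφ is absorbed by r|∂_vφ|/λ ≤ f/ℓ; the other is integrated. -/
theorem integral_density_le (h : IsBVSolution φ r m) (hu : 1 ≤ u) (huV : u < V)
    (hf0 : 0 ≤ f) (hf : eVariationOn (waveFn φ r u) (Ioi u) ≤ ENNReal.ofReal f) (hℓ : 0 < ℓ)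
    (hlam : ∀ x ∈ Ioo u V, ℓ ≤ lam r u x) :
    ∫ v in u..V, r u v * dV φ u v ^ 2 / lam r u v ≤ (f / ℓ) ^ 2 := by
  have hi := h.intervalIntegrable_abs_dV hu le_rfl huV.le
  calc ∫ v in u..V, r u v * dV φ u v ^ 2 / lam r u v ≤ ∫ v in u..V, f / ℓ * |dV φ u v| := by
        refine intervalIntegral.integral_mono_on_of_le_Ioo huV.le
          (h.intervalIntegrable_density hu huV.le hf0 hf) (hi.const_mul _) fun x hx => ?_
        have h1 := h.r_mul_abs_dV_le hu hx.1 hf0 hf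
        have h2 := div_le_div₀ hf0 h1 hℓ (hlam x hx)
        calc r u x * dV φ u x ^ 2 / lam r u x = r u x * |dV φ u x| / lam r u x * |dV φ u x| := by
              rw [← sq_abs]; ring
          _ ≤ _ := mul_le_mul_of_nonneg_right h2 (abs_nonneg _)
    _ ≤ (f / ℓ) ^ 2 := by
        rw [intervalIntegral.integral_const_mul, sq]
        exact mul_le_mul_of_nonneg_left (h.integral_abs_dV_le hu huV hf0 hf hℓ hlam) (by positivity)

/-- `log λ` and `massFn` differ by a function of small variation. -/
theorem exists_log_lam_sub_massFn_le (h : IsBVSolution φ r m) (hu : 1 ≤ u) (huV : u < V)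
    (hf0 : 0 ≤ f) (hf : eVariationOn (waveFn φ r u) (Ioi u) ≤ ENNReal.ofReal f) (hℓ : 0 < ℓ)
    (hlam : ∀ x ∈ Ioo u V, ℓ ≤ lam r u x) : ∃ G : ℝ → ℝ, ∀ x ∈ Ioc u V, ∀ y ∈ Ioc u V, x ≤ y →
      |(Real.log (lam r u y) - massFn φ r m u y) - (Real.log (lam r u x) - massFn φ r m u x)| ≤
        G y - G x ∧ G y - G x ≤ 3 * (f / ℓ) ^ 2 := by
  have hiW := h.intervalIntegrable_density hu huV.le hf0 hf
  have hiX := h.intervalIntegrable_nuInvDU_dV hu huV.le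
  have hW := HasAEDerivOn.of_integral huV.le hiW 0
  have hX := HasAEDerivOn.of_integral huV.le hiX 0
  have hA := HasAEDerivOn.of_integral huV.le hiX.abs 0
  set W : ℝ → ℝ := fun v => 0 + ∫ x in u..v, r u x * dV φ u x ^ 2 / lam r u x with hWdef
  set A : ℝ → ℝ := fun v => 0 + ∫ x in u..v, |(nuInvDU φ r u x - φ u x) * dV φ u x| with hAdef
  have hWnn : ∀ v ∈ Ioo u V, 0 ≤ r u v * dV φ u v ^ 2 / lam r u v := fun v hv => by
    have := h.lam_pos hu hv.1
    have := h.r_pos u v hu hv.1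
    positivity
  have hWle : ∀ y ∈ Ioc u V, W y ≤ (f / ℓ) ^ 2 := by
    intro y hy
    have h1 := (hW.mono hy.1.le hy.2 le_rfl).le_of_nonneg fun z hz => hWnn z ⟨hy.1.trans hz.1, hz.2⟩
    have h2 := h.integral_density_le hu huV hf0 hf hℓ hlam
    simp only [hWdef, zero_add] at h1 ⊢
    linarith
  have hAle : ∀ y ∈ Ioc u V, A y ≤ (f / ℓ) ^ 2 := by
    intro y hy
    have h1 := (hA.mono hy.1.le hy.2 le_rfl).le_of_nonneg fun z hz => abs_nonneg _
    refine h1.trans ?_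
    have hi := h.intervalIntegrable_abs_dV hu le_rfl huV.le
    calc A V = ∫ x in u..V, |(nuInvDU φ r u x - φ u x) * dV φ u x| := zero_add _
      _ ≤ ∫ v in u..V, f / ℓ * |dV φ u v| := by
          refine intervalIntegral.integral_mono_on_of_le_Ioo huV.le hiX.abs (hi.const_mul _)
            fun x hx => ?_
          rw [abs_mul]
          refine mul_le_mul_of_nonneg_right ((h.abs_nuInvDU_sub_le hu hx.1).trans ?_) (abs_nonneg _)
          exact h.integral_abs_dV_le hu hx.1 hf0 hf hℓ fun z hz => hlam z ⟨hz.1, hz.2.trans hx.2⟩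
      _ ≤ (f / ℓ) ^ 2 := by
          rw [intervalIntegral.integral_const_mul, sq]
          exact mul_le_mul_of_nonneg_left (h.integral_abs_dV_le hu huV hf0 hf hℓ hlam) (by positivity)
  -- The derivative of log(1-μ) is P - w with P, w ≥ 0 and w that of W, so |P - w| ≤ (P - w) + 2w.
  -- The total increment is bounded because -W ≤ log(1-μ) ≤ 0; the terms 2W and A account for the
  -- constant 3.
  refine ⟨fun v => Real.log (1 - massRatio r m u v) + 2 * W v + A v, fun x hx y hy hxy => ⟨?_, ?_⟩⟩
  · have h1 := ((h.log_one_sub_v hu hx.1 hxy).add (hX.mono hx.1.le hxy hy.2)).abs_sub_le_sub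
      (((h.log_one_sub_v hu hx.1 hxy).add ((hW.mono hx.1.le hxy hy.2).add
        (hW.mono hx.1.le hxy hy.2))).add (hA.mono hx.1.le hxy hy.2)) fun z hz => by
        have huz := hx.1.trans hz.1
        have h2 := div_nonneg_of_nonpos (h.potential_nonpos hu huz) (h.nu_neg hu huz).le
        have h3 := hWnn z ⟨huz, hz.2.trans_le hy.2⟩
        refine (abs_add_le _ _).trans (add_le_add ?_ le_rfl)
        rw [abs_le]
        constructor <;> linarith
    have h4 : ∀ v, Real.log (lam r u v) - massFn φ r m u v = Real.log (1 - massRatio r m u v) +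
        (0 + ∫ x in u..v, (nuInvDU φ r u x - φ u x) * dV φ u x) := fun v => by
      rw [massFn, logKap]; ring
    rw [h4, h4]
    refine h1.trans (le_of_eq ?_)
    ring
  · have hux := hx.1
    have h1 := h.log_one_sub_add_nonneg hu hux (hiW.mono_set (by
      rw [uIcc_of_le hux.le, uIcc_of_le huV.le]; exact Icc_subset_Icc_right hx.2))
    have h2 : 0 ≤ W x := by
      have :=
        (hW.mono le_rfl hux.le hx.2).le_of_nonneg fun z hz => hWnn z ⟨hz.1, hz.2.trans_le hx.2⟩
      simpa [hWdef] using this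
    have h3 : 0 ≤ A x := by
      have := (hA.mono le_rfl hux.le hx.2).le_of_nonneg fun z hz => abs_nonneg _
      simpa [hAdef] using this
    have h4 : Real.log (1 - massRatio r m u y) ≤ 0 :=
      Real.log_nonpos (h.one_sub_pos hu hy.1).le (by linarith [h.massRatio_nonneg hu hy.1])
    have h5 := hWle y hy
    have h6 := hAle y hy
    simp only [hWdef, zero_add] at h1 h2 h5 ⊢
    linarith

theorem eVariationOn_log_lam_le (h : IsBVSolution φ r m) (hu : 1 ≤ u) (huV : u < V)
    (hf0 : 0 ≤ f) (hf : eVariationOn (waveFn φ r u) (Ioi u) ≤ ENNReal.ofReal f) (hℓ : 0 < ℓ)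
    (hlam : ∀ x ∈ Ioo u V, ℓ ≤ lam r u x) :
    eVariationOn (fun v => Real.log (lam r u v)) (Ioc u V) ≤
      eVariationOn (massFn φ r m u) (Ioc u V) + ENNReal.ofReal (3 * (f / ℓ) ^ 2) := by
  obtain ⟨G, hG⟩ := h.exists_log_lam_sub_massFn_le hu huV hf0 hf hℓ hlam
  refine eVariationOn_le_add (H := G) (fun x hx y hy hxy => ?_)
    (fun x hx y hy hxy => (abs_nonneg _).trans (hG x hx y hy hxy).1)
    fun x hx y hy hxy => (hG x hx y hy hxy).2
  have h1 := (hG x hx y hy hxy).1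
  have h2 := abs_add_le (massFn φ r m u y - massFn φ r m u x)
    ((Real.log (lam r u y) - massFn φ r m u y) - (Real.log (lam r u x) - massFn φ r m u x))
  have h3 : massFn φ r m u y - massFn φ r m u x + ((Real.log (lam r u y) - massFn φ r m u y) -
    (Real.log (lam r u x) - massFn φ r m u x)) = Real.log (lam r u y) - Real.log (lam r u x) := by ring
  rw [h3] at h2
  linarith

/-- The converse comparison, used on C_1 where log λ is constant. -/
theorem eVariationOn_massFn_le_log (h : IsBVSolution φ r m) (hu : 1 ≤ u) (huV : u < V)
    (hf0 : 0 ≤ f) (hf : eVariationOn (waveFn φ r u) (Ioi u) ≤ ENNReal.ofReal f) (hℓ : 0 < ℓ)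
    (hlam : ∀ x ∈ Ioo u V, ℓ ≤ lam r u x) :
    eVariationOn (massFn φ r m u) (Ioc u V) ≤ eVariationOn (fun v => Real.log (lam r u v)) (Ioc u V) +
      ENNReal.ofReal (3 * (f / ℓ) ^ 2) := by
  obtain ⟨G, hG⟩ := h.exists_log_lam_sub_massFn_le hu huV hf0 hf hℓ hlam
  refine eVariationOn_le_add (H := G) (fun x hx y hy hxy => ?_)
    (fun x hx y hy hxy => (abs_nonneg _).trans (hG x hx y hy hxy).1)
    fun x hx y hy hxy => (hG x hx y hy hxy).2
  have h1 := (hG x hx y hy hxy).1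
  have h2 := abs_sub (Real.log (lam r u y) - Real.log (lam r u x))
    ((Real.log (lam r u y) - massFn φ r m u y) - (Real.log (lam r u x) - massFn φ r m u x))
  have h3 : Real.log (lam r u y) - Real.log (lam r u x) - ((Real.log (lam r u y) - massFn φ r m u y) -
    (Real.log (lam r u x) - massFn φ r m u x)) = massFn φ r m u y - massFn φ r m u x := by ring
  rw [h3] at h2
  linarith

end LowerBound

end IsBVSolution

end SSESF

namespace SSESF

namespace IsBVSolution

variable {φ r m : ℝ → ℝ → ℝ}

/-! ### Decay of the variations -/

/-- On C_1 the coordinate normalization gives λ = 1/2, so there `waveFn` is ∂_v(rφ) up to an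
additive constant. -/
theorem eVariationOn_waveFn_one_le (h : IsBVSolution φ r m) :
    eVariationOn (waveFn φ r 1) (Ioi 1) ≤ eVariationOn (dV (rphi r φ) 1) (Ioi 1) := by
  have key : ∀ v ∈ Ioi (1 : ℝ), waveFn φ r 1 v = dV (rphi r φ) 1 v - 1 / 2 * φ 1 1 := by
    intro v hv
    have hv' : (1 : ℝ) < v := hv
    have h1 := h.r_mul_dV le_rfl hv'
    have h2 : ∫ x in (1 : ℝ)..v, lam r 1 x * dV φ 1 x = 1 / 2 * (φ 1 v - φ 1 1) := by
      rw [(h.phi_v le_rfl hv'.le).sub_eq, ← intervalIntegral.integral_const_mul]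
      refine intervalIntegral.integral_congr fun x hx => ?_
      rw [uIcc_of_le hv'.le] at hx
      simp only [h.lam_init hx.1]
    rw [h.lam_init hv'.le] at h1
    rw [waveFn, h1, h2]
    ring
  have := eVariationOn_le_add (f := waveFn φ r 1) (f₁ := dV (rphi r φ) 1) (s := Ioi 1)
    (H := fun _ => 0) (B := 0) (fun x hx y hy _ => by rw [key x hx, key y hy]; simp) (by simp) (by simp)
  simpa using this

theorem eVariationOn_waveFn_ne_top (h : IsBVSolution φ r m)
    (hdata : eVariationOn (dV (rphi r φ) 1) (Ioi 1) ≠ ⊤) (hN : nullForm₁ φ r ≠ ⊤) {u : ℝ}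
    (hu : 1 ≤ u) : eVariationOn (waveFn φ r u) (Ioi u) ≠ ⊤ := by
  refine ne_top_of_le_ne_top ?_ (h.eVariationOn_waveFn_le le_rfl hu)
  refine ENNReal.add_ne_top.2 ⟨?_, ?_⟩
  · exact ne_top_of_le_ne_top hdata
      ((eVariationOn.mono _ (Ioi_subset_Ioi hu)).trans h.eVariationOn_waveFn_one_le)
  · exact ne_top_of_le_ne_top hN (lintegral_mono_set Ioc_subset_Ioi_self)

/-- The first null form is integrated in u last, so two limits are needed: choose u₁ so late that
the null form beyond it is small, then u so late that the variation on C_{u₁} over v > u is small.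
-/
theorem tendsto_eVariationOn_waveFn (h : IsBVSolution φ r m)
    (hdata : eVariationOn (dV (rphi r φ) 1) (Ioi 1) ≠ ⊤) (hN : nullForm₁ φ r ≠ ⊤) :
    Tendsto (fun u => eVariationOn (waveFn φ r u) (Ioi u)) atTop (𝓝 0) := by
  rw [ENNReal.tendsto_nhds_zero]
  intro ε hε
  have hε2 : 0 < ε / 2 := ENNReal.half_pos hε.ne'
  obtain ⟨u₁, hu₁, h1⟩ := ((ENNReal.tendsto_nhds_zero.1 (tendsto_setLIntegral_Ioi_zero hN) _
    hε2).and (eventually_ge_atTop 1)).exists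
  filter_upwards [ENNReal.tendsto_nhds_zero.1
    (tendsto_eVariationOn_Ioi_zero (h.eVariationOn_waveFn_ne_top hdata hN h1)) _ hε2,
    eventually_ge_atTop u₁] with u hu hu'
  refine (h.eVariationOn_waveFn_le h1 hu').trans ?_
  rw [← ENNReal.add_halves ε]
  exact add_le_add hu ((lintegral_mono_set Ioc_subset_Ioi_self).trans hu₁)

theorem boundedVariationOn_massFn_one (h : IsBVSolution φ r m)
    (hdata : eVariationOn (dV (rphi r φ) 1) (Ioi 1) ≠ ⊤) :
    BoundedVariationOn (massFn φ r m 1) (Ioi 1) := by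
  have hf : eVariationOn (waveFn φ r 1) (Ioi 1) ≤
      ENNReal.ofReal (eVariationOn (dV (rphi r φ) 1) (Ioi 1)).toReal := by
    rw [ENNReal.ofReal_toReal hdata]
    exact h.eVariationOn_waveFn_one_le
  refine ne_top_of_le_ne_top (ENNReal.ofReal_ne_top
    (r := 3 * ((eVariationOn (dV (rphi r φ) 1) (Ioi 1)).toReal / (1 / 2)) ^ 2))
    (eVariationOn_Ioi_le fun V hV => ?_)
  refine (h.eVariationOn_massFn_le_log le_rfl hV ENNReal.toReal_nonneg hf (ℓ := 1 / 2) (by norm_num)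
    fun x hx => (h.lam_init hx.1.le).ge).trans ?_
  have h0 : eVariationOn (fun v => Real.log (lam r 1 v)) (Ioc 1 V) = 0 := by
    refine eVariationOn.constant_on ?_
    rintro _ ⟨x, hx, rfl⟩ _ ⟨y, hy, rfl⟩
    simp only [h.lam_init hx.1.le, h.lam_init hy.1.le]
  rw [h0, zero_add]

theorem tendsto_eVariationOn_massFn (h : IsBVSolution φ r m)
    (hdata : eVariationOn (dV (rphi r φ) 1) (Ioi 1) ≠ ⊤) (hN : nullForm₂ φ r ≠ ⊤) :
    Tendsto (fun u => eVariationOn (massFn φ r m u) (Ioi u)) atTop (𝓝 0) := by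
  have h1 := (tendsto_eVariationOn_Ioi_zero (h.boundedVariationOn_massFn_one hdata)).add
    (tendsto_setLIntegral_Ioi_zero hN)
  rw [add_zero] at h1
  refine tendsto_of_tendsto_of_tendsto_of_le_of_le' tendsto_const_nhds h1
    (Eventually.of_forall fun _ => zero_le) ?_
  filter_upwards [eventually_ge_atTop 1] with u hu
  exact h.eVariationOn_massFn_le hu

/-- A continuity argument: if the variations are small, `λ` stays close to its value at the axis. -/
theorem lam_ge_of_small (h : IsBVSolution φ r m) {u f c : ℝ} (hu : 1 ≤ u) (hf0 : 0 ≤ f)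
    (hf : eVariationOn (waveFn φ r u) (Ioi u) ≤ ENNReal.ofReal f) (hc : 0 < c)
    (hcu : c ≤ lamAxis r u) (hsmall : eVariationOn (massFn φ r m u) (Ioi u) +
      ENNReal.ofReal (3 * (f / (c / 4)) ^ 2) ≤ ENNReal.ofReal (Real.log 2)) {v : ℝ} (huv : u < v) :
    c / 4 ≤ lam r u v := by
  by_contra hv
  set A : Set ℝ := {x | u < x ∧ lam r u x < c / 4} with hA
  have hAne : A.Nonempty := ⟨v, huv, not_le.1 hv⟩
  have hbdd : BddBelow A := ⟨u, fun x hx => hx.1.le⟩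
  set s := sInf A with hs
  have hlim := h.tendsto_lam hu
  have hnear : ∀ᶠ x in 𝓝[>] u, c / 4 < lam r u x := hlim.eventually_const_lt (by linarith)
  have hus : u < s := by
    obtain ⟨w, hw, hw'⟩ := mem_nhdsGT_iff_exists_Ioo_subset.1 hnear
    refine (mem_Ioi.1 hw).trans_le (le_csInf hAne fun x hx => ?_)
    by_contra hxw
    exact absurd hx.2 (not_lt.2 (le_of_lt (hw' ⟨hx.1, not_le.1 hxw⟩)))
  have hIoo : ∀ x ∈ Ioo u s, c / 4 ≤ lam r u x := fun x hx => by
    by_contra hx'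
    exact absurd (csInf_le hbdd ⟨hx.1, not_le.1 hx'⟩) (not_le.2 hx.2)
  -- Let s be the infimum of the points where λ < c/4. Up to s the variation of log λ is at most log
  -- 2, so λ(s) is at least half the axis value.
  have hvar := (h.eVariationOn_log_lam_le hu hus hf0 hf (by positivity) hIoo).trans
    ((add_le_add (eVariationOn.mono _ Ioc_subset_Ioi_self) le_rfl).trans hsmall)
  have hlog2 : 0 < Real.log 2 := Real.log_pos (by norm_num)
  have hls := h.lam_pos hu hus
  have h1 : ∀ᶠ x in 𝓝[>] u, Real.log (lam r u x) - Real.log 2 ≤ Real.log (lam r u s) := by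
    filter_upwards [Ioo_mem_nhdsGT hus] with x hx
    have := abs_sub_le_of_eVariationOn_le hvar (x := x) (y := s) ⟨hx.1, hx.2.le⟩ ⟨hus, le_rfl⟩
    rw [max_eq_left hlog2.le] at this
    linarith [(abs_le.1 this).2]
  have h2 : Real.log (lamAxis r u) - Real.log 2 ≤ Real.log (lam r u s) :=
    le_of_tendsto ((hlim.log (by linarith)).sub_const _) h1
  have h3 : c / 2 ≤ lam r u s := by
    rw [← Real.log_div (by linarith) (by norm_num)] at h2
    have := (Real.log_le_log_iff (by linarith) hls).1 h2
    linarith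
  -- Right-continuity keeps λ above c/4 a little beyond s, contradicting the choice of s.
  have h4 : ∀ᶠ x in 𝓝[≥] s, c / 4 < lam r u x :=
    (h.rightCts_lam u s hu hus).tendsto.eventually_const_lt (by linarith)
  obtain ⟨w, hw, hw'⟩ := mem_nhdsGE_iff_exists_Ico_subset.1 h4
  refine absurd (le_csInf hAne fun x hx => ?_) (not_le.2 (mem_Ioi.1 hw))
  by_contra hxw
  exact absurd hx.2 (not_lt.2 (le_of_lt (hw' ⟨csInf_le hbdd hx, not_le.1 hxw⟩)))

theorem exists_le_lamAxis
    (hB : (⨆ u ∈ Ici (1 : ℝ), (ENNReal.ofReal (lamAxis r u))⁻¹) ≠ ⊤) :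
    ∃ c > 0, ∀ u, 1 ≤ u → c ≤ lamAxis r u := by
  set S := ⨆ u ∈ Ici (1 : ℝ), (ENNReal.ofReal (lamAxis r u))⁻¹ with hS
  have hK : 0 < S.toReal + 1 := by positivity
  refine ⟨(S.toReal + 1)⁻¹, by positivity, fun u hu => ?_⟩
  have h1 : (ENNReal.ofReal (lamAxis r u))⁻¹ ≤ ENNReal.ofReal (S.toReal + 1) := by
    refine (le_iSup₂ (f := fun (u : ℝ) (_ : u ∈ Ici (1 : ℝ)) => (ENNReal.ofReal (lamAxis r u))⁻¹)
      u hu).trans (ENNReal.le_ofReal_iff_toReal_le hB hK.le |>.2 ?_)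
    linarith
  have h2 := ENNReal.inv_le_inv.2 h1
  rw [inv_inv, ← ENNReal.ofReal_inv_of_pos hK, ENNReal.ofReal_le_ofReal_iff'] at h2
  rcases h2 with h2 | h2
  · exact h2
  · exact absurd h2 (not_le.2 (by positivity))

/-- Without blow-up at infinity, `λ` is eventually bounded below. -/
theorem eventually_lam_ge (h : IsBVSolution φ r m)
    (hdata : eVariationOn (dV (rphi r φ) 1) (Ioi 1) ≠ ⊤) (hN : ¬BlowsUpAtInfinity φ r) :
    ∃ ℓ > 0, ∀ᶠ u in atTop, ∀ v, u < v → ℓ ≤ lam r u v := by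
  simp only [BlowsUpAtInfinity, not_or] at hN
  obtain ⟨c, hc, hcu⟩ := exists_le_lamAxis hN.1
  refine ⟨c / 4, by positivity, ?_⟩
  have hw := h.tendsto_eVariationOn_waveFn hdata hN.2.1
  have hw' := (ENNReal.tendsto_toReal ENNReal.zero_ne_top).comp hw
  have hmass := h.tendsto_eVariationOn_massFn hdata hN.2.2
  have h1 := hmass.add (ENNReal.tendsto_ofReal (((hw'.div_const (c / 4)).pow 2).const_mul 3))
  simp only [ENNReal.toReal_zero, zero_div, ne_eq, OfNat.ofNat_ne_zero, not_false_eq_true, zero_pow,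
    mul_zero, ENNReal.ofReal_zero, add_zero] at h1
  have hlog2 : 0 < ENNReal.ofReal (Real.log 2) :=
    ENNReal.ofReal_pos.2 (Real.log_pos (by norm_num))
  filter_upwards [h1.eventually_lt_const hlog2, eventually_ge_atTop 1] with u hu hu1 v huv
  exact h.lam_ge_of_small hu1 ENNReal.toReal_nonneg
    (ENNReal.ofReal_toReal (h.eVariationOn_waveFn_ne_top hdata hN.2.1 hu1)).ge hc (hcu u hu1) hu.le huv

theorem tendsto_eVariationOn_log_lam (h : IsBVSolution φ r m)
    (hdata : eVariationOn (dV (rphi r φ) 1) (Ioi 1) ≠ ⊤) (hN : ¬BlowsUpAtInfinity φ r) :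
    Tendsto (fun u => eVariationOn (fun v => Real.log (lam r u v)) (Ioi u)) atTop (𝓝 0) := by
  obtain ⟨ℓ, hℓ, hlam⟩ := h.eventually_lam_ge hdata hN
  simp only [BlowsUpAtInfinity, not_or] at hN
  have hw := h.tendsto_eVariationOn_waveFn hdata hN.2.1
  have hw' := (ENNReal.tendsto_toReal ENNReal.zero_ne_top).comp hw
  have hmass := h.tendsto_eVariationOn_massFn hdata hN.2.2
  have h1 := hmass.add (ENNReal.tendsto_ofReal (((hw'.div_const ℓ).pow 2).const_mul 3))
  simp only [ENNReal.toReal_zero, zero_div, ne_eq, OfNat.ofNat_ne_zero, not_false_eq_true, zero_pow,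
    mul_zero, ENNReal.ofReal_zero, add_zero] at h1
  refine tendsto_of_tendsto_of_tendsto_of_le_of_le' tendsto_const_nhds h1
    (Eventually.of_forall fun _ => zero_le) ?_
  filter_upwards [hlam, eventually_ge_atTop 1] with u hu hu1
  refine eVariationOn_Ioi_le fun V hV => ?_
  exact (h.eVariationOn_log_lam_le hu1 hV ENNReal.toReal_nonneg
    (ENNReal.ofReal_toReal (h.eVariationOn_waveFn_ne_top hdata hN.2.1 hu1)).ge hℓ
    fun x hx => hu x hx.1).trans (add_le_add (eVariationOn.mono _ Ioc_subset_Ioi_self) le_rfl)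

end IsBVSolution

end SSESF

namespace SSESF

namespace IsBVSolution

variable {φ r m : ℝ → ℝ → ℝ}

/-! ### Bounds for `φ` and decay of the variation of `∂_v (r φ)` -/

/-- Young's inequality, with a weight later chosen so that the square becomes the density of the
mass. -/
theorem abs_le_weighted_sq (b : ℝ) {s : ℝ} (hs : 0 < s) : |b| ≤ (s * b ^ 2 + s⁻¹) / 2 := by
  rw [← sq_abs b]
  have h1 : s * s⁻¹ = 1 := mul_inv_cancel₀ hs.ne'
  have h2 : 0 ≤ s⁻¹ * (s * |b| - 1) ^ 2 := by positivity
  have h3 : s⁻¹ * (s * |b| - 1) ^ 2 =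
      (s * s⁻¹) * s * |b| ^ 2 - 2 * (s * s⁻¹) * |b| + s⁻¹ := by ring
  rw [h3, h1] at h2
  linarith

/-- By Young's inequality |∂_uφ| is at most a multiple of -∂_u m plus a multiple of -ν/r² =
∂_u(1/r), and both integrate explicitly. The parameter τ is left free, to be adapted to the
available bound on the mass. -/
theorem abs_phi_sub_le (h : IsBVSolution φ r m) {u v q τ : ℝ} (hu : 1 ≤ u) (huv : u < v)
    (hq : 0 < q)
    (hτ : 0 < τ) (hmu : ∀ x ∈ Icc 1 u, q ≤ 1 - massRatio r m x v) :
    |φ u v - φ 1 v| ≤ (τ * m 1 v + 2 / (τ * q * r u v)) / 2 := by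
  have hv := hu.trans huv.le
  have hr : ∀ x ∈ Icc 1 u, 0 < r x v := fun x hx => h.r_pos x v hx.1 (hx.2.trans_lt huv)
  have hG := ((HasAEDerivOn.const hu (-(τ / 2))).mul ((h.m_u hv).mono le_rfl hu huv.le)).add
    ((HasAEDerivOn.const hu (1 / (τ * q))).mul (((h.r_u hv).mono le_rfl hu huv.le).inv
      fun x hx => (hr x hx).ne'))
  have h1 := ((h.phi_u hv).mono le_rfl hu huv.le).abs_sub_le_sub hG fun x hx => by
    have hN := h.nu_neg hx.1.le (hx.2.trans huv)
    have hrx := hr x ⟨hx.1.le, hx.2.le⟩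
    have hw := hmu x ⟨hx.1.le, hx.2.le⟩
    set N := -nu r x v with hNdef
    have hN0 : 0 < N := neg_pos.2 hN
    have hnu : nu r x v = -N := by rw [hNdef, neg_neg]
    rw [hnu]
    set w := 1 - massRatio r m x v
    have hw0 : 0 < w := hq.trans_le hw
    -- This weight makes s(∂_uφ)²/2 equal to -(τ/2)∂_u m.
    set s := τ * w * r x v ^ 2 / (2 * N) with hs
    have hs0 : 0 < s := by positivity
    have e1 := abs_le_weighted_sq (dU φ x v) hs0
    have e2 : s⁻¹ ≤ 2 * (1 / (τ * q) * (N / r x v ^ 2)) := by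
      rw [hs, inv_div, show 2 * (1 / (τ * q) * (N / r x v ^ 2)) = 2 * N / (τ * q * r x v ^ 2) by
        field_simp]
      gcongr
    have e3 : -(τ / 2) * (w * r x v ^ 2 * dU φ x v ^ 2 / (2 * -N)) = s * dU φ x v ^ 2 / 2 := by
      rw [hs]; field_simp
    rw [e3, zero_mul, zero_add, zero_mul, zero_add]
    linarith
  have h2 := h.m_nonneg hu huv.le
  have h3 := h.r_pos 1 v le_rfl (hu.trans_lt huv)
  have h4 := h.r_pos u v hu huv
  refine h1.trans ?_
  have e1 : (τ * m 1 v + 2 / (τ * q * r u v)) / 2 =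
      τ / 2 * m 1 v + 1 / (τ * q) * (r u v)⁻¹ := by field_simp
  have e2 : 0 ≤ 1 / (τ * q) * (r 1 v)⁻¹ := by positivity
  have e3 : 0 ≤ τ / 2 * m u v := by positivity
  rw [e1]
  linarith

theorem exists_one_sub_init_ge (h : IsBVSolution φ r m)
    (hdata : eVariationOn (dV (rphi r φ) 1) (Ioi 1) ≠ ⊤) :
    ∃ q > 0, ∀ v, 1 < v → q ≤ 1 - massRatio r m 1 v := by
  set f := (eVariationOn (dV (rphi r φ) 1) (Ioi 1)).toReal with hfdef
  have hf0 : 0 ≤ f := ENNReal.toReal_nonneg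
  have hf : eVariationOn (waveFn φ r 1) (Ioi 1) ≤ ENNReal.ofReal f := by
    rw [hfdef, ENNReal.ofReal_toReal hdata]
    exact h.eVariationOn_waveFn_one_le
  refine ⟨Real.exp (-(f / (1 / 2)) ^ 2), Real.exp_pos _, fun v hv => ?_⟩
  have h1 := h.log_one_sub_add_nonneg le_rfl hv (h.intervalIntegrable_density le_rfl hv.le hf0 hf)
  have h2 := h.integral_density_le le_rfl hv hf0 hf (ℓ := 1 / 2) (by norm_num)
    fun x hx => (h.lam_init hx.1.le).ge
  rw [← Real.le_log_iff_exp_le (h.one_sub_pos le_rfl hv)]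
  linarith

/-- Monotonicity of λ/(1-μ) in u compares with C_1, where this quotient is at most 1/(2q); moreover
λ does not increase in u. -/
theorem one_sub_ge (h : IsBVSolution φ r m) {q ℓ u v x : ℝ} (hq : 0 < q)
    (hq1 : ∀ v, 1 < v → q ≤ 1 - massRatio r m 1 v) (hℓ : 0 < ℓ) (hx : 1 ≤ x) (hxu : x ≤ u)
    (huv : u < v) (hlam : ℓ ≤ lam r u v) : 2 * ℓ * q ≤ 1 - massRatio r m x v := by
  have hxv := hxu.trans_lt huv
  have h1 := h.div_one_sub_anti_u le_rfl hx hxv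
  have h2 := h.one_sub_pos hx hxv
  have h3 := hq1 v (hx.trans_lt hxv)
  have h4 := hlam.trans (h.lam_anti_u hx hxu huv)
  rw [h.lam_init (hx.trans hxv.le), div_le_div_iff₀ h2 (hq.trans_le h3)] at h1
  have h5 := mul_le_mul h4 h3 hq.le (hℓ.le.trans h4)
  linarith

theorem r_ge (h : IsBVSolution φ r m) {ℓ u v : ℝ} (hu : 1 ≤ u) (huv : u ≤ v)
    (hlam : ∀ x, u < x → ℓ ≤ lam r u x) : ℓ * (v - u) ≤ r u v := by
  have h1 := intervalIntegral.integral_mono_on_of_le_Ioo huv (intervalIntegrable_const (c := ℓ))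
    (h.r_v hu huv).intervalIntegrable fun x hx => hlam x hx.1
  rw [← h.r_eq_integral hu huv, intervalIntegral.integral_const, smul_eq_mul] at h1
  linarith

/-- A bound uniform in u without finiteness of the Bondi mass: with τ = 1/r(1,v) the mass term is
controlled by 2m < r, and r(1,v)/r(u,v) stays bounded because both radii grow linearly in v. -/
theorem exists_eventually_abs_phi_le (h : IsBVSolution φ r m)
    (hφ : Tendsto (fun v => φ 1 v) atTop (𝓝 0))
    (hdata : eVariationOn (dV (rphi r φ) 1) (Ioi 1) ≠ ⊤) {ℓ : ℝ} (hℓ : 0 < ℓ) :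
    ∃ K : ℝ, 0 ≤ K ∧ ∀ u, 1 ≤ u → (∀ v, u < v → ℓ ≤ lam r u v) → ∀ᶠ v in atTop, |φ u v| ≤ K := by
  obtain ⟨q, hq, hq1⟩ := h.exists_one_sub_init_ge hdata
  have hQ : 0 < 2 * ℓ * q := by positivity
  refine ⟨1 + (1 + 2 / (2 * ℓ * q) * (1 / ℓ)) / 2, by positivity, fun u hu hlam => ?_⟩
  have hφ1 : ∀ᶠ v in atTop, |φ 1 v| < 1 := by
    have := hφ.abs
    rw [abs_zero] at this
    exact this.eventually_lt_const one_pos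
  filter_upwards [hφ1, eventually_ge_atTop (2 * u + 1)] with v hv1 hv
  have huv : u < v := by linarith
  have hr1 := h.r_pos 1 v le_rfl (by linarith)
  have hru := h.r_pos u v hu huv
  have h1 := h.abs_phi_sub_le hu huv hQ (inv_pos.2 hr1) fun x hx =>
    h.one_sub_ge hq hq1 hℓ hx.1 hx.2 huv (hlam v huv)
  have h2 : (r 1 v)⁻¹ * m 1 v ≤ 1 := by
    have h3 := h.one_sub_pos le_rfl (by linarith : 1 < v)
    rw [massRatio, sub_pos, div_lt_one hr1] at h3
    rw [inv_mul_le_iff₀ hr1]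
    linarith [h.m_nonneg le_rfl (by linarith : 1 ≤ v)]
  have h4 : r 1 v / r u v ≤ 1 / ℓ := by
    rw [div_le_div_iff₀ hru hℓ]
    have h5 := h.r_ge hu huv.le hlam
    have h6 := h.r_init v (by linarith)
    nlinarith
  have h5 : 2 / ((r 1 v)⁻¹ * (2 * ℓ * q) * r u v) ≤ 2 / (2 * ℓ * q) * (1 / ℓ) := by
    rw [show 2 / ((r 1 v)⁻¹ * (2 * ℓ * q) * r u v) = 2 / (2 * ℓ * q) * (r 1 v / r u v) by field_simp]
    exact mul_le_mul_of_nonneg_left h4 (by positivity)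
  have h6 := abs_add_le (φ u v - φ 1 v) (φ 1 v)
  rw [sub_add_cancel] at h6
  linarith

theorem abs_phi_sub_phi_le (h : IsBVSolution φ r m) {u x y f ℓ : ℝ} (hu : 1 ≤ u) (hf0 : 0 ≤ f)
    (hf : eVariationOn (waveFn φ r u) (Ioi u) ≤ ENNReal.ofReal f) (hℓ : 0 < ℓ)
    (hlam : ∀ x, u < x → ℓ ≤ lam r u x) (hx : u < x) (hxy : x ≤ y) :
    |φ u y - φ u x| ≤ f / ℓ := by
  have h1 := ((h.phi_v hu (hx.le.trans hxy)).mono hx.le hxy le_rfl).abs_sub_le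
  have h2 := intervalIntegral.integral_add_adjacent_intervals
    (h.intervalIntegrable_abs_dV hu le_rfl hx.le) (h.intervalIntegrable_abs_dV hu hx.le hxy)
  have h3 : 0 ≤ ∫ t in u..x, |dV φ u t| :=
    intervalIntegral.integral_nonneg hx.le fun _ _ => abs_nonneg _
  have h4 := h.integral_abs_dV_le hu (hx.trans_le hxy) hf0 hf hℓ fun z hz => hlam z hz.1
  linarith

/-- Integrate ∂_vφ back from large v; its L¹ norm on C_u is at most f/ℓ. -/
theorem abs_phi_le_of_eventually (h : IsBVSolution φ r m) {u v f ℓ K : ℝ} (hu : 1 ≤ u) (hf0 : 0 ≤ f)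
    (hf : eVariationOn (waveFn φ r u) (Ioi u) ≤ ENNReal.ofReal f) (hℓ : 0 < ℓ)
    (hlam : ∀ x, u < x → ℓ ≤ lam r u x) (hK : ∀ᶠ v in atTop, |φ u v| ≤ K) (huv : u < v) :
    |φ u v| ≤ K + f / ℓ := by
  obtain ⟨y, hy, hvy⟩ := (hK.and (eventually_ge_atTop v)).exists
  have h1 := h.abs_phi_sub_phi_le hu hf0 hf hℓ hlam huv hvy
  have h2 := abs_sub (φ u y) (φ u y - φ u v)
  rw [sub_sub_cancel] at h2
  linarith

/-- From log t ≤ t - 1 at t = a/b, with the larger of the two numbers at most 1/2. -/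
theorem abs_sub_le_half_abs_log_sub {a b : ℝ} (ha : 0 < a) (hb : 0 < b) (ha' : a ≤ 1 / 2)
    (hb' : b ≤ 1 / 2) : |b - a| ≤ 1 / 2 * |Real.log b - Real.log a| := by
  wlog hab : a ≤ b generalizing a b
  · rw [abs_sub_comm, abs_sub_comm (Real.log b)]
    exact this hb ha hb' ha' (not_le.1 hab).le
  have h1 := Real.log_le_log ha hab
  rw [abs_of_nonneg (sub_nonneg.2 hab), abs_of_nonneg (sub_nonneg.2 h1)]
  have h2 := Real.log_le_sub_one_of_pos (div_pos ha hb)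
  rw [Real.log_div ha.ne' hb.ne'] at h2
  have h3 : b - a ≤ b * (Real.log b - Real.log a) := by
    have : b * (a / b) = a := by field_simp
    nlinarith
  nlinarith

theorem eVariationOn_dV_rphi_le (h : IsBVSolution φ r m) {u f ℓ A K : ℝ} (hu : 1 ≤ u) (hf0 : 0 ≤ f)
    (hf : eVariationOn (waveFn φ r u) (Ioi u) ≤ ENNReal.ofReal f) (hℓ : 0 < ℓ)
    (hlam : ∀ x, u < x → ℓ ≤ lam r u x) (hA0 : 0 ≤ A)
    (hA : eVariationOn (fun v => Real.log (lam r u v)) (Ioi u) ≤ ENNReal.ofReal A)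
    (hK0 : 0 ≤ K) (hK : ∀ v, u < v → |φ u v| ≤ K) :
    eVariationOn (dV (rphi r φ) u) (Ioi u) ≤
      eVariationOn (waveFn φ r u) (Ioi u) + ENNReal.ofReal (K / 2 * A + f / ℓ) := by
  have hbv : BoundedVariationOn (fun v => Real.log (lam r u v)) (Ioi u) :=
    ne_top_of_le_ne_top ENNReal.ofReal_ne_top hA
  have hint : ∀ x ∈ Ioi u, ∀ y ∈ Ioi u, x ≤ y →
      (∫ t in u..y, |dV φ u t|) - ∫ t in u..x, |dV φ u t| = ∫ t in x..y, |dV φ u t| :=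
    fun x hx y hy hxy => integral_sub_of (h.intervalIntegrable_abs_dV hu le_rfl
      (le_of_lt (mem_Ioi.1 hy))) (le_of_lt (mem_Ioi.1 hx)) hxy
  have hintnn : ∀ x ∈ Ioi u, ∀ y ∈ Ioi u, x ≤ y → 0 ≤ ∫ t in x..y, |dV φ u t| :=
    fun x _ y _ hxy => intervalIntegral.integral_nonneg hxy fun _ _ => abs_nonneg _
  -- An increment of ∂_v(rφ) is one of `waveFn` plus λΔφ + φΔλ - ∫λ∂_vφ. As λ ≤ 1/2, the first and
  -- last terms cost half of ∫|∂_vφ| each, and φΔλ costs K/2 times the variation of log λ.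
  refine eVariationOn_le_add (H := fun v => K / 2 *
    (eVariationOn (fun v => Real.log (lam r u v)) (Ioc u v)).toReal + ∫ t in u..v, |dV φ u t|)
    (fun x hx y hy hxy => ?_) (fun x hx y hy hxy => ?_) fun x hx y hy hxy => ?_
  · have hx' : u < x := hx
    have hy' : u < y := hy
    have e1 := h.r_mul_dV hu hx'
    have e2 := h.r_mul_dV hu hy'
    have e3 := h.waveFn_sub hu hx' hxy
    have e4 := (h.phi_v hu hy'.le).mono hx'.le hxy le_rfl
    have ei := h.intervalIntegrable_abs_dV hu hx'.le hxy
    have b1 : |φ u y - φ u x| ≤ ∫ t in x..y, |dV φ u t| := e4.abs_sub_le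
    have b2 : |∫ t in x..y, lam r u t * dV φ u t| ≤ 1 / 2 * ∫ t in x..y, |dV φ u t| := by
      rw [← intervalIntegral.integral_const_mul, ← Real.norm_eq_abs]
      refine intervalIntegral.norm_integral_le_of_norm_le hxy ?_ (ei.const_mul _)
      refine Eventually.of_forall fun t ht => ?_
      have hut := hx'.trans ht.1
      rw [Real.norm_eq_abs, abs_mul, abs_of_pos (h.lam_pos hu hut)]
      exact mul_le_mul_of_nonneg_right (h.lam_le_half hu hut) (abs_nonneg _)
    have b3 := abs_sub_le_half_abs_log_sub (h.lam_pos hu hx') (h.lam_pos hu hy')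
      (h.lam_le_half hu hx') (h.lam_le_half hu hy')
    have b4 := abs_sub_le_eVariationOn_Ioc_sub hbv hx' hxy
    have b5 : |lam r u y * (φ u y - φ u x)| ≤ 1 / 2 * ∫ t in x..y, |dV φ u t| := by
      rw [abs_mul, abs_of_pos (h.lam_pos hu hy')]
      exact mul_le_mul (h.lam_le_half hu hy') b1 (abs_nonneg _) (by norm_num)
    have b6 : |φ u x * (lam r u y - lam r u x)| ≤ K * (1 / 2 *
        ((eVariationOn (fun v => Real.log (lam r u v)) (Ioc u y)).toReal -
        (eVariationOn (fun v => Real.log (lam r u v)) (Ioc u x)).toReal)) := by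
      rw [abs_mul]
      exact mul_le_mul (hK x hx') (b3.trans (by linarith)) (abs_nonneg _) hK0
    have e5 : dV (rphi r φ) u y - dV (rphi r φ) u x = (waveFn φ r u y - waveFn φ r u x) +
        lam r u y * (φ u y - φ u x) + φ u x * (lam r u y - lam r u x) +
        -∫ t in x..y, lam r u t * dV φ u t := by
      linarith
    rw [e5]
    have b7 := abs_add_le ((waveFn φ r u y - waveFn φ r u x) + lam r u y * (φ u y - φ u x) +
      φ u x * (lam r u y - lam r u x)) (-∫ t in x..y, lam r u t * dV φ u t)
    have b8 := abs_add_three (waveFn φ r u y - waveFn φ r u x) (lam r u y * (φ u y - φ u x))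
      (φ u x * (lam r u y - lam r u x))
    rw [abs_neg] at b7
    linarith [hint x hx y hy hxy]
  · have h1 := eVariationOn_Ioc_toReal_mono hbv hxy
    have h2 := hint x hx y hy hxy
    have h3 := hintnn x hx y hy hxy
    have h4 := mul_le_mul_of_nonneg_left h1 (by positivity : 0 ≤ K / 2)
    simp only at h4
    linarith
  · have hy' : u < y := hy
    have h1 := eVariationOn_Ioc_toReal_le hA0 hA y
    have h2 := h.integral_abs_dV_le hu hy' hf0 hf hℓ fun z hz => hlam z hz.1
    have h3 : 0 ≤ ∫ t in u..x, |dV φ u t| :=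
      intervalIntegral.integral_nonneg (le_of_lt (mem_Ioi.1 hx)) fun _ _ => abs_nonneg _
    have h4 := mul_le_mul_of_nonneg_left h1 (by positivity : 0 ≤ K / 2)
    have h5 : 0 ≤ K / 2 * (eVariationOn (fun v => Real.log (lam r u v)) (Ioc u x)).toReal := by
      have : 0 ≤ (eVariationOn (fun v => Real.log (lam r u v)) (Ioc u x)).toReal :=
        ENNReal.toReal_nonneg
      positivity
    linarith

theorem scattersInBV (h : IsBVSolution φ r m) (hφ : Tendsto (fun v => φ 1 v) atTop (𝓝 0))
    (hdata : eVariationOn (dV (rphi r φ) 1) (Ioi 1) ≠ ⊤) (hN : ¬BlowsUpAtInfinity φ r) :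
    ScattersInBV φ r ⊤ := by
  have hset : ∀ u, {v | u < v ∧ ((r u v : ℝ) : EReal) ≤ ⊤} = Ioi u := fun u => by ext v; simp
  have hL := h.tendsto_eVariationOn_log_lam hdata hN
  simp only [ScattersInBV, hset]
  refine ⟨?_, hL⟩
  obtain ⟨ℓ, hℓ, hlam⟩ := h.eventually_lam_ge hdata hN
  obtain ⟨K, hK0, hK⟩ := h.exists_eventually_abs_phi_le hφ hdata hℓ
  simp only [BlowsUpAtInfinity, not_or] at hN
  have hw := h.tendsto_eVariationOn_waveFn hdata hN.2.1
  have hw' := (ENNReal.tendsto_toReal ENNReal.zero_ne_top).comp hw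
  have hL' := (ENNReal.tendsto_toReal ENNReal.zero_ne_top).comp hL
  have h1 := hw.add (ENNReal.tendsto_ofReal ((((hw'.div_const ℓ).const_add K).div_const 2).mul hL'
    |>.add (hw'.div_const ℓ)))
  simp only [ENNReal.toReal_zero, zero_div, add_zero, mul_zero, ENNReal.ofReal_zero] at h1
  refine tendsto_of_tendsto_of_tendsto_of_le_of_le' tendsto_const_nhds h1
    (Eventually.of_forall fun _ => zero_le) ?_
  filter_upwards [hlam, eventually_ge_atTop 1, hL.eventually_lt_const ENNReal.zero_lt_top]
    with u hu hu1 huL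
  have hf := (ENNReal.ofReal_toReal (h.eVariationOn_waveFn_ne_top hdata hN.2.1 hu1)).ge
  exact h.eVariationOn_dV_rphi_le hu1 ENNReal.toReal_nonneg hf hℓ hu ENNReal.toReal_nonneg
    (ENNReal.ofReal_toReal huL.ne).ge
    (add_nonneg hK0 (div_nonneg ENNReal.toReal_nonneg hℓ.le)) fun v hv =>
      h.abs_phi_le_of_eventually hu1 ENNReal.toReal_nonneg hf hℓ hu (hK u hu1 hu) hv

end IsBVSolution

end SSESF

namespace SSESF

namespace IsBVSolution

variable {φ r m : ℝ → ℝ → ℝ}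

/-! ### The Bondi mass -/

theorem r_mul_phi_sq_v (h : IsBVSolution φ r m) {u V : ℝ} (hu : 1 ≤ u) (huV : u ≤ V) :
    HasAEDerivOn (fun v => r u v * φ u v ^ 2)
      (fun v => lam r u v * φ u v ^ 2 + 2 * r u v * φ u v * dV φ u v) u V :=
  (((h.r_v hu huV).mul ((h.phi_v hu huV).mul (h.phi_v hu huV))).congr
    fun v _ => by ring).congr_deriv fun v _ => by ring

/-- Completing the square: the mass density and (∂_v(rφ))²/λ differ by the exact derivative of rφ²,
apart from the factor 1-μ. This relates the mass to the L² norm of ∂_v(rφ) in both directions. -/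
theorem density_add_eq (h : IsBVSolution φ r m) {u v : ℝ} (hu : 1 ≤ u) (huv : u < v) :
    r u v ^ 2 * dV φ u v ^ 2 / lam r u v + (lam r u v * φ u v ^ 2 + 2 * r u v * φ u v * dV φ u v) =
      dV (rphi r φ) u v ^ 2 / lam r u v := by
  have h1 : dV (rphi r φ) u v = r u v * dV φ u v + lam r u v * φ u v := by
    linarith [h.r_mul_dV hu huv]
  have h2 := h.lam_ne hu huv
  rw [h1]
  field_simp
  ring

theorem tendsto_r_atTop (h : IsBVSolution φ r m) {u ℓ : ℝ} (hu : 1 ≤ u) (hℓ : 0 < ℓ)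
    (hlam : ∀ v, u < v → ℓ ≤ lam r u v) : Tendsto (r u) atTop atTop := by
  have h1 : Tendsto (fun v => ℓ * (v - u)) atTop atTop :=
    (tendsto_atTop_add_const_right _ (-u) tendsto_id).const_mul_atTop hℓ
  refine tendsto_atTop_mono' _ ?_ h1
  filter_upwards [eventually_ge_atTop u] with v hv using h.r_ge hu hv hlam

/-! ### Decay of φ from bounds on the mass -/

section FiniteMass

variable {M₁ q u ℓ : ℝ}

theorem tendsto_phi_zero (h : IsBVSolution φ r m) (hφ : Tendsto (fun v => φ 1 v) atTop (𝓝 0))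
    (hM : ∀ v, 1 ≤ v → m 1 v ≤ M₁) (hu : 1 ≤ u) (hℓ : 0 < ℓ)
    (hlam : ∀ v, u < v → ℓ ≤ lam r u v) (hq : 0 < q)
    (hmu : ∀ v, u < v → ∀ x ∈ Icc 1 u, q ≤ 1 - massRatio r m x v) :
    Tendsto (φ u) atTop (𝓝 0) := by
  have hr := h.tendsto_r_atTop hu hℓ hlam
  have h1 : Tendsto (fun v => |φ 1 v| + (M₁ + 2 / q) / 2 * (Real.sqrt (r u v))⁻¹) atTop (𝓝 0) := by
    have h2 := (tendsto_inv_atTop_zero.comp (Real.tendsto_sqrt_atTop.comp hr)).const_mul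
      ((M₁ + 2 / q) / 2)
    simpa using hφ.abs.add h2
  refine squeeze_zero_norm' ?_ h1
  filter_upwards [eventually_gt_atTop u] with v hv
  have hru := h.r_pos u v hu hv
  have hs : 0 < Real.sqrt (r u v) := Real.sqrt_pos.2 hru
  -- The choice τ = r(u,v)^(-1/2) makes both terms multiples of r^(-1/2), since the mass is now
  -- bounded.
  have h2 := h.abs_phi_sub_le hu hv hq (inv_pos.2 hs) (hmu v hv)
  have h3 : 2 / ((Real.sqrt (r u v))⁻¹ * q * r u v) = 2 / q * (Real.sqrt (r u v))⁻¹ := by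
    nth_rewrite 2 [← Real.mul_self_sqrt hru.le]
    field_simp
  have h4 := mul_le_mul_of_nonneg_left (hM v (hu.trans hv.le)) (inv_pos.2 hs).le
  have h5 := abs_add_le (φ u v - φ 1 v) (φ 1 v)
  rw [sub_add_cancel] at h5
  rw [h3] at h2
  rw [Real.norm_eq_abs]
  linarith

/-- Decay of `φ` along an outgoing curve from the mass. -/
theorem r_mul_phi_sq_le (h : IsBVSolution φ r m) (hφu : Tendsto (φ u) atTop (𝓝 0))
    (hM : ∀ v, u ≤ v → m u v ≤ M₁) (hM0 : 0 ≤ M₁) (hu : 1 ≤ u) (hq : 0 < q)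
    (hmu : ∀ v, u < v → q ≤ 1 - massRatio r m u v) {v : ℝ} (huv : u < v) :
    r u v * φ u v ^ 2 ≤ ((2 * M₁ / q + 1) / 2) ^ 2 := by
  have hru := h.r_pos u v hu huv
  have hs : 0 < Real.sqrt (r u v) := Real.sqrt_pos.2 hru
  -- This τ balances the mass term τM₁/q against the radial term 1/(2τr).
  set τ := (Real.sqrt (r u v))⁻¹ with hτdef
  have hτ : 0 < τ := inv_pos.2 hs
  have key : ∀ y, v ≤ y → |φ u y - φ u v| ≤ (2 * M₁ / q + 1) / 2 * τ := by
    intro y hy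
    have huy := huv.trans_le hy
    have hG := ((HasAEDerivOn.const hy (τ / q)).mul ((h.m_v hu huy.le).mono huv.le hy le_rfl)).sub
      ((HasAEDerivOn.const hy (1 / (2 * τ))).mul (((h.r_v hu huy.le).mono huv.le hy le_rfl).inv
        fun x hx => (h.r_pos u x hu (huv.trans_le hx.1)).ne'))
    have h1 := ((h.phi_v hu huy.le).mono huv.le hy le_rfl).abs_sub_le_sub hG fun x hx => by
      have hux := huv.trans hx.1
      have hl := h.lam_pos hu hux
      have hrx := h.r_pos u x hu hux
      have hw := hmu x hux
      have e1 := abs_le_weighted_sq (dV φ u x) (s := τ * r u x ^ 2 / lam r u x) (by positivity)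
      have e2 : τ * r u x ^ 2 / lam r u x * dV φ u x ^ 2 / 2 ≤
          τ / q * ((1 - massRatio r m u x) * r u x ^ 2 * dV φ u x ^ 2 / (2 * lam r u x)) := by
        rw [show τ / q * ((1 - massRatio r m u x) * r u x ^ 2 * dV φ u x ^ 2 / (2 * lam r u x)) =
          (1 - massRatio r m u x) / q * (τ * r u x ^ 2 / lam r u x * dV φ u x ^ 2 / 2) by field_simp]
        refine le_mul_of_one_le_left (by positivity) ?_
        rwa [one_le_div hq]
      have e3 : (τ * r u x ^ 2 / lam r u x)⁻¹ / 2 = -(1 / (2 * τ) * (-lam r u x / r u x ^ 2)) := by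
        field_simp
      linarith
    refine h1.trans ?_
    have h2 := hM y huy.le
    have h3 := h.m_nonneg hu huv.le
    have h4 := h.r_pos u y hu huy
    have h5 : 1 / (2 * τ) * (r u v)⁻¹ = τ / 2 := by
      rw [hτdef]
      nth_rewrite 2 [← Real.mul_self_sqrt hru.le]
      field_simp
    have h6 : 0 ≤ 1 / (2 * τ) * (r u y)⁻¹ := by positivity
    have h7 := mul_le_mul_of_nonneg_left h2 (by positivity : 0 ≤ τ / q)
    have h8 : 0 ≤ τ / q * m u v := by positivity
    have h9 : (2 * M₁ / q + 1) / 2 * τ = τ / q * M₁ + τ / 2 := by field_simp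
    rw [h9]
    linarith
  have h1 : |φ u v| ≤ (2 * M₁ / q + 1) / 2 * τ := by
    have h2 : Tendsto (fun y => |φ u y - φ u v|) atTop (𝓝 |φ u v|) := by
      simpa using (hφu.sub_const (φ u v)).abs
    refine le_of_tendsto h2 ?_
    filter_upwards [eventually_ge_atTop v] with y hy using key y hy
  have h2 : r u v * τ ^ 2 = 1 := by
    rw [hτdef, inv_pow, Real.sq_sqrt hru.le, mul_inv_cancel₀ hru.ne']
  calc r u v * φ u v ^ 2 = r u v * |φ u v| ^ 2 := by rw [sq_abs]
    _ ≤ r u v * ((2 * M₁ / q + 1) / 2 * τ) ^ 2 := by gcongr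
    _ = ((2 * M₁ / q + 1) / 2) ^ 2 * (r u v * τ ^ 2) := by ring
    _ = _ := by rw [h2, mul_one]

end FiniteMass

/-- ∂_u∂_v(rφ) = φ∂_uλ, and ∂_uλ has a sign, so its integral is the total decrease of λ. -/
theorem abs_dV_rphi_sub_le (h : IsBVSolution φ r m) {u₁ u v ε : ℝ} (h1 : 1 ≤ u₁) (hu : u₁ ≤ u)
    (huv : u < v) (hε : ∀ x ∈ Icc u₁ u, |φ x v| ≤ ε) :
    |dV (rphi r φ) u v - dV (rphi r φ) u₁ v| ≤ ε * (lam r u₁ v - lam r u v) := by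
  have h2 := (h.dV_rphi_u h1 hu huv).abs_sub_le_sub
    ((HasAEDerivOn.const hu (-ε)).mul (h.lam_u h1 hu huv)) fun x hx => by
      have h3 := h.potential_nonpos (h1.trans hx.1.le) (hx.2.trans huv)
      rw [abs_mul, abs_of_nonpos h3]
      have := mul_le_mul_of_nonneg_left (hε x ⟨hx.1.le, hx.2.le⟩) (neg_nonneg.2 h3)
      linarith
  linarith

/-- Since λ ≤ 1/2, -∂_uλ = 2mλ(-ν)/((1-μ)r²) is at most (M₁/q)∂_u(1/r). -/
theorem lam_sub_le (h : IsBVSolution φ r m) {u₁ u v M₁ q : ℝ} (h1 : 1 ≤ u₁) (hu : u₁ ≤ u)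
    (huv : u < v) (hq : 0 < q) (hM : ∀ x ∈ Icc u₁ u, m x v ≤ M₁) (hM0 : 0 ≤ M₁)
    (hmu : ∀ x ∈ Icc u₁ u, q ≤ 1 - massRatio r m x v) :
    lam r u₁ v - lam r u v ≤ M₁ / q * (r u v)⁻¹ := by
  have hv := h1.trans (hu.trans huv.le)
  have hG := (HasAEDerivOn.const hu (M₁ / q)).mul (((h.r_u hv).mono h1 hu huv.le).inv
    fun x hx => (h.r_pos x v (h1.trans hx.1) (hx.2.trans_lt huv)).ne')
  have h2 := (h.lam_u h1 hu huv).neg.sub_le_sub hG fun x hx => by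
    have h1x := h1.trans hx.1.le
    have hxv := hx.2.trans huv
    have hx' : x ∈ Icc u₁ u := ⟨hx.1.le, hx.2.le⟩
    have hr := h.r_pos x v h1x hxv
    have hn := h.nu_neg h1x hxv
    have hl := h.lam_pos h1x hxv
    have hl' := h.lam_le_half h1x hxv
    have hw := hmu x hx'
    have hm := h.m_nonneg h1x hxv.le
    have hM' := hM x hx'
    rw [potential]
    set w := 1 - massRatio r m x v
    have hw0 : 0 < w := hq.trans_le hw
    rw [massRatio, show -(2 * m x v / r x v * lam r x v * nu r x v / (w * r x v)) =
      (m x v * (2 * lam r x v)) / w * (-nu r x v / r x v ^ 2) by field_simp, zero_mul, zero_add]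
    have hpos : 0 ≤ -nu r x v / r x v ^ 2 := div_nonneg (by linarith) (by positivity)
    refine mul_le_mul_of_nonneg_right (div_le_div₀ hM0 ?_ hq hw) hpos
    nlinarith
  have h3 := h.r_pos u₁ v h1 (hu.trans_lt huv)
  have h4 : 0 ≤ M₁ / q * (r u₁ v)⁻¹ := by positivity
  linarith

theorem intervalIntegrable_dV_rphi_sq (h : IsBVSolution φ r m) {u V : ℝ} (hu : 1 ≤ u)
    (huV : u ≤ V) :
    IntervalIntegrable (fun v => dV (rphi r φ) u v ^ 2) volume u V := by
  obtain ⟨C, hC⟩ := h.bv_dV u V hu huV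
  have hi := (h.rphi_v hu huV).intervalIntegrable
  refine (intervalIntegrable_bdd_mul (C := |dV (rphi r φ) u V| + max C 0) huV hi
    hi.1.aestronglyMeasurable fun x hx => ?_).congr fun x _ => by ring
  have h1 := abs_sub_le_of_eVariationOn_le (hC u ⟨le_rfl, huV⟩) hx ⟨hx.1.trans_le hx.2, le_rfl⟩
  have h2 := abs_add_le (dV (rphi r φ) u x - dV (rphi r φ) u V) (dV (rphi r φ) u V)
  rw [sub_add_cancel] at h2
  linarith

/-- Integrate the completed square from the axis, where both m and rφ² vanish. -/
theorem integral_dV_rphi_sq_le (h : IsBVSolution φ r m) {u V q : ℝ} (hu : 1 ≤ u) (huV : u ≤ V)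
    (hq : 0 < q) (hmu : ∀ v, u < v → q ≤ 1 - massRatio r m u v) :
    ∫ v in u..V, dV (rphi r φ) u v ^ 2 ≤ 1 / q * m u V + 1 / 2 * (r u V * φ u V ^ 2) := by
  have h1 := (HasAEDerivOn.of_integral huV (h.intervalIntegrable_dV_rphi_sq hu huV) 0).sub_le_sub
    (((HasAEDerivOn.const huV (1 / q)).mul (h.m_v hu huV)).add
      ((HasAEDerivOn.const huV (1 / 2)).mul (h.r_mul_phi_sq_v hu huV))) fun x hx => by
    have hl := h.lam_pos hu hx.1
    have hl' := h.lam_le_half hu hx.1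
    have hr := h.r_pos u x hu hx.1
    have hw := hmu x hx.1
    have e1 := h.density_add_eq hu hx.1
    have e2 : r u x ^ 2 * dV φ u x ^ 2 / lam r u x / 2 ≤
        1 / q * ((1 - massRatio r m u x) * r u x ^ 2 * dV φ u x ^ 2 / (2 * lam r u x)) := by
      rw [show 1 / q * ((1 - massRatio r m u x) * r u x ^ 2 * dV φ u x ^ 2 / (2 * lam r u x)) =
        (1 - massRatio r m u x) / q * (r u x ^ 2 * dV φ u x ^ 2 / lam r u x / 2) by field_simp]
      refine le_mul_of_one_le_left (by positivity) ?_
      rwa [one_le_div hq]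
    have e3 : dV (rphi r φ) u x ^ 2 ≤ dV (rphi r φ) u x ^ 2 / lam r u x / 2 := by
      rw [div_div, le_div_iff₀ (by positivity)]
      nlinarith [sq_nonneg (dV (rphi r φ) u x)]
    linarith
  simp only [intervalIntegral.integral_same, h.m_axis u hu, h.r_axis u hu] at h1
  linarith

/-- The mass at retarded time `u`, in terms of the data at an earlier retarded time `u₁`. -/
theorem m_le (h : IsBVSolution φ r m) {u₁ u V ε ℓ k : ℝ} (h1 : 1 ≤ u₁) (hu : u₁ ≤ u) (huV : u < V)
    (hℓ : 0 < ℓ) (hlam : ∀ v, u < v → ℓ ≤ lam r u v)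
    (hε : ∀ x ∈ Icc u₁ u, ∀ v, x < v → |φ x v| ≤ ε)
    (hk : ∀ v, u < v → (lam r u₁ v - lam r u v) * (1 + (v - u)) ≤ k) :
    m u V ≤ 1 / ℓ * (∫ v in u..V, dV (rphi r φ) u₁ v ^ 2) + 1 / ℓ * (ε ^ 2 * k ^ 2) := by
  have hu1 := h1.trans hu
  have hε0 : 0 ≤ ε := (abs_nonneg _).trans (hε u ⟨hu, le_rfl⟩ V huV)
  have hJ : IntervalIntegrable (fun v => dV (rphi r φ) u₁ v ^ 2) volume u V :=
    (h.intervalIntegrable_dV_rphi_sq h1 (hu.trans huV.le)).mono_set (by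
      rw [uIcc_of_le huV.le, uIcc_of_le (hu.trans huV.le)]; exact Icc_subset_Icc_left hu)
  have hlin : HasAEDerivOn (fun v : ℝ => 1 + (v - u)) (fun _ => 1) u V :=
    ⟨huV.le, (by
      have : LipschitzWith 1 fun v : ℝ => 1 + (v - u) := LipschitzWith.of_dist_le_mul fun x y => by
        simp [Real.dist_eq]
      exact this.lipschitzOnWith.absolutelyContinuousOnInterval),
      Eventually.of_forall fun x _ => ((hasDerivAt_id x).sub_const u).const_add 1⟩
  have hinv := hlin.inv fun x hx => (by linarith [hx.1] : (0 : ℝ) < 1 + (x - u)).ne'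
  -- The derivative of 2m + rφ² is at most (∂_v(rφ))²/ℓ. Replacing ∂_v(rφ) on C_u by its values on
  -- C_{u₁} costs at most εk/(1+v-u), whose square has the explicit primitive -(εk)²/(1+v-u).
  have key := (((HasAEDerivOn.const huV.le 2).mul (h.m_v hu1 huV.le)).add
    (h.r_mul_phi_sq_v hu1 huV.le)).sub_le_sub
    (((HasAEDerivOn.const huV.le (2 / ℓ)).mul (HasAEDerivOn.of_integral huV.le hJ 0)).sub
      ((HasAEDerivOn.const huV.le (2 / ℓ * (ε ^ 2 * k ^ 2))).mul hinv)) fun x hx => by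
    have hl := h.lam_pos hu1 hx.1
    have hl' := hlam x hx.1
    have hr := h.r_pos u x hu1 hx.1
    have hmu := h.massRatio_nonneg hu1 hx.1
    have e1 := h.density_add_eq hu1 hx.1
    have e2 : 2 * ((1 - massRatio r m u x) * r u x ^ 2 * dV φ u x ^ 2 / (2 * lam r u x)) ≤
        r u x ^ 2 * dV φ u x ^ 2 / lam r u x := by
      rw [show 2 * ((1 - massRatio r m u x) * r u x ^ 2 * dV φ u x ^ 2 / (2 * lam r u x)) =
        (1 - massRatio r m u x) * (r u x ^ 2 * dV φ u x ^ 2 / lam r u x) by field_simp]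
      exact mul_le_of_le_one_left (by positivity) (by linarith)
    have e3 : dV (rphi r φ) u x ^ 2 / lam r u x ≤ dV (rphi r φ) u x ^ 2 / ℓ :=
      div_le_div_of_nonneg_left (sq_nonneg _) hℓ hl'
    have e4 := h.abs_dV_rphi_sub_le h1 hu hx.1 fun y hy => hε y hy x (hy.2.trans_lt hx.1)
    have hs : 0 < 1 + (x - u) := by linarith [hx.1]
    have hD := h.lam_anti_u h1 hu hx.1
    have e5 : lam r u₁ x - lam r u x ≤ k / (1 + (x - u)) := by
      rw [le_div_iff₀ hs]; exact hk x hx.1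
    have e6 : |dV (rphi r φ) u x - dV (rphi r φ) u₁ x| ≤ ε * (k / (1 + (x - u))) :=
      e4.trans (mul_le_mul_of_nonneg_left e5 hε0)
    have e7 : (dV (rphi r φ) u x - dV (rphi r φ) u₁ x) ^ 2 ≤ (ε * (k / (1 + (x - u)))) ^ 2 := by
      rw [← sq_abs]
      exact pow_le_pow_left₀ (abs_nonneg _) e6 2
    have e8 : dV (rphi r φ) u x ^ 2 ≤ 2 * dV (rphi r φ) u₁ x ^ 2 +
        2 * (ε * (k / (1 + (x - u)))) ^ 2 := by
      nlinarith [sq_nonneg (dV (rphi r φ) u x - 2 * dV (rphi r φ) u₁ x)]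
    have e9 : dV (rphi r φ) u x ^ 2 / ℓ ≤ (2 * dV (rphi r φ) u₁ x ^ 2 +
        2 * (ε * (k / (1 + (x - u)))) ^ 2) / ℓ := div_le_div_of_nonneg_right e8 hℓ.le
    have e10 : (2 * dV (rphi r φ) u₁ x ^ 2 + 2 * (ε * (k / (1 + (x - u)))) ^ 2) / ℓ =
        2 / ℓ * dV (rphi r φ) u₁ x ^ 2 - 2 / ℓ * (ε ^ 2 * k ^ 2) * (-1 / (1 + (x - u)) ^ 2) := by
      field_simp
      ring
    linarith
  simp only [intervalIntegral.integral_same, h.m_axis u hu1, h.r_axis u hu1] at key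
  have h2 : 0 ≤ r u V * φ u V ^ 2 := mul_nonneg (h.r_nonneg hu1 huV.le) (sq_nonneg _)
  have h3 : 0 ≤ 2 / ℓ * (ε ^ 2 * k ^ 2) * (1 + (V - u))⁻¹ := by
    have : 0 < 1 + (V - u) := by linarith
    positivity
  have h4 : 2 / ℓ * (ε ^ 2 * k ^ 2) * (1 + (u - u))⁻¹ = 2 * (1 / ℓ * (ε ^ 2 * k ^ 2)) := by
    rw [sub_self, add_zero, inv_one]; ring
  have h5 : 2 / ℓ * (0 + ∫ t in u..V, dV (rphi r φ) u₁ t ^ 2) =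
      2 * (1 / ℓ * ∫ t in u..V, dV (rphi r φ) u₁ t ^ 2) := by ring
  linarith

end IsBVSolution

end SSESF

/-! ### Vanishing of the final Bondi mass -/

namespace SSESF

theorem exists_sub_lt_of_bddAbove {J : ℝ → ℝ} {a B δ : ℝ} (hB : ∀ v, a ≤ v → J v ≤ B) (hδ : 0 < δ)
    (hJ : ∀ x y, a ≤ x → x ≤ y → J x ≤ J y) : ∃ U, a ≤ U ∧ ∀ x y, U ≤ x → a ≤ y → J y - J x < δ := by
  have hbdd : BddAbove (J '' Ici a) := ⟨B, by rintro _ ⟨v, hv, rfl⟩; exact hB v hv⟩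
  obtain ⟨_, ⟨U, hU, rfl⟩, hlt⟩ := exists_lt_of_lt_csSup (s := J '' Ici a)
    ⟨J a, a, mem_Ici.2 le_rfl, rfl⟩ (sub_lt_self (sSup (J '' Ici a)) hδ)
  refine ⟨U, hU, fun x y hx hy => ?_⟩
  have h1 := le_csSup hbdd (mem_image_of_mem J (mem_Ici.2 hy))
  have h2 := hJ U x hU hx
  linarith

namespace IsBVSolution

variable {φ r m : ℝ → ℝ → ℝ}

theorem eventually_m_le (h : IsBVSolution φ r m) (hφ : Tendsto (fun v => φ 1 v) atTop (𝓝 0))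
    (hdata : eVariationOn (dV (rphi r φ) 1) (Ioi 1) ≠ ⊤) (hN : ¬BlowsUpAtInfinity φ r) {M₁ : ℝ}
    (hM : ∀ u v, 1 ≤ u → u ≤ v → m u v ≤ M₁) {η : ℝ} (hη : 0 < η) :
    ∀ᶠ u in atTop, ∀ V, u ≤ V → m u V ≤ η := by
  have hM0 : 0 ≤ M₁ := (h.m_nonneg le_rfl le_rfl).trans (hM 1 1 le_rfl le_rfl)
  obtain ⟨ℓ, hℓ, hlam⟩ := h.eventually_lam_ge hdata hN
  obtain ⟨q₁, hq₁, hmu₁⟩ := h.exists_one_sub_init_ge hdata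
  simp only [BlowsUpAtInfinity, not_or] at hN
  set q := 2 * ℓ * q₁ with hqdef
  have hq : 0 < q := by positivity
  -- The decrease of λ is at most 1/2, and at most M₁/(qr) with r ≥ ℓ(v-u); together these bound it
  -- by k/(1+v-u).
  set k := 1 / 2 + M₁ / q / ℓ with hkdef
  have hk0 : 0 < k := by positivity
  obtain ⟨ε, hε, hεη⟩ : ∃ ε > 0, 1 / ℓ * (ε ^ 2 * k ^ 2) ≤ η / 2 := by
    refine ⟨Real.sqrt (η * ℓ / 2) / k, by positivity, le_of_eq ?_⟩
    rw [div_pow, Real.sq_sqrt (by positivity)]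
    field_simp
  have hw : Tendsto (fun u => (eVariationOn (waveFn φ r u) (Ioi u)).toReal / ℓ) atTop (𝓝 0) := by
    have := ((ENNReal.tendsto_toReal ENNReal.zero_ne_top).comp
      (h.tendsto_eVariationOn_waveFn hdata hN.2.1)).div_const ℓ
    simpa using this
  -- From u₁ on, λ ≥ ℓ and the L¹ norm of ∂_vφ on C_u is at most ε/2; φ tends to zero along each
  -- C_u, so |φ| ≤ ε there.
  obtain ⟨u₁, hu₁⟩ := eventually_atTop.1 ((hlam.and (hw.eventually_le_const
    (half_pos hε))).and (eventually_ge_atTop 1))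
  have h1 : 1 ≤ u₁ := (hu₁ u₁ le_rfl).2
  have hmu : ∀ u, u₁ ≤ u → ∀ v, u < v → ∀ x ∈ Icc 1 u, q ≤ 1 - massRatio r m x v :=
    fun u hu v huv x hx => h.one_sub_ge hq₁ hmu₁ hℓ hx.1 hx.2 huv ((hu₁ u hu).1.1 v huv)
  have hφ0 : ∀ u, u₁ ≤ u → Tendsto (φ u) atTop (𝓝 0) := fun u hu =>
    h.tendsto_phi_zero hφ (fun v hv => hM 1 v le_rfl hv) (h1.trans hu) hℓ (hu₁ u hu).1.1 hq (hmu u hu)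
  have hφε : ∀ u, u₁ ≤ u → ∀ v, u < v → |φ u v| ≤ ε := by
    intro u hu v huv
    have h2 : ∀ᶠ v in atTop, |φ u v| ≤ ε / 2 := by
      have := (hφ0 u hu).abs
      rw [abs_zero] at this
      exact this.eventually_le_const (half_pos hε)
    have h3 := h.abs_phi_le_of_eventually (h1.trans hu) ENNReal.toReal_nonneg
      (ENNReal.ofReal_toReal (h.eVariationOn_waveFn_ne_top hdata hN.2.1 (h1.trans hu))).ge hℓ
      (hu₁ u hu).1.1 h2 huv
    linarith [(hu₁ u hu).1.2]
  set J : ℝ → ℝ := fun v => ∫ x in u₁..v, dV (rphi r φ) u₁ x ^ 2 with hJdef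
  have hJsub : ∀ x y, u₁ ≤ x → x ≤ y → J y - J x = ∫ t in x..y, dV (rphi r φ) u₁ t ^ 2 :=
    fun x y hx hxy => integral_sub_of (h.intervalIntegrable_dV_rphi_sq h1 (hx.trans hxy)) hx hxy
  have hJmono : ∀ x y, u₁ ≤ x → x ≤ y → J x ≤ J y := fun x y hx hxy => by
    have h2 : 0 ≤ ∫ t in x..y, dV (rphi r φ) u₁ t ^ 2 :=
      intervalIntegral.integral_nonneg hxy fun _ _ => sq_nonneg _
    linarith [hJsub x y hx hxy]
  have hJB : ∀ v, u₁ ≤ v → J v ≤ 1 / q * M₁ + 1 / 2 * ((2 * M₁ / q + 1) / 2) ^ 2 := by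
    intro v hv
    have hmu' : ∀ v, u₁ < v → q ≤ 1 - massRatio r m u₁ v :=
      fun v hv => hmu u₁ le_rfl v hv u₁ ⟨h1, le_rfl⟩
    refine (h.integral_dV_rphi_sq_le h1 hv hq hmu').trans (add_le_add ?_ ?_)
    · exact mul_le_mul_of_nonneg_left (hM u₁ v h1 hv) (by positivity)
    · refine mul_le_mul_of_nonneg_left ?_ (by norm_num)
      rcases hv.eq_or_lt with rfl | hv'
      · rw [h.r_axis u₁ h1, zero_mul]
        positivity
      · exact h.r_mul_phi_sq_le (hφ0 u₁ le_rfl) (fun v hv => hM u₁ v h1 hv) hM0 h1 hq hmu' hv'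
  -- The squared L² norm of ∂_v(rφ) on C_{u₁} beyond U is below ℓη/2, so its share in the mass bound
  -- is at most η/2; the other half is the ε term.
  obtain ⟨U, hU, hJU⟩ := exists_sub_lt_of_bddAbove hJB (mul_pos hℓ (half_pos hη)) hJmono
  filter_upwards [eventually_ge_atTop U] with u hu V huV
  have hu1 : u₁ ≤ u := hU.trans hu
  have hu0 : 1 ≤ u := h1.trans hu1
  rcases huV.eq_or_lt with rfl | huV'
  · rw [h.m_axis u hu0]
    exact hη.le
  have hlu := (hu₁ u hu1).1.1
  have h2 := h.m_le h1 hu1 huV' hℓ hlu (fun x hx v hxv => hφε x hx.1 v hxv) (k := k) fun v hv => by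
    have hr := h.r_pos u v hu0 hv
    have e1 := h.lam_sub_le h1 hu1 hv hq
      (fun x hx => hM x v (h1.trans hx.1) (hx.2.trans hv.le)) hM0
      fun x hx => hmu u hu1 v hv x ⟨h1.trans hx.1, hx.2⟩
    have e2 := h.r_ge hu0 hv.le hlu
    have e3 := h.lam_le_half h1 (hu1.trans_lt hv)
    have e4 := h.lam_pos hu0 hv
    have e5 : (lam r u₁ v - lam r u v) * (v - u) ≤ M₁ / q / ℓ := by
      rw [le_div_iff₀ hℓ]
      have e6 := mul_le_mul_of_nonneg_right e1 (mul_nonneg hℓ.le (sub_nonneg.2 hv.le))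
      have e7 : M₁ / q * (r u v)⁻¹ * (ℓ * (v - u)) ≤ M₁ / q * (r u v)⁻¹ * r u v :=
        mul_le_mul_of_nonneg_left e2 (by positivity)
      rw [inv_mul_cancel_right₀ hr.ne'] at e7
      linarith
    rw [hkdef]
    linarith
  have h3 := hJU u V hu (hu1.trans huV)
  rw [hJsub u V hu1 huV] at h3
  have h4 := mul_le_mul_of_nonneg_left h3.le (by positivity : 0 ≤ 1 / ℓ)
  rw [← mul_assoc, one_div_mul_cancel hℓ.ne', one_mul] at h4
  linarith

theorem vanishingFinalBondiMass (h : IsBVSolution φ r m)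
    (hφ : Tendsto (fun v => φ 1 v) atTop (𝓝 0))
    (hdata : eVariationOn (dV (rphi r φ) 1) (Ioi 1) ≠ ⊤) (hN : ¬BlowsUpAtInfinity φ r)
    (hM : FiniteInitialBondiMass m) : VanishingFinalBondiMass m := by
  obtain ⟨M₁, hM₁⟩ := hM
  have hle : ∀ u v, 1 ≤ u → u ≤ v → m u v ≤ M₁ := fun u v hu huv => by
    refine (h.m_anti_u le_rfl hu huv).trans (ge_of_tendsto hM₁ ?_)
    filter_upwards [eventually_ge_atTop v] with y hy
    exact h.m_mono_v le_rfl (hu.trans huv) hy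
  -- m(u, ·) is nondecreasing, so its limit is its supremum; the maximum avoids v < u, where the
  -- values are meaningless.
  refine ⟨fun u => ⨆ v, m u (max u v), fun u hu => ?_, ?_⟩
  · have h1 : Tendsto (fun v => m u (max u v)) atTop (𝓝 (⨆ v, m u (max u v))) :=
      tendsto_atTop_ciSup
        (fun x y hxy => h.m_mono_v hu (le_max_left _ _) (max_le_max le_rfl hxy))
        ⟨M₁, by rintro _ ⟨v, rfl⟩; exact hle u _ hu (le_max_left _ _)⟩
    refine h1.congr' ?_
    filter_upwards [eventually_ge_atTop u] with v hv
    rw [max_eq_right hv]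
  · rw [Metric.tendsto_atTop']
    intro η hη
    obtain ⟨N, hN'⟩ := eventually_atTop.1 ((h.eventually_m_le hφ hdata hN hle
      (half_pos hη)).and (eventually_ge_atTop 1))
    refine ⟨N, fun u hu => ?_⟩
    obtain ⟨h1, h2⟩ := hN' u hu.le
    have h3 : ⨆ v, m u (max u v) ≤ η / 2 := ciSup_le fun v => h1 _ (le_max_left _ _)
    have h4 : 0 ≤ ⨆ v, m u (max u v) := Real.iSup_nonneg fun v => h.m_nonneg h2 (le_max_left _ _)
    rw [Real.dist_eq, sub_zero, abs_of_nonneg h4]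
    linarith

end IsBVSolution

end SSESF

/-! ### The dichotomy -/

theorem theorem3p3 (φ r m : ℝ → ℝ → ℝ)
    (hsol : SSESF.IsBVSolution φ r m)
    (hcomplete : SSESF.RadiallyComplete r m)
    (hφ : Tendsto (fun v => φ 1 v) atTop (𝓝 0))
    (hdata : eVariationOn (SSESF.dV (SSESF.rphi r φ) 1) (Ioi 1) +
      (⨆ v ∈ Ici (1 : ℝ), ENNReal.ofReal |SSESF.dV (SSESF.rphi r φ) 1 v|) < ⊤) :
    SSESF.BlowsUpAtInfinity φ r ∨
      (SSESF.ScattersInBV φ r ⊤ ∧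
        (SSESF.FiniteInitialBondiMass m → SSESF.VanishingFinalBondiMass m)) := by
  by_cases hN : SSESF.BlowsUpAtInfinity φ r
  · exact Or.inl hN
  have hvar : eVariationOn (SSESF.dV (SSESF.rphi r φ) 1) (Ioi 1) ≠ ⊤ :=
    (le_self_add.trans_lt hdata).ne
  exact Or.inr ⟨hsol.scattersInBV hφ hvar hN, hsol.vanishingFinalBondiMass hφ hvar hN⟩
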